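/- Let $\lambda:[0,\infty)\to(0,\infty)$ be $\mathcal C^2$ (the depth of the order book), let $\rho:[0,\infty)\to(0,\infty)$ be $\mathcal C^1$ (the resilience), and put $\eta_t=\lambda'(t)/\lambda(t)$. Let $S^0$ be a right-continuous martingale (the unaffected price) on a filtered probability space $(\Omega,\mathcal F,(\mathcal F_t)_{t\ge 0},\mathbb P)$. For $T>0$ and $x\in\mathbb R$, an admissible strategy for liquidating $x$ shares over $[0,T]$ is an adapted left-continuous process $(X_t)_{t\in[0,T+]}$ with $X_0=x$, $X_{T+}=0$, whose paths have finite total variation, bounded by a constant almost surely. In the block-shaped limit order book ($f\equiv1$) with price impact reversion (model $P$), the volume impact $E$ generated by $X$ is the solution of $dE_t=dX_t+(\eta_t-\rho_t)E_t\,dt$ with $E_0=0$; equivalently, the price impact $D_t=E_t/\lambda(t)$ satisfies $dD_t=-\rho_tD_t\,dt$ between trades, and a trade of size $\xi$ moves $E_t$ to $E_t+\xi$. With $\Delta X_t=X_{t+}-X_t$, the expected cost of $X$ is $$\mathcal C(X)=\mathbb E\left[\int_{[0,T]}\Big(S^0_t+\frac{E_t}{\lambda(t)}\Big)dX_t+\sum_{t\le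 T}\frac{(\Delta X_t)^2}{2\lambda(t)}\right].$$ Model $P$ admits price manipulation in the sense of Huberman and Stanzl over $[0,T]$ if $\mathcal C(X)<0$ for some admissible strategy $X$ with $x=0$. It admits transaction-triggered price manipulation over $[0,T]$ if, for some $x\in\mathbb R$, there is an admissible strategy $X$ for $x$ with $\mathcal C(X)<\inf\{\mathcal C(\tilde X):\tilde X \text{ admissible for } x \text{ and nonincreasing or nondecreasing}\}$. Then, for every $T>0$: 1. model $P$ does not admit price manipulation in the sense of Huberman and Stanzl over $[0,T]$ if and only if $2\rho_t-\eta_t\ge0$ for all $t\in[0,T]$; 2. model $P$ does not admit transaction-triggered price manipulation over $[0,T]$ if and only if, for all $t\in[0,T]$, $$\rho_t-\eta_t\ge0\quad\text{and}\quad\left(\frac{\rho_t-\eta_t}{2\rho_t-\eta_t}\right)'+\rho_t\,\frac{\rho_t-\eta_t}{2\rho_t-\eta_t}\ge0 .$$ Likewise, for all periods together: there is no Huberman–Stanzl price manipulation over any $[0,T]$ if and only if $2\rho_t-\eta_t\ge0$ for all $t\ge0$, and there is no transaction-triggered price manipulation over any $[0,T]$ if and only if the two inequalities in 2 hold for all $t\ge0$.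 (Derivatives at $t=0$ are one-sided.) -/

import Mathlib

open MeasureTheory Filter Set
open scoped NNReal ENNReal Topology

noncomputable section

namespace LOB

/-! ### Limit order book -/

/-- `F(y) = ∫₀^y f(x) dx`, the antiderivative of the shape function `f`. -/
def shapeF (f : ℝ → ℝ) (y : ℝ) : ℝ := ∫ x in (0 : ℝ)..y, f x

/-- `F⁻¹`; it is the two-sided inverse of `F` as soon as `F` is bijective. -/
def shapeFInv (f : ℝ → ℝ) : ℝ → ℝ := Function.invFun (shapeF f)

/-- `F̃(y) = ∫₀^y x f(x) dx`. -/
def shapeFTilde (f : ℝ → ℝ) (y : ℝ) : ℝ := ∫ x in (0 : ℝ)..y, x * f x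

/-- `G = F̃ ∘ F⁻¹`. -/
def shapeG (f : ℝ → ℝ) (e : ℝ) : ℝ := shapeFTilde f (shapeFInv f e)

/-- The shape of a block-shaped limit order book. -/
def blockShape : ℝ → ℝ := fun _ => 1

/-- `η = λ' / λ`; the derivative is taken in `[0, ∞)`, hence is one-sided at `0`. -/
def eta (lam : ℝ → ℝ) (t : ℝ) : ℝ := derivWithin lam (Ici 0) t / lam t

/-- The ratio `(ρ - η) / (2 ρ - η)`. -/
def ratio (lam rho : ℝ → ℝ) (t : ℝ) : ℝ :=
  (rho t - eta lam t) / (2 * rho t - eta lam t)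

/-! ### Trading strategies -/

/-- Admissible strategies for the liquidation of `x` shares over `[0, T]`.
`X t ω` is the number of shares that remain to be liquidated at time `t`. A process on
`[0, T+]` is encoded as a process on `[0, ∞)` which is constant on `(T, ∞)`, where it
takes the value at `T+`. -/
structure Strategy {Ω : Type*} {mΩ : MeasurableSpace Ω} (P : Measure Ω)
    (ℱ : Filtration ℝ≥0 mΩ) (T : ℝ≥0) (x : ℝ) where
  X : ℝ≥0 → Ω → ℝ
  initial : ∀ ω, X 0 ω = x
  terminal : ∀ t, T < t → ∀ ω, X t ω = 0
  adapted : StronglyAdapted ℱ X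
  left_continuous : ∀ ω t, ContinuousWithinAt (fun s => X s ω) (Iic t) t
  finite_variation : ∀ ω, BoundedVariationOn (fun s => X s ω) univ
  bounded_variation : ∃ M : ℝ≥0, ∀ᵐ ω ∂P, eVariationOn (fun s => X s ω) univ ≤ M

namespace Strategy

variable {Ω : Type*} {mΩ : MeasurableSpace Ω} {P : Measure Ω}
  {ℱ : Filtration ℝ≥0 mΩ} {T : ℝ≥0} {x : ℝ}

/-- The signed measure `dX(ω)`. Paths are left-continuous, so it gives mass `X_{t+} - X_s` to
`[s, t]`; in particular the first trade `X_{0+} - X_0` is a Dirac mass at `0`. -/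
def dX (X : Strategy P ℱ T x) (ω : Ω) : SignedMeasure ℝ≥0 :=
  (X.finite_variation ω).vectorMeasure

/-- The jump `ΔX_t = X_{t+} - X_t`. -/
def jump (X : Strategy P ℱ T x) (t : ℝ≥0) (ω : Ω) : ℝ :=
  Function.rightLim (fun s => X.X s ω) t - X.X t ω

/-- `X` is a pure sell program or a pure buy program. -/
def IsMonotone (X : Strategy P ℱ T x) : Prop :=
  (∀ᵐ ω ∂P, Antitone fun s => X.X s ω) ∨ (∀ᵐ ω ∂P, Monotone fun s => X.X s ω)

/-- `E` is the volume impact process on `[0, T]` generated by `X` in the model with price impact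
reversion, for a book of shape `f`, depth `lam` and resilience `rho`: with `D = F⁻¹(E / λ)` being
the price impact, `E_0 = 0` and
`dE = dX + η E dt - ρ λ f(D) D dt` (that is, `dD = -ρ D dt` between trades). -/
structure IsVolumeImpactP (f lam rho : ℝ → ℝ) (X : Strategy P ℱ T x)
    (E : ℝ≥0 → Ω → ℝ) : Prop where
  integrable : ∀ ω, IntervalIntegrable (fun s : ℝ =>
      eta lam s * E s.toNNReal ω
        - rho s * lam s * f (shapeFInv f (E s.toNNReal ω / lam s))
          * shapeFInv f (E s.toNNReal ω / lam s)) volume 0 T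
  dynamics : ∀ ω, ∀ t : ℝ≥0, t ≤ T → E t ω = X.X t ω - X.X 0 ω +
    ∫ s in (0 : ℝ)..t, (eta lam s * E s.toNNReal ω
        - rho s * lam s * f (shapeFInv f (E s.toNNReal ω / lam s))
          * shapeFInv f (E s.toNNReal ω / lam s))

/-- The cost of the path `X(ω)`, for the unaffected price `S` and the volume impact `E`. -/
def pathCost (f lam : ℝ → ℝ) (S : ℝ≥0 → Ω → ℝ) (X : Strategy P ℱ T x)
    (E : ℝ≥0 → Ω → ℝ) (ω : Ω) : ℝ :=
  (∫ᵛ t in Iic T, (S t ω + shapeFInv f (E t ω / lam t)) ∂•(X.dX ω)) +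
    ∑' t : Iic T,
      (lam (t : ℝ≥0) * (shapeG f ((E t ω + X.jump t ω) / lam (t : ℝ≥0))
          - shapeG f (E t ω / lam (t : ℝ≥0)))
        - shapeFInv f (E t ω / lam (t : ℝ≥0)) * X.jump t ω)

/-- The expected cost of a strategy. -/
def cost (f lam : ℝ → ℝ) (S : ℝ≥0 → Ω → ℝ) (X : Strategy P ℱ T x)
    (E : ℝ≥0 → Ω → ℝ) : ℝ :=
  ∫ ω, X.pathCost f lam S E ω ∂P

end Strategy

/-! ### Price manipulation in the model with price impact reversion -/

section Manipulation

variable {Ω : Type*} {mΩ : MeasurableSpace Ω}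

/-- A price manipulation strategy in the sense of Huberman and Stanzl exists over `[0, T]`:
a round trip with negative expected cost. -/
def AdmitsPMS (P : Measure Ω) (ℱ : Filtration ℝ≥0 mΩ) (S : ℝ≥0 → Ω → ℝ)
    (f lam rho : ℝ → ℝ) (T : ℝ≥0) : Prop :=
  ∃ (X : Strategy P ℱ T 0) (E : ℝ≥0 → Ω → ℝ),
    X.IsVolumeImpactP f lam rho E ∧ X.cost f lam S E < 0

/-- Transaction-triggered price manipulation is possible over `[0, T]`: for some position `x`, some
admissible strategy is strictly cheaper than the infimum of the expected costs of the pure sell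
and pure buy programs. -/
def AdmitsTTPM (P : Measure Ω) (ℱ : Filtration ℝ≥0 mΩ) (S : ℝ≥0 → Ω → ℝ)
    (f lam rho : ℝ → ℝ) (T : ℝ≥0) : Prop :=
  ∃ (x : ℝ) (X : Strategy P ℱ T x) (E : ℝ≥0 → Ω → ℝ),
    X.IsVolumeImpactP f lam rho E ∧
    (X.cost f lam S E : EReal) <
      sInf {c : EReal | ∃ (Y : Strategy P ℱ T x) (E' : ℝ≥0 → Ω → ℝ),
        Y.IsVolumeImpactP f lam rho E' ∧ Y.IsMonotone ∧ c = (Y.cost f lam S E' : EReal)}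

end Manipulation

end LOB

end

noncomputable section

namespace LOB

/-! ### Signed measures and Fubini-type formulas -/

/-! Write `γ = exp ∫ (ρ - η)` and `β = 1 / (γ² λ)`. The impact equation says `d(γE) = γ dX`, and the
cost of impact and jumps is `½ ∫ β d((γE)²)`. Integration by parts, with `E_{T+} = E_T - X_T`, turns
it into a quadratic functional of the path of `E` alone (`path_impact_cost`,
`IsImpact.impactCost_eq`): `(x + ∫ (ρ - η) E)² / (2 λ_T) + ∫ (2ρ - η) / (2λ) E²`. The martingale
contributes `-x 𝔼[S⁰_0]` for every strategy (`Strategy.integral_price`), so lower bounds may be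
proved path by path. Conversely every absolutely continuous `φ` is the impact on `(0, T]` of a
deterministic strategy (`Book.strategy`).

Round trips (`x = 0`): if `2ρ - η ≥ 0`, both terms are nonnegative. If `2ρ - η < 0` on an interval,
some `φ` supported there and orthogonal to `ρ - η` makes the first term vanish and the second
negative.

Transaction-triggered manipulation, with `w = (ρ - η) / (2ρ - η)`: if `ρ ≥ η`, then `2ρ - η > 0`,
and completing the square shows that the unique minimiser up to null sets is `φ = -c λ w`, where `c
= x / K` and `K` is the effective depth. Its holdings have slope `-c λ (w' + ρ w)` inside the
period, so they are monotone when `w' + ρ w ≥ 0`. If this fails on an interval, `γ λ w` decreases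
strictly there, whereas `γE` is nonincreasing for every sell program; hence `E` stays away from the
minimiser and sell programs cost more by a uniform amount. If `ρ < η` somewhere while `2ρ - η ≥ 0`,
sell programs have `E ≤ 0` and are bounded below through the positive part of `w`, but a positive
impact where `ρ < η` is strictly cheaper. If `2ρ - η < 0` somewhere, a profitable round trip beats
the monotone round trips, which do not trade. -/

instance isFiniteMeasure_variation {α : Type*} {mα : MeasurableSpace α} (m : SignedMeasure α) :
    IsFiniteMeasure m.variation := by
  rw [← m.totalVariation_eq_variation]; infer_instance

/-- The polar decomposition of a signed measure. -/
theorem exists_polar {α : Type*} {mα : MeasurableSpace α} (m : SignedMeasure α) :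
    ∃ h : α → ℝ, Measurable h ∧ (∀ x, |h x| = 1) ∧
      (∀ f : α → ℝ, Integrable f m.variation →
        ∫ᵛ x, f x ∂•m = ∫ x, f x * h x ∂m.variation) ∧
      ∀ s, MeasurableSet s → m s = ∫ x in s, h x ∂m.variation := by
  classical
  set j := m.toJordanDecomposition with hj
  have hm : j.posPart.toSignedMeasure - j.negPart.toSignedMeasure = m :=
    m.toSignedMeasure_toJordanDecomposition
  have hv : m.variation = j.posPart + j.negPart := by
    rw [← m.totalVariation_eq_variation]; rfl
  obtain ⟨S, hS, hpS, hnS⟩ := j.mutuallySingular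
  -- `S` is null for the positive part and `Sᶜ` for the negative part, so this sign is the density
  -- of `m` with respect to its variation.
  set h : α → ℝ := fun x => if x ∈ S then -1 else 1 with hh
  have hmeas : Measurable h := Measurable.ite hS measurable_const measurable_const
  have habs : ∀ x, |h x| = 1 := by
    intro x; by_cases hx : x ∈ S <;> simp [hh, hx]
  have hp : ∀ᵐ x ∂j.posPart, h x = 1 := by
    have : ∀ᵐ x ∂j.posPart, x ∉ S := measure_eq_zero_iff_ae_notMem.1 hpS
    filter_upwards [this] with x hx
    simp [hh, hx]
  have hn : ∀ᵐ x ∂j.negPart, h x = -1 := by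
    have : ∀ᵐ x ∂j.negPart, x ∉ Sᶜ := measure_eq_zero_iff_ae_notMem.1 hnS
    filter_upwards [this] with x hx
    have : x ∈ S := by simpa using hx
    simp [hh, this]
  have key : ∀ f : α → ℝ, Integrable f m.variation →
      ∫ x, f x * h x ∂m.variation = ∫ x, f x ∂j.posPart - ∫ x, f x ∂j.negPart := by
    intro f hf
    have hfh : Integrable (fun x => f x * h x) m.variation :=
      hf.mul_bdd (c := 1) hmeas.aestronglyMeasurable (ae_of_all _ fun x => by simp [habs x])
    rw [hv] at hfh ⊢
    rw [integral_add_measure hfh.left_of_add_measure hfh.right_of_add_measure, sub_eq_add_neg,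
      ← integral_neg]
    congr 1
    · exact integral_congr_ae (by filter_upwards [hp] with x hx; simp [hx])
    · exact integral_congr_ae (by filter_upwards [hn] with x hx; simp [hx])
  have hflip : (ContinuousLinearMap.lsmul ℝ ℝ : ℝ →L[ℝ] ℝ →L[ℝ] ℝ)
      = (ContinuousLinearMap.lsmul ℝ ℝ : ℝ →L[ℝ] ℝ →L[ℝ] ℝ).flip := by
    ext; simp
  refine ⟨h, hmeas, habs, fun f hf => ?_, fun s hs => ?_⟩
  · rw [key f hf]
    have hf' := hf
    rw [hv] at hf'
    conv_lhs => rw [← hm]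
    rw [VectorMeasure.integral_sub_vectorMeasure]
    · rw [hflip, VectorMeasure.integral_toSignedMeasure, VectorMeasure.integral_toSignedMeasure]
    · rw [VectorMeasure.Integrable, Measure.variation_toSignedMeasure]
      exact hf'.left_of_add_measure
    · rw [VectorMeasure.Integrable, Measure.variation_toSignedMeasure]
      exact hf'.right_of_add_measure
  · have h1 := key (s.indicator 1) ((integrable_const (1 : ℝ)).indicator hs)
    rw [integral_indicator_one hs, integral_indicator_one hs] at h1
    rw [m.apply_eq_posPart_real_sub_negPart_real hs, ← h1, ← integral_indicator hs]
    congr 1; ext x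
    by_cases hx : x ∈ s <;> simp [hx]

theorem integrable_mul_setIntegral_Iio {π : Measure ℝ≥0} [IsFiniteMeasure π] {g : ℝ≥0 → ℝ}
    (hg : Integrable g π) : Integrable (fun t => g t * ∫ u in Iio t, g u ∂π) π := by
  have h := ((hg.mul_prod hg).indicator (measurableSet_lt measurable_snd measurable_fst :
    MeasurableSet {p : ℝ≥0 × ℝ≥0 | p.2 < p.1})).integral_prod_left
  refine h.congr (ae_of_all _ fun t => ?_)
  simp only
  rw [← integral_const_mul, ← integral_indicator measurableSet_Iio]
  rfl

theorem integrable_mul_setIntegral_Iic {π : Measure ℝ≥0} [IsFiniteMeasure π] {g : ℝ≥0 → ℝ}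
    (hg : Integrable g π) : Integrable (fun t => g t * ∫ u in Iic t, g u ∂π) π := by
  have h := ((hg.mul_prod hg).indicator (measurableSet_le measurable_snd measurable_fst :
    MeasurableSet {p : ℝ≥0 × ℝ≥0 | p.2 ≤ p.1})).integral_prod_left
  refine h.congr (ae_of_all _ fun t => ?_)
  simp only
  rw [← integral_const_mul, ← integral_indicator measurableSet_Iic]
  rfl

/-- The product rule `d(G²) = (G₋ + G₊) dG`, integrated, for `dG = g dπ`. -/
theorem integral_mul_setIntegral_Iio_add_Iic {π : Measure ℝ≥0} [IsFiniteMeasure π] {g : ℝ≥0 → ℝ}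
    (hg : Integrable g π) :
    ∫ t, g t * (∫ u in Iio t, g u ∂π + ∫ u in Iic t, g u ∂π) ∂π = (∫ t, g t ∂π) ^ 2 := by
  have hgg : Integrable (fun p : ℝ≥0 × ℝ≥0 => g p.1 * g p.2) (π.prod π) := hg.mul_prod hg
  have hB : MeasurableSet {p : ℝ≥0 × ℝ≥0 | p.2 ≤ p.1} :=
    measurableSet_le measurable_snd measurable_fst
  have hBint := hgg.indicator hB
  have e2 : ∀ t, g t * ∫ u in Iic t, g u ∂π
      = ∫ u, {p : ℝ≥0 × ℝ≥0 | p.2 ≤ p.1}.indicator (fun p => g p.1 * g p.2) (t, u) ∂π := by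
    intro t
    rw [← integral_const_mul, ← integral_indicator measurableSet_Iic]
    rfl
  -- Exchanging the two variables turns `u ≤ t` into `t ≤ u`; then `Iio t` and `Ici t` partition the
  -- whole half-line, atoms on the diagonal being counted exactly once.
  have e3 : ∫ t, g t * ∫ u in Iic t, g u ∂π ∂π = ∫ t, g t * ∫ u in Ici t, g u ∂π ∂π := by
    simp_rw [e2]
    rw [integral_integral_swap (f := fun t u =>
      {p : ℝ≥0 × ℝ≥0 | p.2 ≤ p.1}.indicator (fun p => g p.1 * g p.2) (t, u)) hBint]
    congr 1; ext t
    rw [← integral_const_mul, ← integral_indicator measurableSet_Ici]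
    congr 1; ext u
    by_cases h : t ≤ u <;> simp [h, mul_comm]
  have i1 := integrable_mul_setIntegral_Iio hg
  have i2 := integrable_mul_setIntegral_Iic hg
  have i3 : ∀ t, ∫ u in Iio t, g u ∂π + ∫ u in Ici t, g u ∂π = ∫ u, g u ∂π := by
    intro t
    rw [← integral_add_compl measurableSet_Iio hg (s := Iio t), compl_Iio]
  have i4 : Integrable (fun t => g t * ∫ u in Ici t, g u ∂π) π := by
    have : (fun t => g t * ∫ u in Ici t, g u ∂π)
        = fun t => g t * (∫ u, g u ∂π) - g t * ∫ u in Iio t, g u ∂π := by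
      ext t; rw [← i3 t]; ring
    rw [this]
    exact (hg.mul_const _).sub i1
  simp_rw [mul_add]
  rw [integral_add i1 i2, e3, ← integral_add i1 i4]
  simp_rw [← mul_add, i3]
  rw [integral_mul_const, sq]

theorem setIntegral_Iic_mul_setIntegral_Iio_add_Iic {π : Measure ℝ≥0} [IsFiniteMeasure π]
    {g : ℝ≥0 → ℝ} (hg : Integrable g π) (s : ℝ≥0) :
    ∫ t in Iic s, g t * (∫ u in Iio t, g u ∂π + ∫ u in Iic t, g u ∂π) ∂π
      = (∫ t in Iic s, g t ∂π) ^ 2 := by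
  rw [← integral_mul_setIntegral_Iio_add_Iic hg.restrict]
  refine setIntegral_congr_fun measurableSet_Iic fun t ht => ?_
  rw [Measure.restrict_restrict measurableSet_Iio, Measure.restrict_restrict measurableSet_Iic,
    inter_eq_left.2 (Iio_subset_Iic_self.trans (Iic_subset_Iic.2 ht)), inter_eq_left.2 (Iic_subset_Iic.2 ht)]

/-- Integration of a function with density `-κ` against a finite measure. -/
theorem integral_mul_eq_add_intervalIntegral {π : Measure ℝ≥0} [IsFiniteMeasure π] {q : ℝ≥0 → ℝ}
    (hq : Integrable q π) {T : ℝ≥0} (hπ : π (Ioi T) = 0) {b κ : ℝ → ℝ} (hκ : Continuous κ)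
    (hb : ∀ s ∈ Icc (0 : ℝ) T, b s = b T + ∫ u in s..T, κ u) :
    ∫ t, b t * q t ∂π = b T * ∫ t, q t ∂π
      + ∫ s in (0 : ℝ)..T, κ s * ∫ u in Iic s.toNNReal, q u ∂π := by
  have hT : ∀ᵐ t ∂π, t ≤ T := by
    have : ∀ᵐ t ∂π, t ∉ Ioi T := measure_eq_zero_iff_ae_notMem.1 hπ
    filter_upwards [this] with t ht
    simpa using ht
  set V : Measure ℝ := volume.restrict (Ioc (0 : ℝ) T) with hV
  have hκi : Integrable κ V := (hκ.integrableOn_Icc).mono_set Ioc_subset_Icc_self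
  have hqκ : Integrable (fun p : ℝ≥0 × ℝ => q p.1 * κ p.2) (π.prod V) := hq.mul_prod hκi
  have hA : MeasurableSet {p : ℝ≥0 × ℝ | p.1 ≤ p.2.toNNReal} :=
    measurableSet_le measurable_fst (measurable_real_toNNReal.comp measurable_snd)
  have hAint := hqκ.indicator hA
  -- The inner integral becomes a section of the region `t ≤ u`, ready for Fubini. The two domains
  -- of integration differ at most at `u = 0`.
  have e1 : ∀ t : ℝ≥0, t ≤ T → q t * ∫ u in (t : ℝ)..T, κ u =
      ∫ u, {p : ℝ≥0 × ℝ | p.1 ≤ p.2.toNNReal}.indicator (fun p => q p.1 * κ p.2) (t, u) ∂V := by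
    intro t ht
    have ht' : (t : ℝ) ≤ T := ht
    rw [intervalIntegral.integral_of_le ht', ← integral_const_mul,
      ← integral_Icc_eq_integral_Ioc, hV]
    have h1 : ∀ u, {p : ℝ≥0 × ℝ | p.1 ≤ p.2.toNNReal}.indicator
        (fun p => q p.1 * κ p.2) (t, u)
          = {u : ℝ | t ≤ u.toNNReal}.indicator (fun u => q t * κ u) u := fun u => rfl
    simp_rw [h1]
    rw [integral_indicator (measurableSet_le measurable_const measurable_real_toNNReal),
      Measure.restrict_restrict (measurableSet_le measurable_const measurable_real_toNNReal)]
    apply setIntegral_congr_set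
    have h0 : ∀ᵐ u : ℝ, u ≠ 0 := by simp [ae_iff]
    filter_upwards [h0] with u hu
    apply propext
    show u ∈ Icc (t : ℝ) T ↔ t ≤ u.toNNReal ∧ u ∈ Ioc (0 : ℝ) T
    rw [mem_Icc, mem_Ioc]
    constructor
    · rintro ⟨h2, h3⟩
      have : 0 ≤ u := t.2.trans h2
      exact ⟨NNReal.le_toNNReal_of_coe_le h2, lt_of_le_of_ne this (Ne.symm hu), h3⟩
    · rintro ⟨h2, h3, h4⟩
      refine ⟨?_, h4⟩
      have := NNReal.coe_le_coe.2 h2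
      rwa [Real.coe_toNNReal _ h3.le] at this
  have e2 : ∫ t, b t * q t ∂π = ∫ t, (b T * q t +
      ∫ u, {p : ℝ≥0 × ℝ | p.1 ≤ p.2.toNNReal}.indicator (fun p => q p.1 * κ p.2) (t, u) ∂V) ∂π := by
    apply integral_congr_ae
    filter_upwards [hT] with t ht
    rw [← e1 t ht, hb t ⟨t.2, ht⟩]; ring
  rw [e2, integral_add (hq.const_mul _) hAint.integral_prod_left, integral_const_mul,
    integral_integral_swap (f := fun t u =>
      {p : ℝ≥0 × ℝ | p.1 ≤ p.2.toNNReal}.indicator (fun p => q p.1 * κ p.2) (t, u)) hAint,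
    intervalIntegral.integral_of_le T.coe_nonneg]
  congr 2
  ext s
  rw [← integral_const_mul, ← integral_indicator measurableSet_Iic]
  congr 1; ext u
  by_cases h : u ≤ s.toNNReal <;> simp [h, mul_comm]

theorem countable_atoms (π : Measure ℝ≥0) [IsFiniteMeasure π] :
    {t : ℝ≥0 | 0 < π {t}}.Countable :=
  Measure.countable_meas_pos_of_disjoint_iUnion (fun _ => measurableSet_singleton _)
    fun _ _ h => by simpa using h

/-- Lebesgue measure ignores the countably many atoms. The restriction `0 ≤ s` matters: `toNNReal`
sends all negative numbers to `0`, which may be an atom. -/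
theorem ae_toNNReal_not_atom (π : Measure ℝ≥0) [IsFiniteMeasure π] :
    ∀ᵐ s : ℝ, 0 ≤ s → π {s.toNNReal} = 0 := by
  have h1 : ((fun t : ℝ≥0 => (t : ℝ)) '' {t : ℝ≥0 | 0 < π {t}}).Countable :=
    (countable_atoms π).image _
  filter_upwards [h1.ae_notMem volume] with s hs h0
  by_contra h2
  exact hs ⟨s.toNNReal, pos_iff_ne_zero.2 h2, Real.coe_toNNReal s h0⟩

/-- An integral supported by the atoms is a sum over the atoms. -/
theorem integral_eq_tsum_of_atoms {π : Measure ℝ≥0} [IsFiniteMeasure π] {f : ℝ≥0 → ℝ}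
    (hf : Integrable f π) (h0 : ∀ t, π {t} = 0 → f t = 0) :
    ∫ t, f t ∂π = ∑' t, π.real {t} * f t := by
  set A := {t : ℝ≥0 | 0 < π {t}} with hA
  have hAc : A.Countable := countable_atoms π
  have h1 : ∫ t, f t ∂π = ∫ t in A, f t ∂π := by
    rw [setIntegral_eq_integral_of_forall_compl_eq_zero]
    intro t ht
    exact h0 t (by simpa [hA] using ht)
  have h2 : ∑' t, π.real {t} * f t = ∑' t : A, π.real {(t : ℝ≥0)} * f t := by
    rw [tsum_subtype A (fun t => π.real {t} * f t)]
    congr 1; ext t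
    by_cases ht : t ∈ A
    · simp [ht]
    · have : π {t} = 0 := by simpa [hA] using ht
      simp [ht, h0 t this]
  have : Countable A := hAc.to_subtype
  have h3 : A = ⋃ a : A, {(a : ℝ≥0)} := by ext; simp
  rw [h1, h2]
  conv_lhs => rw [h3]
  rw [integral_iUnion (fun _ => measurableSet_singleton _) (fun a b hab => by
    simpa [Function.onFun] using fun h => hab (Subtype.ext h)) hf.integrableOn]
  simp [Measure.real]

/-! ### Depth and resilience extended to the real line -/

/-- A depth `L` with logarithmic derivative `n`, and a resilience `r`, on the real line. -/
structure Book where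
  L : ℝ → ℝ
  r : ℝ → ℝ
  n : ℝ → ℝ
  continuous_r : Continuous r
  continuous_n : Continuous n
  hasDerivAt_L : ∀ t, HasDerivAt L (n t * L t) t
  L_pos : ∀ t, 0 < L t

namespace Book

variable (M : Book)

/-- The integrating factor of `dE = dX + (n - r) E dt`. -/
def gam (t : ℝ) : ℝ := Real.exp (∫ s in (0 : ℝ)..t, (M.r s - M.n s))

theorem gam_pos (t : ℝ) : 0 < M.gam t := Real.exp_pos _

theorem continuous_sub : Continuous fun s => M.r s - M.n s := M.continuous_r.sub M.continuous_n

theorem hasDerivAt_gam (t : ℝ) : HasDerivAt M.gam ((M.r t - M.n t) * M.gam t) t := by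
  have h := (intervalIntegral.integral_hasDerivAt_right
    (M.continuous_sub.intervalIntegrable 0 t)
    (M.continuous_sub.stronglyMeasurableAtFilter _ _) M.continuous_sub.continuousAt).exp
  rw [mul_comm]
  exact h

theorem continuous_gam : Continuous M.gam :=
  continuous_iff_continuousAt.2 fun t => (M.hasDerivAt_gam t).continuousAt

theorem continuous_L : Continuous M.L :=
  continuous_iff_continuousAt.2 fun t => (M.hasDerivAt_L t).continuousAt

/-- The weight of `d((γ E)²) / 2` in the cost. -/
def bet (t : ℝ) : ℝ := (M.gam t ^ 2 * M.L t)⁻¹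

theorem hasDerivAt_bet (t : ℝ) : HasDerivAt M.bet (-((2 * M.r t - M.n t) * M.bet t)) t := by
  have hg := (M.gam_pos t).ne'
  have hL := (M.L_pos t).ne'
  have h := (((M.hasDerivAt_gam t).pow 2).mul (M.hasDerivAt_L t)).inv
    (mul_ne_zero (pow_ne_zero 2 hg) hL)
  refine HasDerivAt.congr_deriv (f := M.bet) h ?_
  simp only [bet, Pi.mul_apply, Pi.pow_apply]
  field_simp
  push_cast
  ring

theorem continuous_bet : Continuous M.bet :=
  continuous_iff_continuousAt.2 fun t => (M.hasDerivAt_bet t).continuousAt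

theorem continuous_two_mul_sub : Continuous fun s => 2 * M.r s - M.n s :=
  (continuous_const.mul M.continuous_r).sub M.continuous_n

/-- The volume impact of a path of holdings. -/
structure IsImpact (T : ℝ≥0) (X E : ℝ≥0 → ℝ) : Prop where
  integrable : IntervalIntegrable (fun s : ℝ => (M.n s - M.r s) * E s.toNNReal) volume 0 T
  dynamics : ∀ t ≤ T, E t = X t - X 0 + ∫ s in (0 : ℝ)..t, (M.n s - M.r s) * E s.toNNReal

variable {M} {T : ℝ≥0} {X E : ℝ≥0 → ℝ}

/-- Variation of constants. -/
theorem IsImpact.gam_mul (h : M.IsImpact T X E) {t : ℝ≥0} (ht : t ≤ T) :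
    M.gam t * E t = M.gam t * (X t - X 0)
      - ∫ s in (0 : ℝ)..t, (M.r s - M.n s) * M.gam s * (X s.toNNReal - X 0) := by
  have ht' : (t : ℝ) ≤ T := ht
  set y : ℝ → ℝ := fun s => (M.n s - M.r s) * E s.toNNReal with hy
  have hyi : IntervalIntegrable y volume 0 t := h.integrable.mono_set (by
    rw [uIcc_of_le t.coe_nonneg, uIcc_of_le T.coe_nonneg]
    exact Icc_subset_Icc_right ht')
  set Y : ℝ → ℝ := fun s => ∫ v in (0 : ℝ)..s, y v with hY
  have hYac : AbsolutelyContinuousOnInterval Y 0 t :=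
    hyi.absolutelyContinuousOnInterval_intervalIntegral (by simp)
  have hgac : AbsolutelyContinuousOnInterval M.gam 0 t := by
    have hd : ContDiffOn ℝ 1 M.gam (uIcc 0 t) := by
      apply ContDiff.contDiffOn
      rw [contDiff_one_iff_deriv]
      refine ⟨fun s => (M.hasDerivAt_gam s).differentiableAt, ?_⟩
      have : deriv M.gam = fun s => (M.r s - M.n s) * M.gam s :=
        funext fun s => (M.hasDerivAt_gam s).deriv
      rw [this]
      exact M.continuous_sub.mul M.continuous_gam
    exact hd.absolutelyContinuousOnInterval
  have h1 := AbsolutelyContinuousOnInterval.integral_deriv_mul_eq_sub hgac hYac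
  -- Since `E = X - X 0 + Y`, the terms in `Y` cancel in `(γY)'` and only the known path `X` is
  -- left. The path `E` may jump, but `Y` is absolutely continuous, so the product rule holds almost
  -- everywhere and integrates.
  have h2 : ∫ s in (0 : ℝ)..t, (deriv M.gam s * Y s + M.gam s * deriv Y s)
      = ∫ s in (0 : ℝ)..t, -((M.r s - M.n s) * M.gam s * (X s.toNNReal - X 0)) := by
    apply intervalIntegral.integral_congr_ae
    filter_upwards [hyi.ae_hasDerivAt_integral] with s hs hst
    have hst' : s ∈ uIcc (0 : ℝ) t := uIoc_subset_uIcc hst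
    rw [uIcc_of_le t.coe_nonneg] at hst'
    rw [(hs (uIoc_subset_uIcc hst) 0 (by simp)).deriv, (M.hasDerivAt_gam s).deriv]
    have h3 := h.dynamics s.toNNReal (Real.toNNReal_le_iff_le_coe.2 (hst'.2.trans ht'))
    rw [Real.coe_toNNReal s hst'.1] at h3
    have h4 : Y s = E s.toNNReal - (X s.toNNReal - X 0) := by rw [h3]; simp [hY, hy]
    rw [h4, hy]; ring
  rw [h2, intervalIntegral.integral_neg] at h1
  have h5 : E t = X t - X 0 + Y t := h.dynamics t ht
  have h6 : Y 0 = 0 := by simp [hY]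
  rw [h6] at h1
  rw [h5, mul_add]
  linarith

end Book

/-! ### The cost of a path -/

section Path

variable {X : ℝ≥0 → ℝ} (hX : BoundedVariationOn X univ)

theorem vectorMeasure_Iio_eq (hl : ∀ t, ContinuousWithinAt X (Iic t) t) (t : ℝ≥0) :
    hX.vectorMeasure (Iio t) = X t - X 0 := by
  -- The boundary term is a limit along `atBot`, which on `ℝ≥0` is the pure filter at `0`. It equals
  -- `X 0`, not `X_{0+}`, so the first trade is counted.
  rw [hX.vectorMeasure_Iio, (hl t).leftLim_eq, OrderBot.atBot_eq]
  congr 1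
  exact (tendsto_pure_nhds X ⊥).limUnder_eq

theorem vectorMeasure_Ico_eq (hl : ∀ t, ContinuousWithinAt X (Iic t) t) {s t : ℝ≥0} (h : s ≤ t) :
    hX.vectorMeasure (Ico s t) = X t - X s := by
  rw [hX.vectorMeasure_Ico h, (hl t).leftLim_eq, (hl s).leftLim_eq]

theorem vectorMeasure_singleton_eq (hl : ∀ t, ContinuousWithinAt X (Iic t) t) (t : ℝ≥0) :
    hX.vectorMeasure {t} = Function.rightLim X t - X t := by
  rw [hX.vectorMeasure_singleton, (hl t).leftLim_eq]

theorem rightLim_eq_zero_of_terminal {X : ℝ≥0 → ℝ} {T : ℝ≥0} (hT : ∀ t, T < t → X t = 0) :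
    Function.rightLim X T = 0 := by
  have : (𝓝[>] T).NeBot := inferInstance
  apply rightLim_eq_of_tendsto
  refine tendsto_const_nhds.congr' ?_
  filter_upwards [self_mem_nhdsWithin] with t ht
  exact (hT t ht).symm

variable {M : Book} {T : ℝ≥0} {E : ℝ≥0 → ℝ}

theorem integrable_restrict_Iic_of_continuous {f : ℝ → ℝ} (hf : Continuous f) (ν : Measure ℝ≥0)
    [IsFiniteMeasure ν] (T : ℝ≥0) : Integrable (fun t : ℝ≥0 => f t) (ν.restrict (Iic T)) := by
  have h : IntegrableOn (fun t : ℝ≥0 => f t) (Icc 0 T) ν :=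
    (hf.comp NNReal.continuous_coe).continuousOn.integrableOn_compact isCompact_Icc
  rwa [show Icc 0 T = Iic T from Icc_bot] at h

theorem exists_abs_le_of_continuous {f : ℝ → ℝ} (hf : Continuous f) (T : ℝ) :
    ∃ C, ∀ s ∈ Icc (0 : ℝ) T, |f s| ≤ C :=
  isCompact_Icc.exists_bound_of_continuousOn hf.continuousOn

/-- `γ E` is the integral of `γ dX`. -/
theorem gam_mul_impact_eq_setIntegral (hl : ∀ t, ContinuousWithinAt X (Iic t) t)
    (hE : M.IsImpact T X E) {h : ℝ≥0 → ℝ} (hm : Measurable h) (h1 : ∀ x, |h x| = 1)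
    (hset : ∀ s, MeasurableSet s →
      hX.vectorMeasure s = ∫ x in s, h x ∂hX.vectorMeasure.variation)
    {t : ℝ≥0} (ht : t ≤ T) :
    ∫ u in Iio t, M.gam u * h u ∂hX.vectorMeasure.variation = M.gam t * E t := by
  set ν := hX.vectorMeasure.variation with hν
  have hh : Integrable h (ν.restrict (Iio t)) :=
    (integrable_const (1 : ℝ)).mono' hm.aestronglyMeasurable
      (ae_of_all _ fun x => by simp [h1 x])
  have hκ : Continuous fun s => -((M.r s - M.n s) * M.gam s) :=
    (M.continuous_sub.mul M.continuous_gam).neg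
  -- Integration by parts of `γ` against `dX` on `[0, t)`; the outcome is matched with the
  -- variation-of-constants formula `IsImpact.gam_mul`.
  have key := integral_mul_eq_add_intervalIntegral (π := ν.restrict (Iio t)) hh (T := t)
    (by
      rw [Measure.restrict_apply measurableSet_Ioi, (Ioi_disjoint_Iio_same).inter_eq, measure_empty])
    (b := M.gam) hκ (by
      intro s _
      rw [intervalIntegral.integral_neg, intervalIntegral.integral_eq_sub_of_hasDerivAt
        (fun u _ => M.hasDerivAt_gam u)
        ((M.continuous_sub.mul M.continuous_gam).intervalIntegrable _ _)]
      ring)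
  rw [key, ← hset _ measurableSet_Iio, vectorMeasure_Iio_eq hX hl, hE.gam_mul ht,
    sub_eq_add_neg (M.gam t * (X t - X 0)), ← intervalIntegral.integral_neg]
  congr 1
  apply intervalIntegral.integral_congr_ae
  have hne : ∀ᵐ s : ℝ, s ≠ t := by simp [ae_iff]
  -- At a time without atom, `Iic s` has the same mass `X s - X 0` as `Iio s`; excluding `s = t`
  -- keeps `Iic s` inside `Iio t`.
  filter_upwards [ae_toNNReal_not_atom ν, hne] with s hs hst hs'
  rw [uIoc_of_le t.coe_nonneg] at hs'
  have hlt : s.toNNReal < t := by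
    rw [Real.toNNReal_lt_iff_lt_coe hs'.1.le]
    exact lt_of_le_of_ne hs'.2 hst
  rw [Measure.restrict_restrict measurableSet_Iic,
    inter_eq_left.2 (Iic_subset_Iio.2 hlt),
    ← vectorMeasure_Iio_eq hX hl, hset _ measurableSet_Iio]
  rw [setIntegral_congr_set (s := Iic s.toNNReal) (t := Iio s.toNNReal)]
  · ring
  · exact (Iio_ae_eq_Iic' (hs hs'.1.le)).symm

/-- The cost of a path, the unaffected price being omitted. -/
theorem path_impact_cost (hl : ∀ t, ContinuousWithinAt X (Iic t) t)
    (hT : ∀ t, T < t → X t = 0) (hE : M.IsImpact T X E) :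
    (hX.vectorMeasure.restrict (Iic T)).Integrable (fun t => E t / M.L t) ∧
    ∫ᵛ t in Iic T, E t / M.L t ∂•hX.vectorMeasure
      + ∑' t : Iic T, (Function.rightLim X t - X t) ^ 2 / (2 * M.L (t : ℝ≥0))
      = (E T - X T) ^ 2 / (2 * M.L T)
        + ∫ s in (0 : ℝ)..T, (2 * M.r s - M.n s) / (2 * M.L s) * E s.toNNReal ^ 2 := by
  obtain ⟨h, hm, h1, hint, hset⟩ := exists_polar hX.vectorMeasure
  set ν := hX.vectorMeasure.variation with hν
  set π := ν.restrict (Iic T) with hπ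
  set g : ℝ≥0 → ℝ := fun t => M.gam t * h t with hg
  have hh1 : ∀ t, h t * h t = 1 := fun t => by rw [← abs_mul_abs_self, h1]; norm_num
  have hgi : Integrable g π :=
    (integrable_restrict_Iic_of_continuous M.continuous_gam ν T).mul_bdd (c := 1)
      hm.aestronglyMeasurable (ae_of_all _ fun x => by simp [h1 x])
  set J : ℝ≥0 → ℝ := fun t => Function.rightLim X t - X t with hJ
  have hJh : ∀ t, J t = ν.real {t} * h t := by
    intro t
    rw [hJ]
    simp only
    rw [← vectorMeasure_singleton_eq hX hl, hset _ (measurableSet_singleton t)]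
    simp [Measure.real]
  have hG : ∀ t ≤ T, ∫ u in Iio t, g u ∂π = M.gam t * E t := by
    intro t ht
    rw [← gam_mul_impact_eq_setIntegral hX hl hE hm h1 hset ht, hπ,
      Measure.restrict_restrict measurableSet_Iio,
      inter_eq_left.2 (Iio_subset_Iic_self.trans (Iic_subset_Iic.2 ht))]
  have hG' : ∀ t ≤ T, ∫ u in Iic t, g u ∂π = M.gam t * (E t + J t) := by
    intro t ht
    rw [← Iio_union_right, setIntegral_union (by simp) (measurableSet_singleton t)
      hgi.integrableOn hgi.integrableOn, hG t ht, mul_add, hJh t]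
    have : π.restrict {t} = ν.restrict {t} := by
      rw [hπ, Measure.restrict_restrict (measurableSet_singleton t),
        inter_eq_left.2 (singleton_subset_iff.2 (mem_Iic.2 ht))]
    rw [this]
    simp [Measure.real, hg]
    ring
  -- The density of `d((γE)²)` with respect to `π`: the two integrals are `γE` before and after the
  -- trade at `t`.
  set q : ℝ≥0 → ℝ := fun t => g t * (∫ u in Iio t, g u ∂π + ∫ u in Iic t, g u ∂π) with hq
  have i1 := integrable_mul_setIntegral_Iio hgi
  have i2 := integrable_mul_setIntegral_Iic hgi
  have hqi : Integrable q π := by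
    have := i1.add i2
    refine this.congr (ae_of_all _ fun t => ?_)
    simp [hq, mul_add]
  have hTae : ∀ᵐ t ∂π, t ≤ T := ae_restrict_mem measurableSet_Iic
  obtain ⟨C, hC⟩ := exists_abs_le_of_continuous M.continuous_bet T
  have hbm : AEStronglyMeasurable (fun t : ℝ≥0 => M.bet t) π :=
    (M.continuous_bet.comp NNReal.continuous_coe).aestronglyMeasurable
  have hbb : ∀ᵐ t : ℝ≥0 ∂π, ‖M.bet t‖ ≤ C := by
    filter_upwards [hTae] with t ht using hC t ⟨t.2, ht⟩
  -- The identity `β γ² = 1 / L` converts impact costs into `β`-weighted increments of `(γE)²`.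
  have hLg : ∀ t, (M.bet t * M.gam t) * M.gam t = (M.L t)⁻¹ := by
    intro t
    have := (M.gam_pos t).ne'
    have := (M.L_pos t).ne'
    simp only [Book.bet]
    field_simp
  -- integrability of the integrand against `h dν`
  have iE : Integrable (fun t => E t / M.L t * h t) π := by
    refine (i1.bdd_mul hbm hbb).congr ?_
    filter_upwards [hTae] with t ht
    rw [hG t ht, div_eq_mul_inv, ← hLg t, hg]
    ring
  have iE' : Integrable (fun t => E t / M.L t) π := by
    refine (iE.mul_bdd (c := 1) (g := h) hm.aestronglyMeasurable
      (ae_of_all _ fun x => by simp [h1 x])).congr (ae_of_all _ fun t => ?_)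
    simp only
    rw [mul_assoc, hh1, mul_one]
  have iJ : Integrable (fun t => h t * J t / (2 * M.L t)) π := by
    refine (((i2.sub i1).bdd_mul hbm hbb).div_const 2).congr ?_
    filter_upwards [hTae] with t ht
    simp only [Pi.sub_apply]
    rw [hG t ht, hG' t ht, hg, mul_comm 2, ← div_div, div_eq_mul_inv _ (M.L t), ← hLg t]
    ring
  have hvint : (hX.vectorMeasure.restrict (Iic T)).Integrable (fun t => E t / M.L t) := by
    rw [VectorMeasure.Integrable, VectorMeasure.variation_restrict measurableSet_Iic]
    exact iE'
  refine ⟨hvint, ?_⟩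
  have s1 : ∫ᵛ t in Iic T, E t / M.L t ∂•hX.vectorMeasure = ∫ t, E t / M.L t * h t ∂π := by
    rw [← VectorMeasure.integral_indicator measurableSet_Iic, hint _
      ((integrable_indicator_iff measurableSet_Iic).2 iE'), hπ,
      ← integral_indicator measurableSet_Iic]
    congr 1; ext t
    by_cases ht : t ∈ Iic T
    · simp only [indicator_of_mem ht]
    · simp only [indicator_of_notMem ht, zero_mul]
  -- Since `J t = ν{t} h t`, the square `J²` is `ν{t}` times `h J`, and `J` vanishes off the atoms;
  -- the sum of jump costs is therefore an integral.
  have s2 : ∑' t : Iic T, (Function.rightLim X t - X t) ^ 2 / (2 * M.L (t : ℝ≥0))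
      = ∫ t, h t * J t / (2 * M.L t) ∂π := by
    have iJ' : Integrable ((Iic T).indicator fun t : ℝ≥0 => h t * J t / (2 * M.L t)) ν :=
      (integrable_indicator_iff measurableSet_Iic).2 iJ
    rw [hπ, ← integral_indicator measurableSet_Iic, integral_eq_tsum_of_atoms iJ',
      tsum_subtype (Iic T) (fun t : ℝ≥0 => (Function.rightLim X t - X t) ^ 2 / (2 * M.L t))]
    · congr 1; ext t
      by_cases ht : t ∈ Iic T
      · simp only [indicator_of_mem ht]
        change J t ^ 2 / _ = _
        rw [sq]
        nth_rewrite 1 [hJh t]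
        ring
      · simp only [indicator_of_notMem ht, mul_zero]
    · intro t ht
      have : J t = 0 := by rw [hJh t, Measure.real, ht]; simp
      simp [indicator, this]
  rw [s1, s2, ← integral_add iE iJ]
  -- The jump cost replaces `E` by `E + J / 2`, the midpoint of the impacts before and after a
  -- trade. This makes the total exactly half of `β d((γE)²)`.
  have s3 : ∫ t, (E t / M.L t * h t + h t * J t / (2 * M.L t)) ∂π
      = (∫ t : ℝ≥0, M.bet t * q t ∂π) / 2 := by
    rw [← integral_div]
    apply integral_congr_ae
    filter_upwards [hTae] with t ht
    rw [hq]
    simp only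
    rw [hG t ht, hG' t ht, hg, mul_comm 2, ← div_div, div_eq_mul_inv _ (M.L t),
      div_eq_mul_inv _ (M.L t), ← hLg t]
    ring
  have hκ : Continuous fun s => (2 * M.r s - M.n s) * M.bet s :=
    M.continuous_two_mul_sub.mul M.continuous_bet
  rw [s3, integral_mul_eq_add_intervalIntegral hqi (T := T)
    (by rw [hπ, Measure.restrict_apply measurableSet_Ioi, Ioi_inter_Iic, Ioc_self, measure_empty])
    hκ (by
      intro s _
      have := intervalIntegral.integral_eq_sub_of_hasDerivAt
        (fun u _ => M.hasDerivAt_bet u) (hκ.neg.intervalIntegrable s T)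
      rw [intervalIntegral.integral_neg] at this
      linarith)]
  -- The trade at `T` clears the remaining `X T` shares, so the impact after it is `E T - X T`.
  have s4 : ∫ t, q t ∂π = (M.gam T * (E T - X T)) ^ 2 := by
    rw [hq, integral_mul_setIntegral_Iio_add_Iic hgi]
    have : ∫ t, g t ∂π = ∫ t in Iic T, g t ∂π := by
      rw [hπ, Measure.restrict_restrict measurableSet_Iic, inter_self]
    rw [this, hG' T le_rfl, hJ]
    simp only
    rw [rightLim_eq_zero_of_terminal hT, zero_sub, sub_eq_add_neg]
  have s5 : ∫ s in (0 : ℝ)..T, (2 * M.r s - M.n s) * M.bet s * ∫ u in Iic s.toNNReal, q u ∂π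
      = 2 * ∫ s in (0 : ℝ)..T, (2 * M.r s - M.n s) / (2 * M.L s) * E s.toNNReal ^ 2 := by
    rw [← intervalIntegral.integral_const_mul]
    apply intervalIntegral.integral_congr_ae
    filter_upwards [ae_toNNReal_not_atom ν] with s hs hs'
    rw [uIoc_of_le T.coe_nonneg] at hs'
    have hsT : s.toNNReal ≤ T := Real.toNNReal_le_iff_le_coe.2 hs'.2
    have hJ0 : J s.toNNReal = 0 := by
      rw [hJh, Measure.real, hs hs'.1.le]; simp
    rw [hq, setIntegral_Iic_mul_setIntegral_Iio_add_Iic hgi, hG' _ hsT, hJ0, add_zero,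
      Real.coe_toNNReal s hs'.1.le, mul_comm 2 (M.L s), ← div_div, div_eq_mul_inv _ (M.L s),
      ← hLg s]
    ring
  rw [s4, s5, mul_comm 2 (M.L T), ← div_div _ (M.L T), div_eq_mul_inv _ (M.L T), ← hLg T]
  ring

end Path

/-! ### Right-continuous martingales -/

/-- The dyadic number `k / 2 ^ n`. -/
def dyadic (n k : ℕ) : ℝ≥0 := k / 2 ^ n

theorem monotone_dyadic (n : ℕ) : Monotone (dyadic n) := fun a b h => by
  unfold dyadic; gcongr

theorem dyadic_two_mul_succ (n k : ℕ) : dyadic (n + 1) (2 * k) = dyadic n k := by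
  unfold dyadic
  rw [pow_succ]
  push_cast
  field_simp

theorem dyadic_mul_pow (n N : ℕ) : dyadic n (N * 2 ^ n) = N := by
  unfold dyadic; push_cast; field_simp

/-- The smallest dyadic number of level `n` to the right of `t`. -/
def rightDyadic (n : ℕ) (t : ℝ≥0) : ℝ≥0 := dyadic n (⌊t * 2 ^ n⌋₊ + 1)

theorem lt_rightDyadic (n : ℕ) (t : ℝ≥0) : t < rightDyadic n t := by
  unfold rightDyadic dyadic
  rw [lt_div_iff₀ (by positivity)]
  exact_mod_cast Nat.lt_floor_add_one (t * 2 ^ n)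

theorem rightDyadic_le_add (n : ℕ) (t : ℝ≥0) : rightDyadic n t ≤ t + (2 ^ n)⁻¹ := by
  unfold rightDyadic dyadic
  push_cast
  rw [add_div, one_div]
  gcongr
  rw [div_le_iff₀ (by positivity)]
  exact Nat.floor_le (by positivity)

theorem floor_lt_of_lt {n N : ℕ} {t : ℝ≥0} (h : t < N) : ⌊t * 2 ^ n⌋₊ < N * 2 ^ n := by
  rw [Nat.floor_lt (by positivity)]
  push_cast
  gcongr

theorem mem_Ico_dyadic_iff {n k : ℕ} {t : ℝ≥0} :
    t ∈ Ico (dyadic n k) (dyadic n (k + 1)) ↔ ⌊t * 2 ^ n⌋₊ = k := by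
  unfold dyadic
  rw [Nat.floor_eq_iff (by positivity), mem_Ico, div_le_iff₀ (by positivity),
    lt_div_iff₀ (by positivity)]
  push_cast
  rfl

theorem tendsto_rightDyadic (t : ℝ≥0) :
    Tendsto (fun n => rightDyadic n t) atTop (𝓝[≥] t) := by
  rw [tendsto_nhdsWithin_iff]
  refine ⟨?_, Eventually.of_forall fun n => (lt_rightDyadic n t).le⟩
  refine tendsto_of_tendsto_of_tendsto_of_le_of_le (g := fun _ => t)
    (h := fun n : ℕ => t + (2 ^ n)⁻¹) tendsto_const_nhds ?_
    (fun n => (lt_rightDyadic n t).le) (fun n => rightDyadic_le_add n t)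
  have h : Tendsto (fun n : ℕ => ((2 : ℝ≥0)⁻¹) ^ n) atTop (𝓝 0) :=
    NNReal.tendsto_pow_atTop_nhds_zero_of_lt_one (by
      rw [← NNReal.coe_lt_coe]; norm_num)
  simp_rw [inv_pow] at h
  simpa using tendsto_const_nhds (x := t).add h

section

variable {Ω : Type*} {mΩ : MeasurableSpace Ω} {P : Measure Ω} [IsProbabilityMeasure P]
  {ℱ : Filtration ℝ≥0 mΩ} {S : ℝ≥0 → Ω → ℝ}

/-- Doob's maximal inequality for the nonnegative submartingale `|S|`, sampled on the grid of level
`n`. The right-hand side does not depend on `n`, so the grid can be refined. -/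
theorem measure_exists_dyadic_le (hS : Martingale S ℱ P) (N n m : ℕ) :
    m * P {ω | ∃ k ≤ N * 2 ^ n, (m : ℝ) ≤ |S (dyadic n k) ω|}
      ≤ ENNReal.ofReal (∫ ω, |S N ω| ∂P) := by
  let 𝒢 : Filtration ℕ mΩ :=
    ⟨fun k => ℱ (dyadic n k), fun a b h => ℱ.mono (monotone_dyadic n h), fun k => ℱ.le _⟩
  have hM : Martingale (fun k => S (dyadic n k)) 𝒢 P :=
    ⟨fun k => hS.1 _, fun i j h => hS.2 _ _ (monotone_dyadic n h)⟩
  have hsub : Submartingale ((fun k => S (dyadic n k)) ⊔ -(fun k => S (dyadic n k))) 𝒢 P :=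
    hM.submartingale.sup hM.neg.submartingale
  have h := maximal_ineq hsub (fun k ω => by
    simp only [Pi.sup_apply, Pi.neg_apply, Pi.zero_apply]
    exact abs_nonneg (S (dyadic n k) ω)) (ε := m) (N * 2 ^ n)
  have hset : {ω | ∃ k ≤ N * 2 ^ n, (m : ℝ) ≤ |S (dyadic n k) ω|}
      = {ω | (((m : ℝ≥0) : ℝ)) ≤ (Finset.range (N * 2 ^ n + 1)).sup' Finset.nonempty_range_add_one
        fun k => ((fun k => S (dyadic n k)) ⊔ -(fun k => S (dyadic n k))) k ω} := by
    ext ω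
    simp only [mem_ofPred_eq, Finset.le_sup'_iff, Finset.mem_range, Nat.lt_succ_iff]
    rfl
  rw [hset]
  refine (le_of_eq_of_le ?_ h).trans (ENNReal.ofReal_le_ofReal ?_)
  · simp
  · have : ∀ ω, ((fun k => S (dyadic n k)) ⊔ -(fun k => S (dyadic n k))) (N * 2 ^ n) ω
        = |S N ω| := by
      intro ω
      show |S (dyadic n (N * 2 ^ n)) ω| = _
      rw [dyadic_mul_pow]
    simp_rw [this]
    exact setIntegral_le_integral (hS.integrable _).abs (ae_of_all _ fun ω => abs_nonneg _)

/-- The paths of a right-continuous martingale are almost surely bounded on bounded intervals. -/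
theorem ae_exists_bound (hS : Martingale S ℱ P)
    (hSr : ∀ ω t, ContinuousWithinAt (fun s => S s ω) (Ici t) t) (N : ℕ) :
    ∀ᵐ ω ∂P, ∃ C, (∀ n, ∀ t : ℝ≥0, t < N → |S (rightDyadic n t) ω| ≤ C) ∧
      ∀ t : ℝ≥0, t < N → |S t ω| ≤ C := by
  set K := ENNReal.ofReal (∫ ω, |S N ω| ∂P) with hK
  set B : ℕ → Set Ω := fun m => ⋃ n, {ω | ∃ k ≤ N * 2 ^ n, (m : ℝ) ≤ |S (dyadic n k) ω|} with hB
  have hBm : ∀ m : ℕ, m * P (B m) ≤ K := by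
    intro m
    -- The grids are nested, so the events increase with the level and the maximal inequality passes
    -- to their union.
    have hmono : Monotone fun n => {ω | ∃ k ≤ N * 2 ^ n, (m : ℝ) ≤ |S (dyadic n k) ω|} := by
      apply monotone_nat_of_le_succ
      rintro n ω ⟨k, hk, h⟩
      refine ⟨2 * k, by rw [pow_succ]; linarith, ?_⟩
      rwa [dyadic_two_mul_succ]
    rw [hB, hmono.measure_iUnion, ENNReal.mul_iSup]
    exact iSup_le fun n => measure_exists_dyadic_le hS N n m
  have h0 : P (⋂ m, B m) = 0 := by
    by_contra hne
    have hlt : K / P (⋂ m, B m) ≠ ∞ := (ENNReal.div_lt_top ENNReal.ofReal_ne_top hne).ne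
    obtain ⟨m, hm⟩ := ENNReal.exists_nat_gt hlt
    have h1 : (m : ℝ≥0∞) * P (⋂ m, B m) ≤ K :=
      (mul_le_mul_right (measure_mono (iInter_subset _ m)) _).trans (hBm m)
    rw [ENNReal.div_lt_iff (Or.inl hne) (Or.inl (measure_ne_top _ _))] at hm
    exact absurd h1 (not_le.2 hm)
  have h2 : ∀ᵐ ω ∂P, ω ∉ ⋂ m, B m := measure_eq_zero_iff_ae_notMem.1 h0
  filter_upwards [h2] with ω hω
  simp only [hB, mem_iInter, mem_iUnion, mem_ofPred_eq, not_forall, not_exists, not_and,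
    not_le] at hω
  obtain ⟨m, hm⟩ := hω
  -- For `t < N` the index `⌊t * 2 ^ n⌋₊ + 1` is still at most `N * 2 ^ n`, so the point lies in the
  -- controlled grid.
  have h3 : ∀ n, ∀ t : ℝ≥0, t < N → |S (rightDyadic n t) ω| ≤ m := fun n t ht =>
    (hm n _ (floor_lt_of_lt ht)).le
  refine ⟨m, h3, fun t ht => ?_⟩
  have h4 := ((hSr ω t).tendsto.comp (tendsto_rightDyadic t)).abs
  exact le_of_tendsto h4 (Eventually.of_forall fun n => h3 n t ht)

omit [IsProbabilityMeasure P] in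
theorem integrable_mul_of_ae_bound {V Y : Ω → ℝ} (hV : Integrable V P)
    (hY : AEStronglyMeasurable Y P) {c : ℝ} (hc : ∀ᵐ ω ∂P, |Y ω| ≤ c) :
    Integrable (fun ω => V ω * Y ω) P := hV.mul_bdd hY hc

theorem integral_condExp_mul {V Y : Ω → ℝ} (hV : Integrable V P) {a : ℝ≥0}
    (hY : StronglyMeasurable[ℱ a] Y) {c : ℝ} (hc : ∀ᵐ ω ∂P, |Y ω| ≤ c) :
    ∫ ω, (P[V|ℱ a]) ω * Y ω ∂P = ∫ ω, V ω * Y ω ∂P := by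
  have hVY : Integrable (V * Y) P :=
    integrable_mul_of_ae_bound hV (hY.mono (ℱ.le a)).aestronglyMeasurable hc
  rw [← integral_condExp (ℱ.le a) (f := fun ω => V ω * Y ω)]
  exact integral_congr_ae (condExp_mul_of_stronglyMeasurable_right hY hVY hV).symm

end

/-! ### The expected cost due to the unaffected price -/

section

variable {Ω : Type*} {mΩ : MeasurableSpace Ω} {P : Measure Ω}
  {ℱ : Filtration ℝ≥0 mΩ} {S : ℝ≥0 → Ω → ℝ} {T : ℝ≥0} {x : ℝ}

namespace Strategy

/-- The case to watch is `a ≤ T < b`: the restriction to `Iic T` keeps the terminal trade at `T`,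
after which the holdings are already zero. -/
theorem dX_restrict_Ico (X : Strategy P ℱ T x) (ω : Ω) {a b : ℝ≥0} (h : a ≤ b) :
    (X.dX ω).restrict (Iic T) (Ico a b) = X.X b ω - X.X a ω := by
  have hX := X.finite_variation ω
  have hl := X.left_continuous ω
  rw [VectorMeasure.restrict_apply _ measurableSet_Iic measurableSet_Ico]
  unfold dX
  rcases le_or_gt b T with hb | hb
  · rw [inter_eq_left.2 (Ico_subset_Iio_self.trans (Iio_subset_Iic_self.trans (Iic_subset_Iic.2 hb))),
      vectorMeasure_Ico_eq hX hl h]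
  · rcases le_or_gt a T with ha | ha
    · have : Ico a b ∩ Iic T = Icc a T := by
        ext t
        simp only [mem_inter_iff, mem_Ico, mem_Iic, mem_Icc]
        exact ⟨fun h => ⟨h.1.1, h.2⟩, fun h => ⟨⟨h.1, h.2.trans_lt hb⟩, h.2⟩⟩
      rw [this, hX.vectorMeasure_Icc ha, (hl a).leftLim_eq, X.terminal b hb,
        rightLim_eq_zero_of_terminal fun t ht => X.terminal t ht ω]
    · have : Ico a b ∩ Iic T = ∅ := by
        ext t
        simp only [mem_inter_iff, mem_Ico, mem_Iic, mem_empty_iff_false, iff_false, not_and, not_le]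
        exact fun h => ha.trans_le h.1
      rw [this, VectorMeasure.empty, X.terminal b hb, X.terminal a ha, sub_self]

/-- Riemann sums of `∫ S dX`, with the price at the right end of each interval. -/
def riemann (S : ℝ≥0 → Ω → ℝ) (X : Strategy P ℱ T x) (N n : ℕ) (ω : Ω) : ℝ :=
  ∑ k ∈ Finset.range (N * 2 ^ n),
    S (dyadic n (k + 1)) ω * (X.X (dyadic n (k + 1)) ω - X.X (dyadic n k) ω)

theorem measurable_rightDyadic (n : ℕ) (f : ℝ≥0 → ℝ) :
    Measurable fun t => f (rightDyadic n t) := by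
  have h1 : Measurable fun t : ℝ≥0 => ⌊t * 2 ^ n⌋₊ := Nat.measurable_floor.comp (by fun_prop)
  exact (measurable_from_top (f := fun k : ℕ => f (dyadic n (k + 1)))).comp h1

/-- The price read at `rightDyadic n t` is constant on each dyadic interval, so its integral against
`dX` is exactly a finite sum. -/
theorem integral_rightDyadic (X : Strategy P ℱ T x) {N : ℕ} (hN : T < N) (n : ℕ) (ω : Ω) :
    ∫ᵛ t in Iic T, S (rightDyadic n t) ω ∂•X.dX ω = X.riemann S N n ω := by
  set m := (X.dX ω).restrict (Iic T) with hm
  have hT : ∀ᵐ t : ℝ≥0 ∂m.variation, t < N := by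
    rw [hm, VectorMeasure.variation_restrict measurableSet_Iic]
    filter_upwards [ae_restrict_mem measurableSet_Iic] with t ht using lt_of_le_of_lt ht hN
  have h1 : (fun t => S (rightDyadic n t) ω) =ᵐ[m.variation] fun t =>
      ∑ k ∈ Finset.range (N * 2 ^ n), (Ico (dyadic n k) (dyadic n (k + 1))).indicator
        (fun _ => S (dyadic n (k + 1)) ω) t := by
    filter_upwards [hT] with t ht
    rw [Finset.sum_eq_single_of_mem ⌊t * 2 ^ n⌋₊ (Finset.mem_range.2 (floor_lt_of_lt ht)),
      indicator_of_mem (mem_Ico_dyadic_iff.2 rfl)]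
    · rfl
    · intro k _ hk
      exact indicator_of_notMem (fun h => hk (mem_Ico_dyadic_iff.1 h).symm) _
  rw [VectorMeasure.integral_congr_ae h1, VectorMeasure.integral_finsetSum]
  · refine Finset.sum_congr rfl fun k _ => ?_
    rw [VectorMeasure.integral_indicator measurableSet_Ico, VectorMeasure.integral_const]
    rw [VectorMeasure.restrict_apply _ measurableSet_Ico MeasurableSet.univ, univ_inter, hm,
      X.dX_restrict_Ico ω (monotone_dyadic n k.le_succ)]
    simp
  · intro k _
    exact (integrable_const _).indicator measurableSet_Ico

/-- Dominated convergence along one path: right-continuity of the price gives the pointwise limit,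
and the path bound dominates against a finite measure. -/
theorem tendsto_riemann (hSr : ∀ ω t, ContinuousWithinAt (fun s => S s ω) (Ici t) t)
    (X : Strategy P ℱ T x) {N : ℕ} (hN : T < N) {ω : Ω} {C : ℝ}
    (hC : ∀ n, ∀ t : ℝ≥0, t < N → |S (rightDyadic n t) ω| ≤ C)
    (hC' : ∀ t : ℝ≥0, t < N → |S t ω| ≤ C) :
    ((X.dX ω).restrict (Iic T)).Integrable (fun t => S t ω) ∧
    Tendsto (fun n => X.riemann S N n ω) atTop (𝓝 (∫ᵛ t in Iic T, S t ω ∂•X.dX ω)) := by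
  set m := (X.dX ω).restrict (Iic T) with hm
  have hT : ∀ᵐ t : ℝ≥0 ∂m.variation, t < N := by
    rw [hm, VectorMeasure.variation_restrict measurableSet_Iic]
    filter_upwards [ae_restrict_mem measurableSet_Iic] with t ht using lt_of_le_of_lt ht hN
  have hlim : ∀ t, Tendsto (fun n => S (rightDyadic n t) ω) atTop (𝓝 (S t ω)) := fun t =>
    (hSr ω t).tendsto.comp (tendsto_rightDyadic t)
  have hmeas : Measurable fun t => S t ω :=
    measurable_of_tendsto_metrizable (fun n => measurable_rightDyadic n fun t => S t ω)
      (tendsto_pi_nhds.2 hlim)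
  constructor
  · refine (integrable_const C).mono' hmeas.aestronglyMeasurable ?_
    filter_upwards [hT] with t ht using hC' t ht
  · simp_rw [← X.integral_rightDyadic hN]
    refine VectorMeasure.tendsto_integral_filter_of_norm_le_const
      (Eventually.of_forall fun n =>
        (measurable_rightDyadic n fun t => S t ω).aestronglyMeasurable)
      ⟨C, Eventually.of_forall fun n => ?_⟩ (ae_of_all _ hlim)
    filter_upwards [hT] with t ht using hC n t ht

theorem sum_abs_sub_le (X : Strategy P ℱ T x) {M : ℝ≥0} {ω : Ω}
    (hM : eVariationOn (fun s => X.X s ω) univ ≤ M) (n K : ℕ) :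
    ∑ k ∈ Finset.range K, |X.X (dyadic n (k + 1)) ω - X.X (dyadic n k) ω| ≤ M := by
  have h := (eVariationOn.sum_le (f := fun s => X.X s ω) (s := univ) (n := K) (monotone_dyadic n)
    fun _ => mem_univ _).trans hM
  simp_rw [edist_dist, Real.dist_eq] at h
  rw [← ENNReal.ofReal_sum_of_nonneg (fun _ _ => abs_nonneg _)] at h
  exact ENNReal.ofReal_le_coe.1 h |>.trans' (le_refl _)

theorem abs_sub_le (X : Strategy P ℱ T x) {M : ℝ≥0} {ω : Ω}
    (hM : eVariationOn (fun s => X.X s ω) univ ≤ M) (s t : ℝ≥0) :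
    |X.X s ω - X.X t ω| ≤ M := by
  have h := (eVariationOn.edist_le (fun s => X.X s ω) (mem_univ s) (mem_univ t)).trans hM
  rw [edist_dist, Real.dist_eq] at h
  exact ENNReal.ofReal_le_coe.1 h

theorem ae_bound (X : Strategy P ℱ T x) : ∃ M : ℝ≥0, ∀ᵐ ω ∂P,
    (∀ n K, ∑ k ∈ Finset.range K, |X.X (dyadic n (k + 1)) ω - X.X (dyadic n k) ω| ≤ M) ∧
      ∀ s t, |X.X s ω - X.X t ω| ≤ M := by
  obtain ⟨M, hM⟩ := X.bounded_variation
  refine ⟨M, ?_⟩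
  filter_upwards [hM] with ω h
  exact ⟨fun n K => X.sum_abs_sub_le h n K, fun s t => X.abs_sub_le h s t⟩

theorem stronglyMeasurable_increment (X : Strategy P ℱ T x) (n k : ℕ) :
    StronglyMeasurable[ℱ (dyadic n (k + 1))]
      fun ω => X.X (dyadic n (k + 1)) ω - X.X (dyadic n k) ω :=
  (X.adapted _).sub ((X.adapted _).mono (ℱ.mono (monotone_dyadic n k.le_succ)))

theorem dyadic_le_of_lt {N n k : ℕ} (hk : k < N * 2 ^ n) : dyadic n (k + 1) ≤ N := by
  rw [← dyadic_mul_pow n N]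
  exact monotone_dyadic n hk

variable [IsProbabilityMeasure P]

omit [IsProbabilityMeasure P] in
theorem integrable_riemann (hS : Martingale S ℱ P) (X : Strategy P ℱ T x) (N n : ℕ) :
    Integrable (X.riemann S N n) P := by
  obtain ⟨M, hM⟩ := X.ae_bound
  refine integrable_finsetSum _ fun k _ => ?_
  refine integrable_mul_of_ae_bound (hS.integrable _)
    ((X.stronglyMeasurable_increment n k).mono (ℱ.le _)).aestronglyMeasurable (c := M) ?_
  filter_upwards [hM] with ω h using h.2 _ _

/-- Each increment of `X` is measurable at the right end of its interval, where the price is the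
conditional expectation of `S N`. Replacing every price by `S N` makes the sum telescope to `-x * S
N`. Left end points would not allow this. -/
theorem integral_riemann (hS : Martingale S ℱ P) (X : Strategy P ℱ T x) {N : ℕ} (hN : T < N)
    (n : ℕ) : ∫ ω, X.riemann S N n ω ∂P = -x * ∫ ω, S 0 ω ∂P := by
  obtain ⟨M, hM⟩ := X.ae_bound
  have hb : ∀ k, ∀ᵐ ω ∂P, |X.X (dyadic n (k + 1)) ω - X.X (dyadic n k) ω| ≤ (M : ℝ) := by
    intro k
    filter_upwards [hM] with ω h using h.2 _ _
  have hm := fun k => X.stronglyMeasurable_increment n k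
  have hi : ∀ a : ℝ≥0, ∀ k, Integrable
      (fun ω => S a ω * (X.X (dyadic n (k + 1)) ω - X.X (dyadic n k) ω)) P := fun a k =>
    integrable_mul_of_ae_bound (hS.integrable _) ((hm k).mono (ℱ.le _)).aestronglyMeasurable (hb k)
  unfold riemann
  rw [integral_finsetSum _ fun k _ => hi _ k]
  have h1 : ∀ k ∈ Finset.range (N * 2 ^ n),
      ∫ ω, S (dyadic n (k + 1)) ω * (X.X (dyadic n (k + 1)) ω - X.X (dyadic n k) ω) ∂P
        = ∫ ω, S N ω * (X.X (dyadic n (k + 1)) ω - X.X (dyadic n k) ω) ∂P := by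
    intro k hk
    rw [← integral_condExp_mul (hS.integrable N) (hm k) (hb k)]
    refine integral_congr_ae ?_
    filter_upwards [hS.2 _ _ (dyadic_le_of_lt (Finset.mem_range.1 hk))] with ω h
    rw [h]
  rw [Finset.sum_congr rfl h1, ← integral_finsetSum _ fun k _ => hi _ k]
  have h2 : ∀ ω, ∑ k ∈ Finset.range (N * 2 ^ n),
      S N ω * (X.X (dyadic n (k + 1)) ω - X.X (dyadic n k) ω) = -x * S N ω := by
    intro ω
    rw [← Finset.mul_sum, Finset.sum_range_sub (fun k => X.X (dyadic n k) ω), dyadic_mul_pow,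
      X.terminal _ hN, show dyadic n 0 = 0 by simp [dyadic], X.initial]
    ring
  simp_rw [h2]
  rw [integral_const_mul]
  have h3 := hS.setIntegral_eq (zero_le (a := (N : ℝ≥0))) (MeasurableSet.univ (α := Ω) (m := ℱ 0))
  simp only [setIntegral_univ] at h3
  rw [h3]

/-- Riemann sums are the sum of a bounded part and a part that is small in mean. -/
theorem riemann_le (hS : Martingale S ℱ P) (X : Strategy P ℱ T x) (N n : ℕ) {M : ℝ≥0}
    (hM : ∀ᵐ ω ∂P,
      (∀ n K, ∑ k ∈ Finset.range K, |X.X (dyadic n (k + 1)) ω - X.X (dyadic n k) ω| ≤ M) ∧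
      ∀ s t, |X.X s ω - X.X t ω| ≤ M) {K : ℝ} (hK : 0 ≤ K) :
    ∃ U : Ω → ℝ, Integrable U P ∧ 0 ≤ᵐ[P] U ∧ (∀ᵐ ω ∂P, |X.riemann S N n ω| ≤ K * M + U ω) ∧
      ∫ ω, U ω ∂P ≤ M * ∫ ω, max (|S N ω| - K) 0 ∂P := by
  -- The excess of the final price over the level `K`: conditional expectations give `|S_t| ≤ K +
  -- 𝔼[W | ℱ_t]` for `t ≤ N`.
  set W : Ω → ℝ := fun ω => max (|S N ω| - K) 0 with hW
  have hWi : Integrable W P := ((hS.integrable N).abs.sub (integrable_const K)).sup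
    (integrable_const 0)
  have hW0 : 0 ≤ W := fun ω => le_max_right _ _
  have hb : ∀ k, ∀ᵐ ω ∂P, |(|X.X (dyadic n (k + 1)) ω - X.X (dyadic n k) ω|)| ≤ (M : ℝ) := by
    intro k
    filter_upwards [hM] with ω h
    rw [abs_abs]
    exact h.2 _ _
  have hm : ∀ k, StronglyMeasurable[ℱ (dyadic n (k + 1))]
      fun ω => |X.X (dyadic n (k + 1)) ω - X.X (dyadic n k) ω| := fun k =>
    (X.stronglyMeasurable_increment n k).norm
  have hi : ∀ k, Integrable (fun ω => (P[W|ℱ (dyadic n (k + 1))]) ω *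
      |X.X (dyadic n (k + 1)) ω - X.X (dyadic n k) ω|) P := fun k =>
    integrable_mul_of_ae_bound integrable_condExp ((hm k).mono (ℱ.le _)).aestronglyMeasurable (hb k)
  have hi' : ∀ k, Integrable (fun ω => W ω *
      |X.X (dyadic n (k + 1)) ω - X.X (dyadic n k) ω|) P := fun k =>
    integrable_mul_of_ae_bound hWi ((hm k).mono (ℱ.le _)).aestronglyMeasurable (hb k)
  refine ⟨fun ω => ∑ k ∈ Finset.range (N * 2 ^ n), (P[W|ℱ (dyadic n (k + 1))]) ω *
      |X.X (dyadic n (k + 1)) ω - X.X (dyadic n k) ω|,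
    integrable_finsetSum _ fun k _ => hi k, ?_, ?_, ?_⟩
  · have h0 : ∀ᵐ ω ∂P, ∀ k, 0 ≤ (P[W|ℱ (dyadic n (k + 1))]) ω :=
      ae_all_iff.2 fun k => condExp_nonneg (ae_of_all _ hW0)
    filter_upwards [h0] with ω h
    exact Finset.sum_nonneg fun k _ => mul_nonneg (h k) (abs_nonneg _)
  · have h1 : ∀ᵐ ω ∂P, ∀ k ∈ Finset.range (N * 2 ^ n),
        |S (dyadic n (k + 1)) ω| ≤ K + (P[W|ℱ (dyadic n (k + 1))]) ω := by
      refine (ae_ball_iff (Finset.range (N * 2 ^ n)).countable_toSet).2 fun k hk => ?_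
      have e1 := hS.2 _ _ (dyadic_le_of_lt (Finset.mem_range.1 (Finset.mem_coe.1 hk)))
      have e2 := norm_condExp_le (m := ℱ (dyadic n (k + 1))) (μ := P) (S N)
      have e3 : P[(fun ω => ‖S N ω‖)|ℱ (dyadic n (k + 1))]
          ≤ᵐ[P] P[(fun _ => K) + W|ℱ (dyadic n (k + 1))] :=
        condExp_mono (hS.integrable N).norm ((integrable_const K).add hWi) (ae_of_all _ fun ω => by
          simp only [hW, Pi.add_apply, Real.norm_eq_abs]
          linarith [le_max_left (|S N ω| - K) 0])
      have e4 := condExp_add (integrable_const (μ := P) K) hWi (ℱ (dyadic n (k + 1)))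
      filter_upwards [e1, e2, e3, e4] with ω h1 h2 h3 h4
      rw [h4, Pi.add_apply, condExp_const (ℱ.le _)] at h3
      rw [← h1]
      exact h2.trans h3
    filter_upwards [h1, hM] with ω h hMω
    calc |X.riemann S N n ω|
        ≤ ∑ k ∈ Finset.range (N * 2 ^ n), |S (dyadic n (k + 1)) ω| *
            |X.X (dyadic n (k + 1)) ω - X.X (dyadic n k) ω| := by
          refine (Finset.abs_sum_le_sum_abs _ _).trans (le_of_eq ?_)
          exact Finset.sum_congr rfl fun k _ => abs_mul _ _
      _ ≤ ∑ k ∈ Finset.range (N * 2 ^ n), (K + (P[W|ℱ (dyadic n (k + 1))]) ω) *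
            |X.X (dyadic n (k + 1)) ω - X.X (dyadic n k) ω| :=
          Finset.sum_le_sum fun k hk => mul_le_mul_of_nonneg_right (h k hk) (abs_nonneg _)
      _ ≤ _ := by
          simp_rw [add_mul]
          rw [Finset.sum_add_distrib, ← Finset.mul_sum]
          gcongr
          exact hMω.1 _ _
  · rw [integral_finsetSum _ fun k _ => hi k, Finset.sum_congr rfl fun k _ =>
      integral_condExp_mul hWi (hm k) (hb k), ← integral_const_mul]
    rw [← integral_finsetSum _ fun k _ => hi' k]
    refine integral_mono_ae (integrable_finsetSum _ fun k _ => hi' k) (hWi.const_mul _) ?_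
    filter_upwards [hM] with ω h
    rw [← Finset.mul_sum, mul_comm]
    exact mul_le_mul_of_nonneg_right (h.1 _ _) (hW0 ω)

theorem tendsto_integral_excess {V : Ω → ℝ} (hV : Integrable V P) :
    Tendsto (fun K : ℕ => ∫ ω, max (|V ω| - K) 0 ∂P) atTop (𝓝 0) := by
  have h := tendsto_integral_of_dominated_convergence (μ := P)
    (F := fun (K : ℕ) ω => max (|V ω| - K) 0) (f := fun _ => (0 : ℝ)) (fun ω => |V ω|)
    (fun K => ((hV.abs.sub (integrable_const (K : ℝ))).sup (integrable_const 0)).1) hV.abs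
    (fun K => ae_of_all _ fun ω => by
      rw [Real.norm_of_nonneg (le_max_right _ _)]
      exact max_le (by linarith [Nat.cast_nonneg (α := ℝ) K]) (abs_nonneg _))
    (ae_of_all _ fun ω => by
      refine tendsto_const_nhds.congr' ?_
      filter_upwards [eventually_ge_atTop ⌈|V ω|⌉₊] with K hK
      rw [max_eq_right]
      linarith [Nat.ceil_le.1 hK])
  simpa using h

/-- The source of uniform integrability in `n`: a large `K` makes the excess term small, after which
a small set makes the other term small. -/
theorem eLpNorm_indicator_riemann_le (hS : Martingale S ℱ P) (X : Strategy P ℱ T x) (N n : ℕ)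
    {M : ℝ≥0} (hM : ∀ᵐ ω ∂P,
      (∀ n K, ∑ k ∈ Finset.range K, |X.X (dyadic n (k + 1)) ω - X.X (dyadic n k) ω| ≤ M) ∧
      ∀ s t, |X.X s ω - X.X t ω| ≤ M) {K : ℝ} (hK : 0 ≤ K) {s : Set Ω} (hs : MeasurableSet s) :
    eLpNorm (s.indicator (X.riemann S N n)) 1 P
      ≤ ENNReal.ofReal (K * M * P.real s + M * ∫ ω, max (|S N ω| - K) 0 ∂P) := by
  obtain ⟨U, hUi, hU0, hU, hUM⟩ := X.riemann_le hS N n hM hK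
  rw [eLpNorm_indicator_eq_eLpNorm_restrict hs, eLpNorm_one_eq_lintegral_enorm,
    ← ofReal_integral_norm_eq_lintegral_enorm (X.integrable_riemann hS N n).restrict]
  apply ENNReal.ofReal_le_ofReal
  calc ∫ ω in s, ‖X.riemann S N n ω‖ ∂P ≤ ∫ ω in s, (K * M + U ω) ∂P :=
        integral_mono_ae (X.integrable_riemann hS N n).restrict.norm
          ((integrable_const _).add hUi.restrict) (ae_restrict_of_ae hU)
    _ = K * M * P.real s + ∫ ω in s, U ω ∂P := by
        rw [integral_add (integrable_const _) hUi.restrict]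
        simp [mul_comm]
    _ ≤ _ := by
        gcongr
        exact (setIntegral_le_integral hUi hU0).trans hUM

/-- The expected cost due to the unaffected price does not depend on the strategy. -/
theorem integral_price (hS : Martingale S ℱ P)
    (hSr : ∀ ω t, ContinuousWithinAt (fun s => S s ω) (Ici t) t) (X : Strategy P ℱ T x) :
    (∀ᵐ ω ∂P, ((X.dX ω).restrict (Iic T)).Integrable (fun t => S t ω)) ∧
    Integrable (fun ω => ∫ᵛ t in Iic T, S t ω ∂•X.dX ω) P ∧
    ∫ ω, (∫ᵛ t in Iic T, S t ω ∂•X.dX ω) ∂P = -x * ∫ ω, S 0 ω ∂P := by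
  obtain ⟨N, hN⟩ := exists_nat_gt T
  obtain ⟨M, hM⟩ := X.ae_bound
  set R : Ω → ℝ := fun ω => ∫ᵛ t in Iic T, S t ω ∂•X.dX ω with hR
  have hconv : ∀ᵐ ω ∂P, ((X.dX ω).restrict (Iic T)).Integrable (fun t => S t ω) ∧
      Tendsto (fun n => X.riemann S N n ω) atTop (𝓝 (R ω)) := by
    filter_upwards [ae_exists_bound hS hSr N] with ω ⟨C, hC, hC'⟩
    exact X.tendsto_riemann hSr hN hC hC'
  have hlim : ∀ᵐ ω ∂P, Tendsto (fun n => X.riemann S N n ω) atTop (𝓝 (R ω)) := by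
    filter_upwards [hconv] with ω h using h.2
  have hfm : ∀ n, AEStronglyMeasurable (X.riemann S N n) P := fun n =>
    (X.integrable_riemann hS N n).1
  have hmem : MemLp R 1 P := by
    refine ⟨aestronglyMeasurable_of_tendsto_ae atTop hfm hlim, ?_⟩
    -- Fatou's lemma; the preceding estimate with `K = 0` and the full space bounds all `L¹` norms.
    refine (Lp.eLpNorm_lim_le_liminf_eLpNorm hfm R hlim).trans_lt ?_
    refine lt_of_le_of_lt (liminf_le_of_le (by isBoundedDefault) (a := ENNReal.ofReal
      (0 * M * P.real univ + M * ∫ ω, max (|S N ω| - 0) 0 ∂P)) fun b hb => ?_)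
      ENNReal.ofReal_lt_top
    obtain ⟨n, hn⟩ := hb.exists
    refine hn.trans ?_
    have := X.eLpNorm_indicator_riemann_le hS N n hM le_rfl (MeasurableSet.univ)
    rwa [indicator_univ] at this
  have hui : UnifIntegrable (X.riemann S N) 1 P := by
    intro ε hε
    have h1 := (tendsto_integral_excess (hS.integrable N)).const_mul (M : ℝ)
    rw [mul_zero] at h1
    obtain ⟨K, hK⟩ := (h1.eventually_lt_const (half_pos hε)).exists
    have hpos : 0 < (K : ℝ) * M + 1 := by positivity
    -- Half of `ε` is spent on the excess, half on the bounded part; the `+ 1` only keeps the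
    -- denominator positive.
    refine ⟨ε / 2 / (K * M + 1), by positivity, fun n s hs hPs => ?_⟩
    refine (X.eLpNorm_indicator_riemann_le hS N n hM (Nat.cast_nonneg K) hs).trans
      (ENNReal.ofReal_le_ofReal ?_)
    have h2 : P.real s ≤ ε / 2 / (K * M + 1) :=
      ENNReal.toReal_le_of_le_ofReal (by positivity) hPs
    rw [le_div_iff₀ hpos] at h2
    have h3 : 0 ≤ P.real s := measureReal_nonneg
    nlinarith
  -- Vitali's theorem: the expectations converge too, and all of them equal `-x * ∫ S 0`.
  have hL1 := tendsto_Lp_finite_of_tendsto_ae le_rfl ENNReal.one_ne_top hfm hmem hui hlim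
  have hRi : Integrable R P := memLp_one_iff_integrable.1 hmem
  refine ⟨by filter_upwards [hconv] with ω h using h.1, hRi, ?_⟩
  have h4 : Tendsto (fun n => ∫ ω, X.riemann S N n ω ∂P) atTop (𝓝 (∫ ω, R ω ∂P)) := by
    refine tendsto_integral_of_L1 R hRi.1
      (Eventually.of_forall fun n => X.integrable_riemann hS N n) ?_
    simpa only [eLpNorm_one_eq_lintegral_enorm, Pi.sub_apply] using hL1
  simp_rw [X.integral_riemann hS hN] at h4
  exact tendsto_nhds_unique h4 tendsto_const_nhds

end Strategy

end

/-! ### The expected cost -/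

theorem tendsto_dyadic_floor (t : ℝ≥0) :
    Tendsto (fun n => dyadic n ⌊t * 2 ^ n⌋₊) atTop (𝓝[≤] t) := by
  have hle : ∀ n, dyadic n ⌊t * 2 ^ n⌋₊ ≤ t := fun n => by
    unfold dyadic
    rw [div_le_iff₀ (by positivity)]
    exact Nat.floor_le (by positivity)
  rw [tendsto_nhdsWithin_iff]
  refine ⟨?_, Eventually.of_forall hle⟩
  have h1 := (tendsto_rightDyadic t).mono_right nhdsWithin_le_nhds
  have h : Tendsto (fun n : ℕ => ((2 : ℝ≥0)⁻¹) ^ n) atTop (𝓝 0) :=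
    NNReal.tendsto_pow_atTop_nhds_zero_of_lt_one (by
      rw [← NNReal.coe_lt_coe]; norm_num)
  have h2 := h1.sub h
  rw [tsub_zero] at h2
  refine h2.congr fun n => ?_
  rw [rightDyadic, tsub_eq_iff_eq_add_of_le]
  · unfold dyadic
    push_cast
    rw [add_div, one_div, inv_pow]
  · unfold dyadic
    push_cast
    rw [add_div, one_div, inv_pow]
    exact le_add_self

/-- A left-continuous process is jointly measurable. -/
theorem measurable_uncurry_of_left_continuous {Ω : Type*} {mΩ : MeasurableSpace Ω}
    {X : ℝ≥0 → Ω → ℝ} (hm : ∀ t, Measurable (X t))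
    (hl : ∀ ω t, ContinuousWithinAt (fun s => X s ω) (Iic t) t) :
    Measurable fun p : ℝ≥0 × Ω => X p.1 p.2 := by
  refine measurable_of_tendsto_metrizable
    (f := fun n (p : ℝ≥0 × Ω) => X (dyadic n ⌊p.1 * 2 ^ n⌋₊) p.2) (fun n => ?_)
    (tendsto_pi_nhds.2 fun p => (hl p.2 p.1).tendsto.comp (tendsto_dyadic_floor p.1))
  have h1 : Measurable fun q : ℕ × Ω => X (dyadic n q.1) q.2 :=
    measurable_from_prod_countable_right fun k => by exact hm (dyadic n k)
  have h2 : Measurable fun p : ℝ≥0 × Ω => (⌊p.1 * 2 ^ n⌋₊, p.2) :=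
    (Nat.measurable_floor.comp (by fun_prop)).prodMk measurable_snd
  exact h1.comp h2

/-! ### Bounds and integrability of the volume impact -/

namespace Book

variable {M : Book} {T : ℝ≥0}

/-- The cost of a path, the unaffected price being omitted. -/
def impactCost (M : Book) (T : ℝ≥0) (X E : ℝ≥0 → ℝ) : ℝ :=
  (E T - X T) ^ 2 / (2 * M.L T)
    + ∫ s in (0 : ℝ)..T, (2 * M.r s - M.n s) / (2 * M.L s) * E s.toNNReal ^ 2

/-- Variation of constants controls `E` by the oscillation of `X`. The constant depends only on the
book and on `T`, so a bound of the variation in `ω` gives a bound of the impact in `ω`. -/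
theorem IsImpact.exists_bound (M : Book) (T : ℝ≥0) : ∃ A : ℝ, 0 ≤ A ∧
    ∀ (X E : ℝ≥0 → ℝ) (V : ℝ), M.IsImpact T X E → (∀ s, |X s - X 0| ≤ V) →
      ∀ t ≤ T, |E t| ≤ A * V := by
  obtain ⟨C, hC⟩ := exists_abs_le_of_continuous (M.continuous_sub.mul M.continuous_gam) T
  obtain ⟨D, hD⟩ := exists_abs_le_of_continuous
    (M.continuous_gam.inv₀ fun t => (M.gam_pos t).ne') T
  have hC0 : 0 ≤ C := (abs_nonneg _).trans (hC 0 ⟨le_rfl, T.coe_nonneg⟩)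
  have hD0 : 0 ≤ D := (abs_nonneg _).trans (hD 0 ⟨le_rfl, T.coe_nonneg⟩)
  refine ⟨1 + D * (C * T), by positivity, fun X E V hE hV t ht => ?_⟩
  have ht' : (t : ℝ) ≤ T := ht
  have hV0 : 0 ≤ V := (abs_nonneg _).trans (hV 0)
  have h1 : ‖∫ s in (0 : ℝ)..t, (M.r s - M.n s) * M.gam s * (X s.toNNReal - X 0)‖
      ≤ C * V * |(t : ℝ) - 0| := by
    refine intervalIntegral.norm_integral_le_of_norm_le_const fun s hs => ?_
    rw [uIoc_of_le t.coe_nonneg] at hs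
    rw [norm_mul]
    exact mul_le_mul (hC s ⟨hs.1.le, hs.2.trans ht'⟩) (hV _) (norm_nonneg _) hC0
  have h2 := hE.gam_mul ht
  have hg := (M.gam_pos t).ne'
  have h3 : E t = (X t - X 0)
      - (M.gam t)⁻¹ * ∫ s in (0 : ℝ)..t, (M.r s - M.n s) * M.gam s * (X s.toNNReal - X 0) := by
    have : E t = (M.gam t)⁻¹ * (M.gam t * E t) := by field_simp
    rw [this, h2, mul_sub]
    field_simp
  rw [h3]
  refine (_root_.abs_sub _ _).trans ?_
  rw [abs_mul]
  have h4 : |(M.gam t)⁻¹| ≤ D := hD t ⟨t.coe_nonneg, ht'⟩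
  have h5 : C * V * |(t : ℝ) - 0| ≤ C * V * T := by
    rw [sub_zero, abs_of_nonneg t.coe_nonneg]
    gcongr
  have h6 : |(M.gam t)⁻¹| * |∫ s in (0 : ℝ)..t, (M.r s - M.n s) * M.gam s * (X s.toNNReal - X 0)|
      ≤ D * (C * V * T) := mul_le_mul h4 (h1.trans h5) (abs_nonneg _) hD0
  calc _ ≤ V + D * (C * V * T) := add_le_add (hV t) h6
    _ = _ := by ring

/-- No regularity of `E` is assumed: its equation presents it as a left-continuous path plus a
continuous primitive. -/
theorem IsImpact.aestronglyMeasurable {X E : ℝ≥0 → ℝ} (hE : M.IsImpact T X E)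
    (hl : ∀ t, ContinuousWithinAt X (Iic t) t) :
    AEStronglyMeasurable (fun s : ℝ => E s.toNNReal) (volume.restrict (Ioc 0 (T : ℝ))) := by
  have h1 : Measurable fun s : ℝ => X s.toNNReal - X 0 := by
    have := measurable_uncurry_of_left_continuous (Ω := Unit) (mΩ := ⊤) (X := fun t _ => X t)
      (fun t => measurable_const) (fun _ t => hl t)
    exact (this.comp (measurable_real_toNNReal.prodMk (measurable_const (a := ())))).sub_const _
  have h2 : ContinuousOn (fun t : ℝ => ∫ s in (0 : ℝ)..t, (M.n s - M.r s) * E s.toNNReal)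
      (Ioc 0 (T : ℝ)) := by
    have := intervalIntegral.continuousOn_primitive_interval'
      (hE.integrable) (left_mem_uIcc)
    rw [uIcc_of_le T.coe_nonneg] at this
    exact this.mono Ioc_subset_Icc_self
  refine (h1.aestronglyMeasurable.add (h2.aestronglyMeasurable measurableSet_Ioc)).congr ?_
  filter_upwards [ae_restrict_mem measurableSet_Ioc] with s hs
  rw [hE.dynamics s.toNNReal (Real.toNNReal_le_iff_le_coe.2 hs.2), Pi.add_apply,
    Real.coe_toNNReal s hs.1.le]

theorem IsImpact.intervalIntegrable {X E : ℝ≥0 → ℝ} (hE : M.IsImpact T X E)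
    (hl : ∀ t, ContinuousWithinAt X (Iic t) t) (hX : BoundedVariationOn X univ) {c : ℝ → ℝ}
    (hc : ContinuousOn c (Icc 0 T)) (k : ℕ) :
    IntervalIntegrable (fun s => c s * E s.toNNReal ^ k) volume 0 T := by
  obtain ⟨A, -, hA⟩ := IsImpact.exists_bound M T
  have hb : ∀ t ≤ T, |E t| ≤ A * (eVariationOn X univ).toReal := hA X E _ hE fun s => by
    have := hX.dist_le (mem_univ s) (mem_univ 0)
    rwa [Real.dist_eq] at this
  rw [intervalIntegrable_iff_integrableOn_Ioc_of_le T.coe_nonneg]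
  have h1 : IntegrableOn c (Ioc 0 (T : ℝ)) :=
    (hc.integrableOn_compact isCompact_Icc).mono_set Ioc_subset_Icc_self
  refine h1.mul_bdd (c := (A * (eVariationOn X univ).toReal) ^ k)
    ((hE.aestronglyMeasurable hl).pow k) ?_
  filter_upwards [ae_restrict_mem measurableSet_Ioc] with s hs
  rw [norm_pow]
  exact pow_le_pow_left₀ (norm_nonneg _) (hb _ (Real.toNNReal_le_iff_le_coe.2 hs.2)) k

end Book

/-! ### Expected cost in the block-shaped book -/

theorem shapeFInv_blockShape (y : ℝ) : shapeFInv blockShape y = y := by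
  have h : shapeF blockShape = id := by
    ext y; simp [shapeF, blockShape]
  have := Function.leftInverse_invFun (f := shapeF blockShape) (by rw [h]; exact Function.injective_id) y
  rw [h] at this
  rw [shapeFInv, h]
  exact this

theorem shapeG_blockShape (e : ℝ) : shapeG blockShape e = e ^ 2 / 2 := by
  rw [shapeG, shapeFInv_blockShape, shapeFTilde]
  simp [blockShape, integral_id]

/-- `M` describes the depth `lam` and the resilience `rho` on `[0, ∞)`. -/
structure Book.Extends (M : Book) (lam rho : ℝ → ℝ) : Prop where
  L_eq : ∀ t, 0 ≤ t → M.L t = lam t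
  r_eq : ∀ t, 0 ≤ t → M.r t = rho t
  n_eq : ∀ t, 0 ≤ t → M.n t = eta lam t

section

variable {Ω : Type*} {mΩ : MeasurableSpace Ω} {P : Measure Ω}
  {ℱ : Filtration ℝ≥0 mΩ} {S : ℝ≥0 → Ω → ℝ} {T : ℝ≥0} {x : ℝ} {M : Book} {lam rho : ℝ → ℝ}

namespace Strategy

/-- For the block shape `F⁻¹` is the identity, so the resilience term `ρ λ f(D) D` is simply `ρ E`.
-/
theorem isVolumeImpactP_iff (hM : M.Extends lam rho) (X : Strategy P ℱ T x) (E : ℝ≥0 → Ω → ℝ) :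
    X.IsVolumeImpactP blockShape lam rho E ↔
      ∀ ω, M.IsImpact T (fun s => X.X s ω) (fun s => E s ω) := by
  have key : ∀ ω, ∀ s : ℝ, 0 ≤ s → eta lam s * E s.toNNReal ω
        - rho s * lam s * blockShape (shapeFInv blockShape (E s.toNNReal ω / lam s))
          * shapeFInv blockShape (E s.toNNReal ω / lam s)
        = (M.n s - M.r s) * E s.toNNReal ω := by
    intro ω s hs
    have hL := (M.L_pos s).ne'
    rw [shapeFInv_blockShape, blockShape, ← hM.L_eq s hs, hM.n_eq s hs, hM.r_eq s hs]
    field_simp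
  have k1 : ∀ ω, (IntervalIntegrable (fun s : ℝ => eta lam s * E s.toNNReal ω
        - rho s * lam s * blockShape (shapeFInv blockShape (E s.toNNReal ω / lam s))
          * shapeFInv blockShape (E s.toNNReal ω / lam s)) volume 0 T ↔
      IntervalIntegrable (fun s : ℝ => (M.n s - M.r s) * E s.toNNReal ω) volume 0 T) := fun ω =>
    intervalIntegrable_congr fun s hs => by
      rw [uIoc_of_le T.coe_nonneg] at hs
      exact key ω s hs.1.le
  have k2 : ∀ ω, ∀ t : ℝ≥0, ∫ s in (0 : ℝ)..t, (eta lam s * E s.toNNReal ω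
        - rho s * lam s * blockShape (shapeFInv blockShape (E s.toNNReal ω / lam s))
          * shapeFInv blockShape (E s.toNNReal ω / lam s))
      = ∫ s in (0 : ℝ)..t, (M.n s - M.r s) * E s.toNNReal ω := fun ω t =>
    intervalIntegral.integral_congr fun s hs => by
      rw [uIcc_of_le t.coe_nonneg] at hs
      exact key ω s hs.1
  constructor
  · intro h ω
    exact ⟨(k1 ω).1 (h.integrable ω), fun t ht => by rw [← k2]; exact h.dynamics ω t ht⟩
  · intro h
    exact ⟨fun ω => (k1 ω).2 (h ω).integrable, fun ω t ht => by
      rw [k2]; exact (h ω).dynamics t ht⟩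

theorem pathCost_eq (hM : M.Extends lam rho) (X : Strategy P ℱ T x) {E : ℝ≥0 → Ω → ℝ} {ω : Ω}
    (hE : M.IsImpact T (fun s => X.X s ω) (fun s => E s ω))
    (hS : ((X.dX ω).restrict (Iic T)).Integrable (fun t => S t ω)) :
    X.pathCost blockShape lam S E ω = ∫ᵛ t in Iic T, S t ω ∂•X.dX ω
      + M.impactCost T (fun s => X.X s ω) (fun s => E s ω) := by
  obtain ⟨h1, h2⟩ := path_impact_cost (X.finite_variation ω) (X.left_continuous ω)
    (fun t ht => X.terminal t ht ω) hE
  rw [Book.impactCost, ← h2, ← add_assoc, pathCost]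
  congr 1
  · have h3 := VectorMeasure.integral_fun_add (B := ContinuousLinearMap.lsmul ℝ ℝ) hS h1
    rw [dX] at h3 ⊢
    rw [← h3]
    congr 1; ext t
    rw [shapeFInv_blockShape, hM.L_eq t t.2]
  · congr 1; ext t
    have hL := (M.L_pos (t : ℝ≥0)).ne'
    rw [shapeFInv_blockShape, shapeG_blockShape, shapeG_blockShape, ← hM.L_eq (t : ℝ≥0) (t : ℝ≥0).2,
      jump]
    field_simp
    ring

/-- The process `E` comes without any measurability in `ω`. Variation of constants writes it as an
integral of the jointly measurable `X`. -/
theorem measurable_impactCost (X : Strategy P ℱ T x) {E : ℝ≥0 → Ω → ℝ}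
    (hE : ∀ ω, M.IsImpact T (fun s => X.X s ω) (fun s => E s ω)) :
    Measurable fun ω => M.impactCost T (fun s => X.X s ω) (fun s => E s ω) := by
  have hXm : Measurable fun p : ℝ≥0 × Ω => X.X p.1 p.2 :=
    measurable_uncurry_of_left_continuous
      (fun t => ((X.adapted t).mono (ℱ.le t)).measurable) X.left_continuous
  -- The indicator of `u ≤ s` replaces the variable upper limit by a fixed domain, so that
  -- measurability of parametric integrals applies.
  have hY : Measurable fun p : ℝ × Ω => ∫ s in Ioc (0 : ℝ) T, {q : ℝ × Ω × ℝ | q.2.2 ≤ q.1}.indicator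
      (fun q => (M.r q.2.2 - M.n q.2.2) * M.gam q.2.2 * (X.X q.2.2.toNNReal q.2.1 - x))
        (p.1, p.2, s) := by
    have hm : Measurable fun q : (ℝ × Ω) × ℝ => {q : ℝ × Ω × ℝ | q.2.2 ≤ q.1}.indicator
      (fun q => (M.r q.2.2 - M.n q.2.2) * M.gam q.2.2 * (X.X q.2.2.toNNReal q.2.1 - x))
        (q.1.1, q.1.2, q.2) := by
      have h1 : Measurable fun q : ℝ × Ω × ℝ =>
          (M.r q.2.2 - M.n q.2.2) * M.gam q.2.2 * (X.X q.2.2.toNNReal q.2.1 - x) := by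
        refine Measurable.mul ?_ (Measurable.sub_const ?_ _)
        · exact (M.continuous_sub.mul M.continuous_gam).measurable.comp
            (measurable_snd.comp measurable_snd)
        · exact hXm.comp ((measurable_real_toNNReal.comp (measurable_snd.comp measurable_snd)).prodMk
            (measurable_fst.comp measurable_snd))
      refine (h1.indicator (measurableSet_le (measurable_snd.comp measurable_snd)
        measurable_fst)).comp ?_
      fun_prop
    exact (hm.stronglyMeasurable.integral_prod_right (ν := volume.restrict (Ioc (0 : ℝ) T))).measurable
  have hEm : Measurable fun p : ℝ × Ω => (X.X p.1.toNNReal p.2 - x) - (M.gam p.1)⁻¹ *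
      ∫ s in Ioc (0 : ℝ) T, {q : ℝ × Ω × ℝ | q.2.2 ≤ q.1}.indicator
      (fun q => (M.r q.2.2 - M.n q.2.2) * M.gam q.2.2 * (X.X q.2.2.toNNReal q.2.1 - x))
        (p.1, p.2, s) :=
    ((hXm.comp ((measurable_real_toNNReal.comp measurable_fst).prodMk measurable_snd)).sub_const
      _).sub ((M.continuous_gam.measurable.comp measurable_fst).inv.mul hY)
  have hEeq : ∀ ω, ∀ s : ℝ, 0 ≤ s → s ≤ T → E s.toNNReal ω =
      (X.X s.toNNReal ω - x) - (M.gam s)⁻¹ *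
      ∫ u in Ioc (0 : ℝ) T, {q : ℝ × Ω × ℝ | q.2.2 ≤ q.1}.indicator
      (fun q => (M.r q.2.2 - M.n q.2.2) * M.gam q.2.2 * (X.X q.2.2.toNNReal q.2.1 - x))
        (s, ω, u) := by
    intro ω s h0 hs
    have hg := (M.gam_pos s).ne'
    have h2 := (hE ω).gam_mul (Real.toNNReal_le_iff_le_coe.2 hs)
    rw [Real.coe_toNNReal s h0] at h2
    have h3 : ∫ u in Ioc (0 : ℝ) T, {q : ℝ × Ω × ℝ | q.2.2 ≤ q.1}.indicator
      (fun q => (M.r q.2.2 - M.n q.2.2) * M.gam q.2.2 * (X.X q.2.2.toNNReal q.2.1 - x)) (s, ω, u)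
        = ∫ u in (0 : ℝ)..s, (M.r u - M.n u) * M.gam u * (X.X u.toNNReal ω - X.X 0 ω) := by
      have h4 : ∀ u, {q : ℝ × Ω × ℝ | q.2.2 ≤ q.1}.indicator
        (fun q => (M.r q.2.2 - M.n q.2.2) * M.gam q.2.2 * (X.X q.2.2.toNNReal q.2.1 - x)) (s, ω, u)
          = (Iic s).indicator
            (fun u => (M.r u - M.n u) * M.gam u * (X.X u.toNNReal ω - x)) u := fun u => rfl
      simp_rw [h4]
      rw [setIntegral_indicator measurableSet_Iic, Ioc_inter_Iic, min_eq_right hs,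
        intervalIntegral.integral_of_le h0, X.initial]
    rw [h3]
    rw [X.initial] at h2 ⊢
    field_simp
    linarith
  unfold Book.impactCost
  have hc : Measurable fun s => (2 * M.r s - M.n s) / (2 * M.L s) :=
    M.continuous_two_mul_sub.measurable.div (M.continuous_L.measurable.const_mul 2)
  refine Measurable.add ?_ ?_
  · refine Measurable.div_const (Measurable.pow_const (Measurable.sub ?_ ?_) 2) _
    · have h1 := hEm.comp (measurable_const.prodMk measurable_id : Measurable fun ω : Ω => ((T : ℝ), ω))
      convert h1 using 2 with ω
      have := hEeq ω T T.2 le_rfl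
      rw [Real.toNNReal_coe] at this
      simp only [Function.comp, this, Real.toNNReal_coe]
    · exact ((X.adapted T).mono (ℱ.le T)).measurable
  · have hm : Measurable fun q : Ω × ℝ => (2 * M.r q.2 - M.n q.2) / (2 * M.L q.2) *
        ((X.X q.2.toNNReal q.1 - x) - (M.gam q.2)⁻¹ *
      ∫ u in Ioc (0 : ℝ) T, {q : ℝ × Ω × ℝ | q.2.2 ≤ q.1}.indicator
      (fun q => (M.r q.2.2 - M.n q.2.2) * M.gam q.2.2 * (X.X q.2.2.toNNReal q.2.1 - x))
        (q.2, q.1, u)) ^ 2 :=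
      (hc.comp measurable_snd).mul
        ((hEm.comp (measurable_snd.prodMk measurable_fst)).pow_const 2)
    have h1 := (hm.stronglyMeasurable.integral_prod_right'
      (ν := volume.restrict (Ioc (0 : ℝ) T))).measurable
    convert h1 using 2 with ω
    rw [intervalIntegral.integral_of_le T.coe_nonneg]
    refine setIntegral_congr_fun measurableSet_Ioc fun s hs => ?_
    dsimp only
    rw [hEeq ω s hs.1.le hs.2]

theorem integrable_impactCost [IsProbabilityMeasure P] (X : Strategy P ℱ T x) {E : ℝ≥0 → Ω → ℝ}
    (hE : ∀ ω, M.IsImpact T (fun s => X.X s ω) (fun s => E s ω)) :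
    Integrable (fun ω => M.impactCost T (fun s => X.X s ω) (fun s => E s ω)) P := by
  obtain ⟨V, hV⟩ := X.ae_bound
  obtain ⟨A, hA0, hA⟩ := Book.IsImpact.exists_bound M T
  have hcc : Continuous fun s => (2 * M.r s - M.n s) / (2 * M.L s) :=
    M.continuous_two_mul_sub.div₀ (continuous_const.mul M.continuous_L) fun s =>
      (mul_pos two_pos (M.L_pos s)).ne'
  obtain ⟨C, hC⟩ := exists_abs_le_of_continuous hcc T
  have hC0 : 0 ≤ C := (abs_nonneg _).trans (hC 0 ⟨le_rfl, T.coe_nonneg⟩)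
  refine (integrable_const ((A * V + V) ^ 2 / (2 * M.L T) + C * (A * V) ^ 2 * T)).mono'
    (X.measurable_impactCost hE).aestronglyMeasurable ?_
  filter_upwards [hV] with ω h
  have hb : ∀ t ≤ T, |E t ω| ≤ A * V := hA _ _ V (hE ω) fun s => h.2 s 0
  have hXT : |X.X T ω| ≤ V := by
    have := h.2 T (T + 1)
    rwa [X.terminal (T + 1) (by simp), sub_zero] at this
  unfold Book.impactCost
  refine (norm_add_le _ _).trans (add_le_add ?_ ?_)
  · have hL := M.L_pos T
    rw [Real.norm_of_nonneg (by positivity)]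
    gcongr ?_ / _
    rw [← sq_abs]
    gcongr
    exact (_root_.abs_sub _ _).trans (add_le_add (hb T le_rfl) hXT)
  · have h1 : ‖∫ s in (0 : ℝ)..T, (2 * M.r s - M.n s) / (2 * M.L s) * E s.toNNReal ω ^ 2‖
        ≤ C * (A * V) ^ 2 * |(T : ℝ) - 0| := by
      refine intervalIntegral.norm_integral_le_of_norm_le_const fun s hs => ?_
      rw [uIoc_of_le T.coe_nonneg] at hs
      rw [norm_mul, norm_pow]
      exact mul_le_mul (hC s ⟨hs.1.le, hs.2⟩) (pow_le_pow_left₀ (norm_nonneg _)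
        (hb _ (Real.toNNReal_le_iff_le_coe.2 hs.2)) 2) (by positivity) hC0
    rwa [sub_zero, abs_of_nonneg T.coe_nonneg] at h1

/-- The expected cost of a strategy. -/
theorem cost_eq [IsProbabilityMeasure P] (hM : M.Extends lam rho) (hS : Martingale S ℱ P)
    (hSr : ∀ ω t, ContinuousWithinAt (fun s => S s ω) (Ici t) t) (X : Strategy P ℱ T x)
    {E : ℝ≥0 → Ω → ℝ} (hE : ∀ ω, M.IsImpact T (fun s => X.X s ω) (fun s => E s ω)) :
    X.cost blockShape lam S E = -x * ∫ ω, S 0 ω ∂P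
      + ∫ ω, M.impactCost T (fun s => X.X s ω) (fun s => E s ω) ∂P := by
  obtain ⟨h1, h2, h3⟩ := X.integral_price hS hSr
  rw [← h3, ← integral_add h2 (X.integrable_impactCost hE)]
  refine integral_congr_ae ?_
  filter_upwards [h1] with ω h
  exact X.pathCost_eq hM (hE ω) h

end Strategy

end

/-! ### The cost as a function of the volume impact -/

namespace Book

variable {M : Book} {T : ℝ≥0} {X E : ℝ≥0 → ℝ}

/-- The cost of liquidating `x` shares with volume impact `φ`, the unaffected price being
omitted. -/
def impactFunctional (M : Book) (T x : ℝ) (φ : ℝ → ℝ) : ℝ :=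
  (x + ∫ s in (0 : ℝ)..T, (M.r s - M.n s) * φ s) ^ 2 / (2 * M.L T)
    + ∫ s in (0 : ℝ)..T, (2 * M.r s - M.n s) / (2 * M.L s) * φ s ^ 2

theorem impactFunctional_congr (M : Book) (T : ℝ≥0) (x : ℝ) {φ ψ : ℝ → ℝ}
    (h : ∀ s ∈ Ioc (0 : ℝ) T, φ s = ψ s) :
    M.impactFunctional T x φ = M.impactFunctional T x ψ := by
  have h1 : ∫ s in (0 : ℝ)..T, (M.r s - M.n s) * φ s
      = ∫ s in (0 : ℝ)..T, (M.r s - M.n s) * ψ s :=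
    intervalIntegral.integral_congr_ae (ae_of_all _ fun s hs => by
      rw [uIoc_of_le T.coe_nonneg] at hs; rw [h s hs])
  have h2 : ∫ s in (0 : ℝ)..T, (2 * M.r s - M.n s) / (2 * M.L s) * φ s ^ 2
      = ∫ s in (0 : ℝ)..T, (2 * M.r s - M.n s) / (2 * M.L s) * ψ s ^ 2 :=
    intervalIntegral.integral_congr_ae (ae_of_all _ fun s hs => by
      rw [uIoc_of_le T.coe_nonneg] at hs; rw [h s hs])
  rw [impactFunctional, impactFunctional, h1, h2]

/-- The dynamics at `T` give `X T - E T = X 0 + ∫ (r - n) E`. Hence the strategy enters its cost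
only through its impact. -/
theorem IsImpact.impactCost_eq (h : M.IsImpact T X E) :
    M.impactCost T X E = M.impactFunctional T (X 0) fun s => E s.toNNReal := by
  have h1 := h.dynamics T le_rfl
  have h2 : ∫ s in (0 : ℝ)..T, (M.n s - M.r s) * E s.toNNReal
      = -∫ s in (0 : ℝ)..T, (M.r s - M.n s) * E s.toNNReal := by
    rw [← intervalIntegral.integral_neg]
    congr 1; ext s; ring
  rw [impactCost, impactFunctional]
  congr 2
  rw [h1, h2]
  ring

theorem IsImpact.neg (h : M.IsImpact T X E) : M.IsImpact T (fun t => -X t) (fun t => -E t) := by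
  constructor
  · simpa only [mul_neg] using! h.integrable.neg
  · intro t ht
    simp only [mul_neg, intervalIntegral.integral_neg]
    rw [h.dynamics t ht]
    ring

/-- A pure sell program decreases `γ E` at every time. -/
theorem IsImpact.antitoneOn (h : M.IsImpact T X E) (hX : Antitone X) :
    AntitoneOn (fun t : ℝ≥0 => M.gam t * E t) (Iic T) := by
  obtain ⟨C, hC⟩ := exists_abs_le_of_continuous (M.continuous_sub.mul M.continuous_gam) T
  obtain ⟨D, hD⟩ := exists_abs_le_of_continuous
    (M.continuous_gam.inv₀ fun t => (M.gam_pos t).ne') T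
  have hC0 : 0 ≤ C := (abs_nonneg _).trans (hC 0 ⟨le_rfl, T.coe_nonneg⟩)
  have hD0 : 0 < D := (inv_pos.2 (M.gam_pos 0)).trans_le
    ((le_abs_self _).trans (hD 0 ⟨le_rfl, T.coe_nonneg⟩))
  have hXi : ∀ a b : ℝ, IntervalIntegrable (fun s => (M.r s - M.n s) * M.gam s *
      (X s.toNNReal - X 0)) volume a b := fun a b => by
    have h1 : IntervalIntegrable (fun s : ℝ => X s.toNNReal) volume a b :=
      (hX.comp_monotone fun _ _ h => Real.toNNReal_mono h).intervalIntegrable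
    exact (h1.sub intervalIntegrable_const).continuousOn_mul
      (M.continuous_sub.mul M.continuous_gam).continuousOn
  have hci : ∀ a b : ℝ, IntervalIntegrable (fun s => (M.r s - M.n s) * M.gam s) volume a b :=
    fun a b => (M.continuous_sub.mul M.continuous_gam).intervalIntegrable a b
  have hgi : ∀ a b : ℝ, ∫ s in a..b, (M.r s - M.n s) * M.gam s = M.gam b - M.gam a := fun a b =>
    intervalIntegral.integral_eq_sub_of_hasDerivAt (fun s _ => M.hasDerivAt_gam s)
      (hci a b)
  -- On `[s, t]` the increment of `γE` is `γ_t (X_t - X_s) - ∫ γ' (X_u - X_s) du`. The integral is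
  -- at most `C (t - s) (X_s - X_t)`, which the first term absorbs once `C (t - s) ≤ 1 / D ≤ γ_t`;
  -- here `C` bounds `|γ'|` and `D` bounds `1 / γ`.
  have local_le : ∀ s t : ℝ≥0, s ≤ t → t ≤ T → (t : ℝ) - s ≤ (D * (C + 1))⁻¹ →
      M.gam t * E t ≤ M.gam s * E s := by
    intro s t hst ht hd
    have hst' : (s : ℝ) ≤ t := hst
    have ht' : (t : ℝ) ≤ T := ht
    have e1 := h.gam_mul ht
    have e2 := h.gam_mul (hst.trans ht)
    have e3 := intervalIntegral.integral_add_adjacent_intervals (hXi 0 s) (hXi s t)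
    have e4 : ∫ u in (s : ℝ)..t, (M.r u - M.n u) * M.gam u * (X u.toNNReal - X 0)
        = (∫ u in (s : ℝ)..t, (M.r u - M.n u) * M.gam u * (X u.toNNReal - X s))
          + (M.gam t - M.gam s) * (X s - X 0) := by
      rw [← hgi, ← intervalIntegral.integral_mul_const,
        ← intervalIntegral.integral_add _ ((hci s t).mul_const (X s - X 0))]
      · congr 1; ext u; ring
      · refine ((hXi s t).sub ((hci s t).mul_const (X s - X 0))).congr fun u _ => ?_
        ring
    have e5 : ‖∫ u in (s : ℝ)..t, (M.r u - M.n u) * M.gam u * (X u.toNNReal - X s)‖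
        ≤ C * (X s - X t) * |(t : ℝ) - s| := by
      refine intervalIntegral.norm_integral_le_of_norm_le_const fun u hu => ?_
      rw [uIoc_of_le hst'] at hu
      rw [norm_mul]
      refine mul_le_mul (hC u ⟨s.coe_nonneg.trans hu.1.le, hu.2.trans ht'⟩) ?_
        (norm_nonneg _) hC0
      have h1 : X u.toNNReal ≤ X s := hX (NNReal.le_toNNReal_of_coe_le hu.1.le)
      have h2 : X t ≤ X u.toNNReal := hX (Real.toNNReal_le_iff_le_coe.2 hu.2)
      rw [Real.norm_eq_abs, abs_of_nonpos (by linarith)]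
      linarith
    rw [abs_of_nonneg (by linarith)] at e5
    have e6 := (abs_le.1 e5).1
    have e7 : C * ((t : ℝ) - s) ≤ M.gam t := by
      have h1 : (M.gam t)⁻¹ ≤ D := (le_abs_self _).trans (hD t ⟨t.coe_nonneg, ht'⟩)
      have h2 : D⁻¹ ≤ M.gam t := inv_le_of_inv_le₀ (M.gam_pos t) h1
      refine le_trans ?_ h2
      calc C * ((t : ℝ) - s) ≤ (C + 1) * (D * (C + 1))⁻¹ := by
            refine mul_le_mul (by linarith) hd (by linarith) (by linarith)
        _ = D⁻¹ := by field_simp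
    have e8 : 0 ≤ X s - X t := by linarith [hX hst]
    rw [e1, e2, ← e3, e4]
    nlinarith [mul_le_mul_of_nonneg_right e7 e8]
  intro s hs t ht hst
  have hs' : s ≤ T := hs
  have ht' : t ≤ T := ht
  -- The admissible step length is uniform, so `N` equal steps lead from `s` to `t`.
  obtain ⟨N, hN⟩ := exists_nat_gt (((t : ℝ) - s) * (D * (C + 1)))
  have hDC : 0 < D * (C + 1) := by positivity
  have hst' : (s : ℝ) ≤ t := hst
  have hN0 : (0 : ℝ) < N := (mul_nonneg (by linarith) hDC.le).trans_lt hN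
  set u : ℕ → ℝ := fun k => s + k * (((t : ℝ) - s) / N) with hu
  have hq : 0 ≤ ((t : ℝ) - s) / N := div_nonneg (by linarith) hN0.le
  have hu0 : ∀ k, (s : ℝ) ≤ u k := fun k => by
    have : 0 ≤ (k : ℝ) * (((t : ℝ) - s) / N) := by positivity
    simp only [hu]; linarith
  have huN : u N = t := by simp only [hu]; field_simp; ring
  have hus : ∀ k, u k ≤ u (k + 1) := fun k => by
    simp only [hu]; push_cast; linarith
  have hmono : Monotone u := monotone_nat_of_le_succ hus
  have chain : ∀ k ≤ N, M.gam (u k) * E (u k).toNNReal ≤ M.gam s * E s := by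
    intro k
    induction k with
    | zero => intro _; simp [hu]
    | succ k ih =>
      intro hk
      refine le_trans ?_ (ih (by omega))
      have hk0 : 0 ≤ u k := s.coe_nonneg.trans (hu0 k)
      have hk1 : 0 ≤ u (k + 1) := s.coe_nonneg.trans (hu0 _)
      have := local_le (u k).toNNReal (u (k + 1)).toNNReal (Real.toNNReal_mono (hus k))
        (Real.toNNReal_le_iff_le_coe.2 (((hmono hk).trans_eq huN).trans ht')) ?_
      · rwa [Real.coe_toNNReal _ hk0, Real.coe_toNNReal _ hk1] at this
      · rw [Real.coe_toNNReal _ hk0, Real.coe_toNNReal _ hk1]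
        have : u (k + 1) - u k = ((t : ℝ) - s) / N := by simp only [hu]; push_cast; ring
        rw [this, div_le_iff₀ hN0, inv_mul_eq_div, le_div_iff₀ hDC]
        exact hN.le
  have := chain N le_rfl
  rwa [huN, Real.toNNReal_coe] at this

theorem IsImpact.zero (h : M.IsImpact T X E) : E 0 = 0 := by
  simpa using h.dynamics 0 zero_le

theorem IsImpact.nonpos_of_antitone (h : M.IsImpact T X E) (hX : Antitone X) {t : ℝ≥0}
    (ht : t ≤ T) : E t ≤ 0 := by
  have h1 := h.antitoneOn hX (mem_Iic.2 zero_le : 0 ∈ Iic T) (ht : t ∈ Iic T) zero_le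
  simp only [h.zero, mul_zero] at h1
  exact nonpos_of_mul_nonpos_right h1 (M.gam_pos t)

/-- The impact of a strategy that does not trade vanishes. -/
theorem IsImpact.eq_zero_of_const (h : M.IsImpact T X E) (hX : ∀ t, X t = X 0) {t : ℝ≥0}
    (ht : t ≤ T) : E t = 0 := by
  have h1 := h.nonpos_of_antitone (fun a b _ => by rw [hX a, hX b]) ht
  have h2 := h.neg.nonpos_of_antitone (fun a b _ => by dsimp only; rw [hX a, hX b]) ht
  linarith

end Book

/-! ### Deterministic strategies -/

theorem boundedVariationOn_add {α : Type*} [LinearOrder α] {f g : α → ℝ} {s : Set α}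
    (hf : BoundedVariationOn f s) (hg : BoundedVariationOn g s) :
    BoundedVariationOn (fun x => f x + g x) s := by
  refine ne_of_lt (lt_of_le_of_lt ?_ (ENNReal.add_lt_top.2 ⟨hf.lt_top, hg.lt_top⟩))
  refine iSup_le fun ⟨n, u, hu, hus⟩ => ?_
  calc _ ≤ ∑ i ∈ Finset.range n, (edist (f (u (i + 1))) (f (u i)) + edist (g (u (i + 1))) (g (u i))) :=
        Finset.sum_le_sum fun i _ => edist_add_add_le _ _ _ _
    _ ≤ _ := by
        rw [Finset.sum_add_distrib]
        exact add_le_add (eVariationOn.sum_le hu hus) (eVariationOn.sum_le hu hus)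

/-- The holdings whose volume impact on `(0, T]` is `φ`. -/
def Book.holdings (M : Book) (T : ℝ≥0) (x : ℝ) (φ : ℝ → ℝ) (t : ℝ≥0) : ℝ :=
  if t ≤ T then x + ((if 0 < t then φ t else 0) + ∫ s in (0 : ℝ)..t, (M.r s - M.n s) * φ s) else 0

namespace Book

variable {M : Book} {T : ℝ≥0} {x : ℝ} {φ : ℝ → ℝ}

theorem holdings_zero : M.holdings T x φ 0 = x := by simp [holdings]

theorem holdings_of_lt {t : ℝ≥0} (ht : T < t) : M.holdings T x φ t = 0 := by
  rw [holdings, if_neg ht.not_ge]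

theorem intervalIntegrable_of_continuousOn (hφ : ContinuousOn φ (Icc 0 T)) :
    IntervalIntegrable (fun s => (M.r s - M.n s) * φ s) volume 0 T :=
  (M.continuous_sub.continuousOn.mul hφ).intervalIntegrable_of_Icc T.coe_nonneg

theorem continuousOn_primitive (hφ : ContinuousOn φ (Icc 0 T)) :
    ContinuousOn (fun t => ∫ s in (0 : ℝ)..t, (M.r s - M.n s) * φ s) (Icc 0 T) := by
  have := intervalIntegral.continuousOn_primitive_interval'
    (M.intervalIntegrable_of_continuousOn hφ) left_mem_uIcc
  rwa [uIcc_of_le T.coe_nonneg] at this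

theorem continuousWithinAt_holdings (hφ : ContinuousOn φ (Icc 0 T)) (t : ℝ≥0) :
    ContinuousWithinAt (M.holdings T x φ) (Iic t) t := by
  rcases eq_or_lt_of_le (zero_le : 0 ≤ t) with rfl | h0
  · rw [show Iic (0 : ℝ≥0) = {0} from Iic_bot]
    exact continuousWithinAt_singleton
  rcases lt_or_ge T t with hT | hT
  · refine (continuousWithinAt_const (b := (0 : ℝ))).congr_of_eventuallyEq ?_ (holdings_of_lt hT)
    filter_upwards [mem_nhdsWithin_of_mem_nhds (Ioi_mem_nhds hT)] with s hs
    exact holdings_of_lt hs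
  · have h1 : ContinuousOn (fun t => x + (φ t + ∫ s in (0 : ℝ)..t, (M.r s - M.n s) * φ s))
        (Icc 0 T) := continuousOn_const.add (hφ.add (M.continuousOn_primitive hφ))
    have h2 : ContinuousWithinAt (fun t : ℝ≥0 => x + (φ t + ∫ s in (0 : ℝ)..t,
        (M.r s - M.n s) * φ s)) (Iic t) t :=
      (h1 t ⟨t.coe_nonneg, hT⟩).comp (NNReal.continuous_coe.continuousWithinAt)
        fun s hs => ⟨s.coe_nonneg, NNReal.coe_le_coe.2 (le_trans hs hT)⟩
    refine h2.congr_of_eventuallyEq ?_ (by rw [holdings, if_pos hT, if_pos h0])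
    filter_upwards [self_mem_nhdsWithin, mem_nhdsWithin_of_mem_nhds (Ioi_mem_nhds h0)] with s hs h
    rw [holdings, if_pos (le_trans hs hT), if_pos (mem_Ioi.1 h)]

theorem boundedVariationOn_holdings (hφ : AbsolutelyContinuousOnInterval φ 0 T) :
    BoundedVariationOn (M.holdings T x φ) univ := by
  have hc : ContinuousOn φ (Icc 0 T) := by
    have := hφ.continuousOn
    rwa [uIcc_of_le T.coe_nonneg] at this
  have hI := (M.intervalIntegrable_of_continuousOn hc).absolutelyContinuousOnInterval_intervalIntegral
    left_mem_uIcc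
  have comp : ∀ {f : ℝ → ℝ}, AbsolutelyContinuousOnInterval f 0 T →
      BoundedVariationOn (fun t : ℝ≥0 => f (min (t : ℝ) T)) univ := fun {f} hf => by
    refine ne_of_lt ((eVariationOn.comp_le_of_monotoneOn f (s := uIcc 0 (T : ℝ))
      (fun t : ℝ≥0 => min (t : ℝ) T) ?_ ?_).trans_lt hf.boundedVariationOn.lt_top)
    · exact fun a _ b _ h => min_le_min_right _ h
    · intro t _
      rw [uIcc_of_le T.coe_nonneg]
      exact ⟨le_min t.coe_nonneg T.coe_nonneg, min_le_right _ _⟩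
  have ind : ∀ {f : ℝ≥0 → ℝ}, Monotone f → (∀ t, |f t| ≤ 1) → BoundedVariationOn f univ :=
    fun hf h1 => (hf.monotoneOn univ).boundedVariationOn fun t _ => h1 t
  have cst : ∀ c : ℝ, BoundedVariationOn (fun _ : ℝ≥0 => c) univ := fun c =>
    (monotone_const.monotoneOn univ).boundedVariationOn (C := |c|) fun t _ => le_rfl
  have b1 : BoundedVariationOn (fun t : ℝ≥0 => if 0 < t then (1 : ℝ) else 0) univ := by
    refine ind (fun a b h => ?_) fun t => by split_ifs <;> simp
    split_ifs with h1 h2 <;> first | exact absurd (h1.trans_le h) h2 | norm_num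
  have b2 : BoundedVariationOn (fun t : ℝ≥0 => if t ≤ T then (0 : ℝ) else 1) univ := by
    refine ind (fun a b h => ?_) fun t => by split_ifs <;> simp
    split_ifs with h1 h2 <;> first | exact absurd (h.trans ‹_›) h1 | norm_num
  -- The holdings factor as the indicator of `t ≤ T` times `x + 1_{t > 0} φ + ∫ (r - n) φ`, with
  -- time stopped at `T`.
  have b3 := (boundedVariationOn_add (cst 1) ((cst (-1)).mul b2)).mul
    (boundedVariationOn_add (cst x) (boundedVariationOn_add (b1.mul (comp hφ)) (comp hI)))
  convert b3 using 1
  ext t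
  simp only [holdings, Pi.mul_apply]
  by_cases h : t ≤ T
  · have : min (t : ℝ) T = t := min_eq_left h
    simp only [if_pos h, this]
    split_ifs <;> ring
  · simp [if_neg h]

/-- The impact must vanish at time `0`, before any trade; the value `φ 0` is the size of the initial
block trade and appears only immediately after `0`. -/
theorem isImpact_holdings (hφ : ContinuousOn φ (Icc 0 T)) :
    M.IsImpact T (M.holdings T x φ) fun t => if 0 < t then φ t else 0 := by
  have hi := M.intervalIntegrable_of_continuousOn hφ
  have key : ∀ s : ℝ, 0 < s → (M.n s - M.r s) * (if 0 < s.toNNReal then φ s.toNNReal else 0)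
      = -((M.r s - M.n s) * φ s) := by
    intro s hs
    rw [if_pos (Real.toNNReal_pos.2 hs), Real.coe_toNNReal s hs.le]
    ring
  constructor
  · refine hi.neg.congr_ae ?_
    rw [uIoc_of_le T.coe_nonneg]
    filter_upwards [ae_restrict_mem measurableSet_Ioc] with s hs
    rw [key s hs.1, Pi.neg_apply]
  · intro t ht
    have h1 : ∫ s in (0 : ℝ)..t, (M.n s - M.r s) * (if 0 < s.toNNReal then φ s.toNNReal else 0)
        = -∫ s in (0 : ℝ)..t, (M.r s - M.n s) * φ s := by
      rw [← intervalIntegral.integral_neg]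
      refine intervalIntegral.integral_congr_ae (ae_of_all _ fun s hs => ?_)
      rw [uIoc_of_le t.coe_nonneg] at hs
      exact key s hs.1
    rw [h1, holdings_zero, holdings, if_pos ht]
    ring

end Book

section

variable {Ω : Type*} {mΩ : MeasurableSpace Ω} {P : Measure Ω}
  {ℱ : Filtration ℝ≥0 mΩ} {S : ℝ≥0 → Ω → ℝ} {T : ℝ≥0} {x : ℝ} {M : Book} {lam rho : ℝ → ℝ}

/-- The deterministic strategy whose volume impact on `(0, T]` is `φ`. -/
def Book.strategy (M : Book) (P : Measure Ω) (ℱ : Filtration ℝ≥0 mΩ) (T : ℝ≥0) (x : ℝ)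
    {φ : ℝ → ℝ} (hφ : AbsolutelyContinuousOnInterval φ 0 T) : Strategy P ℱ T x where
  X t _ := M.holdings T x φ t
  initial _ := Book.holdings_zero
  terminal t ht _ := Book.holdings_of_lt ht
  adapted _ := stronglyMeasurable_const
  left_continuous _ t := M.continuousWithinAt_holdings (by
    have := hφ.continuousOn
    rwa [uIcc_of_le T.coe_nonneg] at this) t
  finite_variation _ := M.boundedVariationOn_holdings hφ
  bounded_variation := ⟨(eVariationOn (M.holdings T x φ) univ).toNNReal, ae_of_all _ fun _ => by
    rw [ENNReal.coe_toNNReal (M.boundedVariationOn_holdings hφ)]⟩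

theorem Book.strategy_isVolumeImpactP (hM : M.Extends lam rho) {φ : ℝ → ℝ}
    (hφ : AbsolutelyContinuousOnInterval φ 0 T) :
    (M.strategy P ℱ T x hφ).IsVolumeImpactP blockShape lam rho
      fun t _ => if 0 < t then φ t else 0 := by
  have hc := hφ.continuousOn
  rw [uIcc_of_le T.coe_nonneg] at hc
  exact (Strategy.isVolumeImpactP_iff hM _ _).2 fun _ => M.isImpact_holdings hc

namespace Strategy

theorem cost_eq_impactFunctional [IsProbabilityMeasure P] (hM : M.Extends lam rho)
    (hS : Martingale S ℱ P) (hSr : ∀ ω t, ContinuousWithinAt (fun s => S s ω) (Ici t) t)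
    (X : Strategy P ℱ T x) {E : ℝ≥0 → Ω → ℝ}
    (hE : ∀ ω, M.IsImpact T (fun s => X.X s ω) (fun s => E s ω)) :
    X.cost blockShape lam S E = -x * ∫ ω, S 0 ω ∂P
      + ∫ ω, M.impactFunctional T x (fun s => E s.toNNReal ω) ∂P := by
  rw [X.cost_eq hM hS hSr hE]
  congr 2
  ext ω
  rw [(hE ω).impactCost_eq, X.initial]

theorem integrable_impactFunctional [IsProbabilityMeasure P] (X : Strategy P ℱ T x)
    {E : ℝ≥0 → Ω → ℝ} (hE : ∀ ω, M.IsImpact T (fun s => X.X s ω) (fun s => E s ω)) :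
    Integrable (fun ω => M.impactFunctional T x (fun s => E s.toNNReal ω)) P := by
  refine (X.integrable_impactCost hE).congr (ae_of_all _ fun ω => ?_)
  dsimp only
  rw [(hE ω).impactCost_eq, X.initial]

/-- A pathwise lower bound of the cost, up to the revenue in the unaffected price. -/
theorem le_cost [IsProbabilityMeasure P] (hM : M.Extends lam rho)
    (hS : Martingale S ℱ P) (hSr : ∀ ω t, ContinuousWithinAt (fun s => S s ω) (Ici t) t)
    (X : Strategy P ℱ T x) {E : ℝ≥0 → Ω → ℝ}
    (hE : ∀ ω, M.IsImpact T (fun s => X.X s ω) (fun s => E s ω)) {c : ℝ}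
    (hc : ∀ᵐ ω ∂P, c ≤ M.impactFunctional T x (fun s => E s.toNNReal ω)) :
    -x * ∫ ω, S 0 ω ∂P + c ≤ X.cost blockShape lam S E := by
  rw [X.cost_eq_impactFunctional hM hS hSr hE]
  gcongr
  have := integral_mono_ae (integrable_const c) (X.integrable_impactFunctional hE) hc
  simpa using this

end Strategy

theorem Book.cost_strategy [IsProbabilityMeasure P] (hM : M.Extends lam rho)
    (hS : Martingale S ℱ P) (hSr : ∀ ω t, ContinuousWithinAt (fun s => S s ω) (Ici t) t)
    {φ : ℝ → ℝ} (hφ : AbsolutelyContinuousOnInterval φ 0 T) :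
    (M.strategy P ℱ T x hφ).cost blockShape lam S (fun t _ => if 0 < t then φ t else 0)
      = -x * ∫ ω, S 0 ω ∂P + M.impactFunctional T x φ := by
  rw [Strategy.cost_eq_impactFunctional hM hS hSr _
    ((Strategy.isVolumeImpactP_iff hM _ _).1 (Book.strategy_isVolumeImpactP hM hφ))]
  simp only [integral_const, probReal_univ, one_smul]
  congr 1
  refine M.impactFunctional_congr T x fun s hs => ?_
  rw [if_pos (Real.toNNReal_pos.2 hs.1), Real.coe_toNNReal s hs.1.le]

end

/-! ### Books on the half-line -/

/-- The resilience is positive, and the coefficients are `C¹` on `[0, ∞)`. -/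
structure Book.IsSmooth (M : Book) : Prop where
  r_pos : ∀ t, 0 < M.r t
  contDiffOn_r : ContDiffOn ℝ 1 M.r (Ici 0)
  contDiffOn_n : ContDiffOn ℝ 1 M.n (Ici 0)

/-- Resilience and `η` are frozen at their value at `0` for negative times, and the depth is rebuilt
as the exponential of the primitive of `η`. This yields two-sided derivatives everywhere. -/
theorem exists_book {lam rho : ℝ → ℝ}
    (hlam : ContDiffOn ℝ 2 lam (Ici 0)) (hlam_pos : ∀ t, 0 ≤ t → 0 < lam t)
    (hrho : ContDiffOn ℝ 1 rho (Ici 0)) (hrho_pos : ∀ t, 0 ≤ t → 0 < rho t) :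
    ∃ M : Book, M.Extends lam rho ∧ M.IsSmooth := by
  have heta : ContDiffOn ℝ 1 (eta lam) (Ici 0) :=
    (hlam.derivWithin (uniqueDiffOn_Ici 0) (by norm_num)).div (hlam.of_le (by norm_num))
      fun t ht => (hlam_pos t ht).ne'
  have hmax : ∀ t : ℝ, max t 0 ∈ Ici (0 : ℝ) := fun t => le_max_right t 0
  have hcmax : Continuous fun t : ℝ => max t 0 := continuous_id.max continuous_const
  set n : ℝ → ℝ := fun t => eta lam (max t 0) with hn
  have hnc : Continuous n := heta.continuousOn.comp_continuous hcmax hmax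
  have hN : ∀ t, HasDerivAt (fun t => ∫ s in (0 : ℝ)..t, n s) (n t) t := fun t =>
    intervalIntegral.integral_hasDerivAt_right (hnc.intervalIntegrable 0 t)
      (hnc.stronglyMeasurableAtFilter _ _) hnc.continuousAt
  have h0 : 0 < lam 0 := hlam_pos 0 le_rfl
  have hL : ∀ t, 0 ≤ t → lam 0 * Real.exp (∫ s in (0 : ℝ)..t, n s) = lam t := by
    intro t ht
    -- The quotient of the given depth by the rebuilt exponential has zero derivative, hence is
    -- constant.
    have hd : ∀ u, 0 ≤ u → HasDerivWithinAt (fun u => lam u * Real.exp (-∫ s in (0 : ℝ)..u, n s))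
        0 (Ici 0) u := by
      intro u hu
      have h1 := ((hlam.differentiableOn (by norm_num)) u hu).hasDerivWithinAt
      have h2 := (hN u).fun_neg.exp.hasDerivWithinAt (s := Ici 0)
      refine (h1.mul h2).congr_deriv ?_
      have h3 : n u = derivWithin lam (Ici 0) u / lam u := by simp only [hn, max_eq_left hu, eta]
      have h4 := (hlam_pos u hu).ne'
      rw [h3]
      field_simp
      ring
    have := constant_of_has_deriv_right_zero (a := 0) (b := t)
      (fun u hu => (hd u hu.1).continuousWithinAt.mono Icc_subset_Ici_self)
      (fun u hu => (hd u hu.1).mono (Ici_subset_Ici.2 hu.1)) t (right_mem_Icc.2 ht)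
    simp only [intervalIntegral.integral_same, neg_zero, Real.exp_zero, mul_one] at this
    rw [← this, mul_assoc, ← Real.exp_add]
    simp
  refine ⟨⟨fun t => lam 0 * Real.exp (∫ s in (0 : ℝ)..t, n s), fun t => rho (max t 0), n,
    hrho.continuousOn.comp_continuous hcmax hmax, hnc, fun t => ?_, fun t => by positivity⟩,
    ⟨hL, fun t ht => ?_, fun t ht => ?_⟩, ⟨fun t => hrho_pos _ (hmax t), ?_, ?_⟩⟩
  · refine ((hN t).exp.const_mul (lam 0)).congr_deriv ?_
    ring
  · simp only [max_eq_left ht]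
  · simp only [hn, max_eq_left ht]
  · exact hrho.congr fun t ht => by simp only [max_eq_left (mem_Ici.1 ht)]
  · exact heta.congr fun t ht => by simp only [hn, max_eq_left (mem_Ici.1 ht)]

/-- A continuous function that is negative at a point of `[0, T]` is negative on an interval. -/
theorem exists_Icc_neg {f : ℝ → ℝ} {T : ℝ} (hT : 0 < T) (hf : ContinuousOn f (Icc 0 T)) {t : ℝ}
    (ht : t ∈ Icc 0 T) (hneg : f t < 0) :
    ∃ a b, 0 ≤ a ∧ a < b ∧ b ≤ T ∧ ∀ s ∈ Icc a b, f s < 0 := by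
  obtain ⟨δ, hδ, h⟩ := Metric.mem_nhdsWithin_iff.1 ((hf t ht).eventually_lt_const hneg)
  have key : ∀ s, 0 ≤ s → s ≤ T → |s - t| < δ → f s < 0 := fun s h0 h1 h2 => h ⟨h2, h0, h1⟩
  rcases lt_or_ge t T with htT | htT
  · refine ⟨t, min T (t + δ / 2), ht.1, lt_min htT (by linarith), min_le_left _ _, fun s hs => ?_⟩
    refine key s (ht.1.trans hs.1) (hs.2.trans (min_le_left _ _)) ?_
    have := hs.2.trans (min_le_right _ _)
    rw [abs_of_nonneg (by linarith [hs.1])]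
    linarith
  · refine ⟨max 0 (T - δ / 2), T, le_max_left _ _, max_lt hT (by linarith), le_rfl, fun s hs => ?_⟩
    refine key s ((le_max_left _ _).trans hs.1) hs.2 ?_
    have := (le_max_right _ _).trans hs.1
    rw [abs_lt]
    constructor <;> linarith [hs.2, ht.2]

/-! ### Sign of the impact functional -/

namespace Book

variable {M : Book} {T : ℝ≥0} {x : ℝ} {φ : ℝ → ℝ}

theorem continuous_two_mul_sub_div : Continuous fun s => (2 * M.r s - M.n s) / (2 * M.L s) :=
  M.continuous_two_mul_sub.div₀ (continuous_const.mul M.continuous_L) fun s =>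
    (mul_pos two_pos (M.L_pos s)).ne'

/-- Profitable round trips if `2 ρ < η` on an interval. -/
theorem exists_impactFunctional_neg {a b : ℝ} (ha : 0 ≤ a) (hab : a < b) (hb : b ≤ T)
    (hneg : ∀ s ∈ Icc a b, 2 * M.r s - M.n s < 0) :
    ∃ φ : ℝ → ℝ, AbsolutelyContinuousOnInterval φ 0 T ∧ M.impactFunctional T 0 φ < 0 := by
  -- A Lipschitz bump, positive exactly on `(a, b)`.
  set u : ℝ → ℝ := fun s => max ((s - a) * (b - s)) 0 with hu
  have huc : Continuous u := by fun_prop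
  have hu0 : ∀ s, s ∉ Icc a b → u s = 0 := by
    intro s hs
    refine max_eq_right ?_
    rcases lt_or_ge s a with h | h
    · nlinarith
    · have : b < s := not_le.1 fun h' => hs ⟨h, h'⟩
      nlinarith
  have hup : ∀ s, a < s → s < b → 0 < u s := fun s h1 h2 =>
    lt_max_of_lt_left (mul_pos (by linarith) (by linarith))
  have huac : AbsolutelyContinuousOnInterval u 0 T := by
    have h1 : ContDiffOn ℝ 1 (fun s : ℝ => (s - a) * (b - s)) (uIcc 0 (T : ℝ)) := by fun_prop
    obtain ⟨K, hK⟩ := h1.exists_lipschitzOnWith (by decide) (convex_uIcc _ _) isCompact_uIcc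
    have := (LipschitzWith.id.max_const (0 : ℝ)).comp_lipschitzOnWith hK
    exact LipschitzOnWith.absolutelyContinuousOnInterval this
  -- Two free parameters against one linear constraint leave a nonzero solution; the constraint
  -- removes the terminal square.
  obtain ⟨α, β, hne, horth⟩ : ∃ α β : ℝ, (α ≠ 0 ∨ β ≠ 0) ∧
      ∫ s in (0 : ℝ)..T, (M.r s - M.n s) * (u s * (α * s + β)) = 0 := by
    have hi : ∀ f : ℝ → ℝ, Continuous f → IntervalIntegrable f volume 0 T := fun f hf =>
      hf.intervalIntegrable 0 T
    have hrc := M.continuous_sub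
    have key : ∀ α β : ℝ, ∫ s in (0 : ℝ)..T, (M.r s - M.n s) * (u s * (α * s + β))
        = α * (∫ s in (0 : ℝ)..T, (M.r s - M.n s) * (u s * s))
          + β * ∫ s in (0 : ℝ)..T, (M.r s - M.n s) * u s := by
      intro α β
      rw [← intervalIntegral.integral_const_mul, ← intervalIntegral.integral_const_mul,
        ← intervalIntegral.integral_add (hi _ (by fun_prop)) (hi _ (by fun_prop))]
      congr 1; ext s; ring
    by_cases h : ∫ s in (0 : ℝ)..T, (M.r s - M.n s) * u s = 0
    · exact ⟨0, 1, Or.inr one_ne_zero, by rw [key, h]; ring⟩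
    · exact ⟨_, -∫ s in (0 : ℝ)..T, (M.r s - M.n s) * (u s * s), Or.inl h, by rw [key]; ring⟩
  refine ⟨fun s => u s * (α * s + β), huac.mul (ContDiffOn.absolutelyContinuousOnInterval
    (by fun_prop)), ?_⟩
  rw [impactFunctional, horth]
  have hcc : Continuous fun s => (2 * M.r s - M.n s) / (2 * M.L s) := M.continuous_two_mul_sub_div
  have hpos : 0 < ∫ s in (0 : ℝ)..T,
      -((2 * M.r s - M.n s) / (2 * M.L s) * (u s * (α * s + β)) ^ 2) := by
    have hle : ∀ s ∈ Icc a b, 0 < -((2 * M.r s - M.n s) / (2 * M.L s)) := fun s hs =>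
      neg_pos.2 (div_neg_of_neg_of_pos (hneg s hs) (mul_pos two_pos (M.L_pos s)))
    have hpt : ∀ s, a < s → s < b → α * s + β ≠ 0 →
        0 < -((2 * M.r s - M.n s) / (2 * M.L s) * (u s * (α * s + β)) ^ 2) := by
      intro s h1 h2 h3
      rw [← neg_mul]
      have h4 : u s * (α * s + β) ≠ 0 := mul_ne_zero (hup s h1 h2).ne' h3
      exact mul_pos (hle s ⟨h1.le, h2.le⟩) (by positivity)
    refine intervalIntegral.integral_pos (by linarith) (Continuous.continuousOn (by fun_prop))
      (fun s _ => ?_) ?_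
    · by_cases hs : s ∈ Icc a b
      · rw [← neg_mul]
        exact mul_nonneg (hle s hs).le (sq_nonneg _)
      · rw [hu0 s hs]; simp
    -- A nonzero affine function has at most one zero, so one of two points of `(a, b)` gives a
    -- strictly positive integrand.
    · by_cases h1 : α * ((a + b) / 2) + β = 0
      · refine ⟨(3 * a + b) / 4, ⟨by linarith, by linarith⟩,
          hpt _ (by linarith) (by linarith) fun h2 => ?_⟩
        have h3 : α * (b - a) = 0 := by linarith
        have hα : α = 0 := (mul_eq_zero.1 h3).resolve_right (by linarith)
        rw [hα] at h1
        rcases hne with h | h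
        · exact h hα
        · exact h (by linarith)
      · exact ⟨(a + b) / 2, ⟨by linarith, by linarith⟩, hpt _ (by linarith) (by linarith) h1⟩
  rw [intervalIntegral.integral_neg] at hpos
  simp only [add_zero, ne_eq, OfNat.ofNat_ne_zero, not_false_eq_true, zero_pow, zero_div, zero_add]
  linarith

theorem impactFunctional_nonneg (h : ∀ t ∈ Icc (0 : ℝ) T, 0 ≤ 2 * M.r t - M.n t) :
    0 ≤ M.impactFunctional T x φ := by
  have hL := M.L_pos T
  refine add_nonneg (by positivity) (intervalIntegral.integral_nonneg T.coe_nonneg fun s hs => ?_)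
  exact mul_nonneg (div_nonneg (h s hs) (mul_pos two_pos (M.L_pos s)).le) (sq_nonneg _)

/-! ### The optimal impact -/

/-- The ratio `(ρ - η) / (2 ρ - η)`. -/
def w (M : Book) (t : ℝ) : ℝ := (M.r t - M.n t) / (2 * M.r t - M.n t)

/-- The effective depth over `[0, T]`. -/
def depth (M : Book) (T : ℝ) : ℝ := M.L T + ∫ s in (0 : ℝ)..T, M.L s * ((M.r s - M.n s) * M.w s)

theorem continuousOn_w (h : ∀ t ∈ Icc (0 : ℝ) T, 0 < 2 * M.r t - M.n t) :
    ContinuousOn M.w (Icc 0 T) :=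
  M.continuous_sub.continuousOn.div M.continuous_two_mul_sub.continuousOn fun t ht => (h t ht).ne'

theorem depth_pos (h : ∀ t ∈ Icc (0 : ℝ) T, 0 < 2 * M.r t - M.n t) : 0 < M.depth T := by
  refine add_pos_of_pos_of_nonneg (M.L_pos T)
    (intervalIntegral.integral_nonneg T.coe_nonneg fun s hs => ?_)
  rw [w, ← mul_div_assoc]
  exact mul_nonneg (M.L_pos s).le (div_nonneg (mul_self_nonneg _) (h s hs).le)

/-- Completing the square. -/
theorem impactFunctional_eq (h : ∀ t ∈ Icc (0 : ℝ) T, 0 < 2 * M.r t - M.n t)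
    (hφ : ∀ (c : ℝ → ℝ) (k : ℕ), ContinuousOn c (Icc 0 T) →
      IntervalIntegrable (fun s => c s * φ s ^ k) volume 0 T) :
    M.impactFunctional T x φ = x ^ 2 / (2 * M.depth T)
      + (x + (∫ s in (0 : ℝ)..T, (M.r s - M.n s) * φ s) - x / M.depth T * M.L T) ^ 2 / (2 * M.L T)
      + ∫ s in (0 : ℝ)..T, (2 * M.r s - M.n s) / (2 * M.L s)
        * (φ s + x / M.depth T * (M.L s * M.w s)) ^ 2 := by
  have hK := M.depth_pos h
  set K := M.depth T with hKdef
  have hw := M.continuousOn_w h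
  have hcc := M.continuous_two_mul_sub_div
  have hJc : ContinuousOn (fun s => M.L s * ((M.r s - M.n s) * M.w s)) (Icc 0 T) :=
    M.continuous_L.continuousOn.mul (M.continuous_sub.continuousOn.mul hw)
  have h1 : IntervalIntegrable (fun s => (M.r s - M.n s) * φ s) volume 0 T := by
    simpa using hφ _ 1 M.continuous_sub.continuousOn
  have h2 := hφ _ 2 hcc.continuousOn
  have h3 := hJc.intervalIntegrable_of_Icc (μ := volume) T.coe_nonneg
  -- By `(2r - n) w = r - n`, the cross term of the square is `(x / K) (r - n) φ` and its last term
  -- is half of `(x / K)² L (r - n) w`.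
  have e : ∫ s in (0 : ℝ)..T, (2 * M.r s - M.n s) / (2 * M.L s)
        * (φ s + x / K * (M.L s * M.w s)) ^ 2
      = (∫ s in (0 : ℝ)..T, (2 * M.r s - M.n s) / (2 * M.L s) * φ s ^ 2)
        + x / K * (∫ s in (0 : ℝ)..T, (M.r s - M.n s) * φ s)
        + (x / K) ^ 2 / 2 * ∫ s in (0 : ℝ)..T, M.L s * ((M.r s - M.n s) * M.w s) := by
    rw [← intervalIntegral.integral_const_mul, ← intervalIntegral.integral_const_mul,
      ← intervalIntegral.integral_add h2 (h1.const_mul _),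
      ← intervalIntegral.integral_add (h2.add (h1.const_mul _)) (h3.const_mul _)]
    refine intervalIntegral.integral_congr fun s hs => ?_
    rw [uIcc_of_le T.coe_nonneg] at hs
    have hs0 := (h s hs).ne'
    have hL := (M.L_pos s).ne'
    simp only [w]
    field_simp
    ring
  have hJ : ∫ s in (0 : ℝ)..T, M.L s * ((M.r s - M.n s) * M.w s) = K - M.L T := by
    rw [hKdef, depth]; ring
  have hL := (M.L_pos T).ne'
  rw [e, hJ, impactFunctional]
  field_simp
  ring

theorem le_impactFunctional (h : ∀ t ∈ Icc (0 : ℝ) T, 0 < 2 * M.r t - M.n t)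
    (hφ : ∀ (c : ℝ → ℝ) (k : ℕ), ContinuousOn c (Icc 0 T) →
      IntervalIntegrable (fun s => c s * φ s ^ k) volume 0 T) :
    x ^ 2 / (2 * M.depth T) + ∫ s in (0 : ℝ)..T, (2 * M.r s - M.n s) / (2 * M.L s)
        * (φ s + x / M.depth T * (M.L s * M.w s)) ^ 2 ≤ M.impactFunctional T x φ := by
  rw [impactFunctional_eq h hφ]
  have hL := M.L_pos T
  have : 0 ≤ (x + (∫ s in (0 : ℝ)..T, (M.r s - M.n s) * φ s) - x / M.depth T * M.L T) ^ 2
    / (2 * M.L T) := by positivity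
  linarith

/-- The optimal volume impact. -/
def optimal (M : Book) (T x : ℝ) (s : ℝ) : ℝ := -(x / M.depth T * (M.L s * M.w s))

theorem continuousOn_optimal (h : ∀ t ∈ Icc (0 : ℝ) T, 0 < 2 * M.r t - M.n t) :
    ContinuousOn (M.optimal T x) (Icc 0 T) :=
  (continuousOn_const.mul (M.continuous_L.continuousOn.mul (M.continuousOn_w h))).neg

theorem impactFunctional_optimal (h : ∀ t ∈ Icc (0 : ℝ) T, 0 < 2 * M.r t - M.n t) :
    M.impactFunctional T x (M.optimal T x) = x ^ 2 / (2 * M.depth T) := by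
  have hK := (M.depth_pos h).ne'
  rw [impactFunctional_eq h fun c k hc =>
    (hc.mul ((continuousOn_optimal h).pow k)).intervalIntegrable_of_Icc T.coe_nonneg]
  have e : ∫ s in (0 : ℝ)..T, (M.r s - M.n s) * M.optimal T x s
      = -(x / M.depth T) * (M.depth T - M.L T) := by
    rw [depth, add_sub_cancel_left, ← intervalIntegral.integral_const_mul]
    congr 1; ext s; rw [optimal, depth]; ring
  rw [e]
  have e2 : ∀ s, M.optimal T x s + x / M.depth T * (M.L s * M.w s) = 0 := fun s => by
    rw [optimal]; ring
  simp only [e2]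
  have e3 : x + -(x / M.depth T) * (M.depth T - M.L T) - x / M.depth T * M.L T = 0 := by
    field_simp; ring
  rw [e3]
  simp

end Book

namespace Book

variable {M : Book} {T : ℝ≥0} {x : ℝ} {φ : ℝ → ℝ}

/-! ### Monotonicity of the optimal strategy -/

theorem contDiff_L (M : Book) : ContDiff ℝ 1 M.L := by
  rw [contDiff_one_iff_deriv]
  refine ⟨fun s => (M.hasDerivAt_L s).differentiableAt, ?_⟩
  rw [show deriv M.L = fun s => M.n s * M.L s from funext fun s => (M.hasDerivAt_L s).deriv]
  exact M.continuous_n.mul M.continuous_L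

theorem IsSmooth.differentiableWithinAt_w (hM : M.IsSmooth) {t : ℝ} (ht : 0 ≤ t)
    (h : 2 * M.r t - M.n t ≠ 0) : DifferentiableWithinAt ℝ M.w (Ici 0) t := by
  have hr := hM.contDiffOn_r.differentiableOn (by norm_num) t ht
  have hn := hM.contDiffOn_n.differentiableOn (by norm_num) t ht
  exact (hr.sub hn).div ((hr.const_mul 2).sub hn) h

/-- Continuity is needed to spread a failure of `w' + r w ≥ 0` from one time to an interval. -/
theorem IsSmooth.continuousOn_derivWithin_w (hM : M.IsSmooth)
    (h : ∀ t ∈ Icc (0 : ℝ) T, 0 < 2 * M.r t - M.n t) :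
    ContinuousOn (derivWithin M.w (Ici 0)) (Icc 0 T) := by
  have hr := (hM.contDiffOn_r.continuousOn_derivWithin (uniqueDiffOn_Ici 0) le_rfl).mono
    (Icc_subset_Ici_self : Icc (0 : ℝ) T ⊆ Ici 0)
  have hn := (hM.contDiffOn_n.continuousOn_derivWithin (uniqueDiffOn_Ici 0) le_rfl).mono
    (Icc_subset_Ici_self : Icc (0 : ℝ) T ⊆ Ici 0)
  have hd := M.continuous_two_mul_sub.continuousOn (s := Icc 0 (T : ℝ))
  refine ContinuousOn.congr (f := fun t =>
    ((derivWithin M.r (Ici 0) t - derivWithin M.n (Ici 0) t) * (2 * M.r t - M.n t)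
      - (M.r t - M.n t) * (2 * derivWithin M.r (Ici 0) t - derivWithin M.n (Ici 0) t))
      / (2 * M.r t - M.n t) ^ 2) ?_ fun t ht => ?_
  · exact (((hr.sub hn).mul hd).sub (M.continuous_sub.continuousOn.mul
      ((continuousOn_const.mul hr).sub hn))).div (hd.pow 2) fun t ht => pow_ne_zero 2 (h t ht).ne'
  · have h1 := (hM.contDiffOn_r.differentiableOn (by norm_num) t ht.1).hasDerivWithinAt
    have h2 := (hM.contDiffOn_n.differentiableOn (by norm_num) t ht.1).hasDerivWithinAt
    exact ((h1.sub h2).div ((h1.const_mul 2).sub h2) (h t ht).ne').derivWithin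
      (uniqueDiffOn_Ici 0 t ht.1)

theorem IsSmooth.hasDerivAt_w (hM : M.IsSmooth) {t : ℝ} (ht : 0 < t)
    (h : 2 * M.r t - M.n t ≠ 0) : HasDerivAt M.w (derivWithin M.w (Ici 0) t) t :=
  (hM.differentiableWithinAt_w ht.le h).hasDerivWithinAt.hasDerivAt (Ici_mem_nhds ht)

theorem IsSmooth.contDiffOn_w (hM : M.IsSmooth)
    (h : ∀ t ∈ Icc (0 : ℝ) T, 0 < 2 * M.r t - M.n t) : ContDiffOn ℝ 1 M.w (Icc 0 T) := by
  have hr := hM.contDiffOn_r.mono (Icc_subset_Ici_self : Icc (0 : ℝ) T ⊆ Ici 0)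
  have hn := hM.contDiffOn_n.mono (Icc_subset_Ici_self : Icc (0 : ℝ) T ⊆ Ici 0)
  exact (hr.sub hn).div ((contDiffOn_const.mul hr).sub hn) fun t ht => (h t ht).ne'

theorem IsSmooth.absolutelyContinuous_optimal (hM : M.IsSmooth)
    (h : ∀ t ∈ Icc (0 : ℝ) T, 0 < 2 * M.r t - M.n t) :
    AbsolutelyContinuousOnInterval (M.optimal T x) 0 T := by
  apply ContDiffOn.absolutelyContinuousOnInterval
  rw [uIcc_of_le T.coe_nonneg]
  exact (contDiffOn_const.mul (M.contDiff_L.contDiffOn.mul (hM.contDiffOn_w h))).neg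

theorem two_mul_sub_pos (hM : M.IsSmooth) {t : ℝ} (h : 0 ≤ M.r t - M.n t) :
    0 < 2 * M.r t - M.n t := by
  linarith [hM.r_pos t]

/-- With `c = x / K`, the holdings have slope `-c L (w' + r w)` inside the period, an initial trade
`-c L_0 w_0` and a final trade `-c L_T (1 - w_T)`. All three are nonpositive, since `0 ≤ w ≤ 1`. -/
theorem IsSmooth.antitone_holdings_optimal (hM : M.IsSmooth) (hx : 0 ≤ x)
    (h1 : ∀ t ∈ Icc (0 : ℝ) T, 0 ≤ M.r t - M.n t)
    (h2 : ∀ t ∈ Icc (0 : ℝ) T, 0 ≤ derivWithin M.w (Ici 0) t + M.r t * M.w t) :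
    Antitone (M.holdings T x (M.optimal T x)) := by
  have h : ∀ t ∈ Icc (0 : ℝ) T, 0 < 2 * M.r t - M.n t := fun t ht => two_mul_sub_pos hM (h1 t ht)
  have hK := M.depth_pos h
  have hc : 0 ≤ x / M.depth T := by positivity
  set c := x / M.depth T with hcdef
  have hoc := M.continuousOn_optimal (x := x) h
  set g : ℝ → ℝ := fun t => M.optimal T x t
    + ∫ s in (0 : ℝ)..t, (M.r s - M.n s) * M.optimal T x s with hg
  have hw0 : ∀ t ∈ Icc (0 : ℝ) T, 0 ≤ M.w t := fun t ht => div_nonneg (h1 t ht) (h t ht).le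
  have hganti : AntitoneOn g (Icc 0 T) := by
    refine antitoneOn_of_hasDerivWithinAt_nonpos (f' := fun t =>
      -(c * (M.L t * (derivWithin M.w (Ici 0) t + M.r t * M.w t)))) (convex_Icc _ _)
      (hoc.add (M.continuousOn_primitive hoc)) ?_ ?_
    · intro t ht
      rw [interior_Icc] at ht ⊢
      have ht' : t ∈ Icc (0 : ℝ) T := Ioo_subset_Icc_self ht
      have d1 := (((M.hasDerivAt_L t).mul (hM.hasDerivAt_w ht.1 (h t ht').ne')).const_mul c).fun_neg
      have hcont : ContinuousOn (fun s => (M.r s - M.n s) * M.optimal T x s) (Icc 0 T) :=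
        M.continuous_sub.continuousOn.mul hoc
      have d2 : HasDerivAt (fun t => ∫ s in (0 : ℝ)..t, (M.r s - M.n s) * M.optimal T x s)
          ((M.r t - M.n t) * M.optimal T x t) t := by
        refine intervalIntegral.integral_hasDerivAt_right
          ((hcont.mono (Icc_subset_Icc_right ht.2.le)).intervalIntegrable_of_Icc ht.1.le)
          ?_ (hcont.continuousAt (Icc_mem_nhds ht.1 ht.2))
        exact (hcont.mono Ioo_subset_Icc_self).stronglyMeasurableAtFilter isOpen_Ioo t ht
      refine ((d1.add d2).congr_deriv ?_).hasDerivWithinAt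
      rw [optimal, ← hcdef]
      ring
    · intro t ht
      rw [interior_Icc] at ht
      have ht' : t ∈ Icc (0 : ℝ) T := Ioo_subset_Icc_self ht
      exact neg_nonpos.2 (mul_nonneg hc (mul_nonneg (M.L_pos t).le (h2 t ht')))
  have hg0 : g 0 ≤ 0 := by
    have h0 : (0 : ℝ) ∈ Icc (0 : ℝ) T := ⟨le_rfl, T.coe_nonneg⟩
    simp only [hg, intervalIntegral.integral_same, add_zero, optimal, ← hcdef]
    exact neg_nonpos.2 (mul_nonneg hc (mul_nonneg (M.L_pos 0).le (hw0 0 h0)))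
  have hTm : (T : ℝ) ∈ Icc (0 : ℝ) T := ⟨T.coe_nonneg, le_rfl⟩
  have hgT : 0 ≤ x + g T := by
    have e : ∫ s in (0 : ℝ)..T, (M.r s - M.n s) * M.optimal T x s
        = -c * (M.depth T - M.L T) := by
      rw [depth, add_sub_cancel_left, ← intervalIntegral.integral_const_mul]
      congr 1; ext s; rw [optimal, ← hcdef]; ring
    have e1 : x = c * M.depth T := by rw [hcdef]; field_simp
    have e2 : M.w T ≤ 1 := by
      rw [w, div_le_one (h T hTm)]
      linarith [hM.r_pos T]
    have e3 : x + g T = c * (M.L T * (1 - M.w T)) := by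
      simp only [hg]
      rw [e, optimal, ← hcdef]
      linear_combination e1
    rw [e3]
    exact mul_nonneg hc (mul_nonneg (M.L_pos T).le (by linarith))
  have hpos : ∀ t : ℝ≥0, 0 < t → t ≤ T → M.holdings T x (M.optimal T x) t = x + g t :=
    fun t h0 hT => by rw [holdings, if_pos hT, if_pos h0]
  have hmem : ∀ t : ℝ≥0, t ≤ T → (t : ℝ) ∈ Icc (0 : ℝ) T := fun t ht => ⟨t.coe_nonneg, ht⟩
  have hge : ∀ t : ℝ≥0, 0 ≤ M.holdings T x (M.optimal T x) t := by
    intro t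
    rcases lt_or_ge T t with hT | hT
    · rw [holdings_of_lt hT]
    rcases eq_or_lt_of_le (zero_le : 0 ≤ t) with rfl | h0
    · rwa [holdings_zero]
    · rw [hpos t h0 hT]
      linarith [hganti (hmem t hT) hTm hT]
  intro s t hst
  rcases lt_or_ge T t with hT | hT
  · rw [holdings_of_lt hT]
    exact hge s
  rcases eq_or_lt_of_le (zero_le : 0 ≤ t) with rfl | h0
  · rw [le_antisymm hst zero_le]
  rw [hpos t h0 hT]
  have hgt := hganti (hmem 0 zero_le) (hmem t hT) (NNReal.coe_le_coe.2 h0.le)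
  rw [NNReal.coe_zero] at hgt
  rcases eq_or_lt_of_le (zero_le : 0 ≤ s) with rfl | hs0
  · rw [holdings_zero]
    linarith
  · rw [hpos s hs0 (hst.trans hT)]
    linarith [hganti (hmem s (hst.trans hT)) (hmem t hT) hst]

theorem holdings_neg_optimal (t : ℝ≥0) :
    M.holdings T (-x) (M.optimal T (-x)) t = -M.holdings T x (M.optimal T x) t := by
  have h : ∀ s, M.optimal T (-x) s = -M.optimal T x s := fun s => by
    rw [optimal, optimal]; ring
  simp only [holdings, h, mul_neg, intervalIntegral.integral_neg]
  split_ifs <;> ring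

theorem IsSmooth.antitone_or_monotone_holdings_optimal (hM : M.IsSmooth) (x : ℝ)
    (h1 : ∀ t ∈ Icc (0 : ℝ) T, 0 ≤ M.r t - M.n t)
    (h2 : ∀ t ∈ Icc (0 : ℝ) T, 0 ≤ derivWithin M.w (Ici 0) t + M.r t * M.w t) :
    Antitone (M.holdings T x (M.optimal T x)) ∨ Monotone (M.holdings T x (M.optimal T x)) := by
  rcases le_total 0 x with hx | hx
  · exact Or.inl (hM.antitone_holdings_optimal hx h1 h2)
  · refine Or.inr ?_
    have := hM.antitone_holdings_optimal (neg_nonneg.2 hx) h1 h2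
    simp only [funext holdings_neg_optimal] at this
    simpa using this.neg

/-! ### Pure sell programs when the optimal strategy is not monotone -/

/-- The optimal value of `γE` is `-G` with `G = c γ L w` and `G' = c γ L (w' + r w) < 0`. So it
increases strictly on `[a, b]`, whereas `γE` is nonincreasing for a sell program. The mismatch
bounds the completed square from below, uniformly in the program. -/
theorem IsSmooth.exists_add_le_impactFunctional_of_antitone (hM : M.IsSmooth)
    (h : ∀ t ∈ Icc (0 : ℝ) T, 0 < 2 * M.r t - M.n t) {a b : ℝ} (ha : 0 ≤ a) (hab : a < b)
    (hb : b ≤ T) (hneg : ∀ s ∈ Icc a b, derivWithin M.w (Ici 0) s + M.r s * M.w s < 0)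
    (hx : 0 < x) :
    ∃ δ > 0, ∀ X E : ℝ≥0 → ℝ, M.IsImpact T X E → (∀ t, ContinuousWithinAt X (Iic t) t) →
      BoundedVariationOn X univ → Antitone X →
      x ^ 2 / (2 * M.depth T) + δ ≤ M.impactFunctional T x fun s => E s.toNNReal := by
  have hK := M.depth_pos h
  have hc : 0 < x / M.depth T := by positivity
  set c := x / M.depth T with hcdef
  have hsub : Icc a b ⊆ Icc (0 : ℝ) T := Icc_subset_Icc ha hb
  set G : ℝ → ℝ := fun s => c * (M.gam s * (M.L s * M.w s)) with hG
  have hanti : StrictAntiOn G (Icc a b) := by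
    refine strictAntiOn_of_hasDerivWithinAt_neg (f' := fun s =>
      c * (M.gam s * M.L s * (derivWithin M.w (Ici 0) s + M.r s * M.w s))) (convex_Icc _ _) ?_ ?_ ?_
    · exact continuousOn_const.mul (M.continuous_gam.continuousOn.mul
        (M.continuous_L.continuousOn.mul ((M.continuousOn_w h).mono hsub)))
    · intro s hs
      rw [interior_Icc] at hs ⊢
      have hs' := hsub (Ioo_subset_Icc_self hs)
      have d := ((M.hasDerivAt_gam s).mul ((M.hasDerivAt_L s).mul
        (hM.hasDerivAt_w (ha.trans_lt hs.1) (h s hs').ne'))).const_mul c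
      refine (d.congr_deriv ?_).hasDerivWithinAt
      simp only [Pi.mul_apply]
      ring
    · intro s hs
      rw [interior_Icc] at hs
      exact mul_neg_of_pos_of_neg hc (mul_neg_of_pos_of_neg
        (mul_pos (M.gam_pos s) (M.L_pos s)) (hneg s (Ioo_subset_Icc_self hs)))
  set κ : ℝ → ℝ := fun s => (2 * M.r s - M.n s) / (2 * M.L s) / M.gam s ^ 2 with hκ
  have hκc : Continuous κ := M.continuous_two_mul_sub_div.div₀ (M.continuous_gam.pow 2) fun s =>
    pow_ne_zero 2 (M.gam_pos s).ne'
  have hκ0 : ∀ s ∈ Icc (0 : ℝ) T, 0 < κ s := fun s hs =>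
    div_pos (div_pos (h s hs) (mul_pos two_pos (M.L_pos s))) (pow_pos (M.gam_pos s) 2)
  obtain ⟨s₀, hs₀, hmin⟩ := isCompact_Icc.exists_isMinOn (s := Icc (0 : ℝ) T)
    ⟨0, le_rfl, T.coe_nonneg⟩ hκc.continuousOn
  have hmin' : ∀ s ∈ Icc (0 : ℝ) T, κ s₀ ≤ κ s := fun s hs => hmin hs
  -- The sum `γE + G` is nonincreasing and drops by at least `2 d` between the thirds `p` and `q`,
  -- so on one of the outer thirds its absolute value is at least `d`.
  set p := a + (b - a) / 3 with hp
  set q := a + 2 * (b - a) / 3 with hq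
  have hpm : p ∈ Icc a b := ⟨by rw [hp]; linarith, by rw [hp]; linarith⟩
  have hqm : q ∈ Icc a b := ⟨by rw [hq]; linarith, by rw [hq]; linarith⟩
  have hpq : p < q := by rw [hp, hq]; linarith
  have hd : 0 < (G p - G q) / 2 := by linarith [hanti hpm hqm hpq]
  set d := (G p - G q) / 2 with hddef
  have hδ : 0 < κ s₀ * d ^ 2 * ((b - a) / 3) := by
    have := hκ0 s₀ hs₀
    have : 0 < b - a := by linarith
    positivity
  refine ⟨_, hδ, fun X E hE hl hX hXa => ?_⟩
  refine le_trans (add_le_add le_rfl ?_)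
    (M.le_impactFunctional h fun _ k hc => hE.intervalIntegrable hl hX hc k)
  rw [← hcdef]
  set F : ℝ → ℝ := fun s => (2 * M.r s - M.n s) / (2 * M.L s)
    * (E s.toNNReal + c * (M.L s * M.w s)) ^ 2 with hF
  have hFi : IntervalIntegrable F volume 0 T := by
    have hcc := M.continuous_two_mul_sub_div.continuousOn (s := Icc 0 (T : ℝ))
    have hf : ContinuousOn (fun s => c * (M.L s * M.w s)) (Icc 0 (T : ℝ)) :=
      continuousOn_const.mul (M.continuous_L.continuousOn.mul (M.continuousOn_w h))
    refine (((hE.intervalIntegrable hl hX hcc 2).add (hE.intervalIntegrable hl hX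
      (hcc.mul (continuousOn_const.mul hf) (f := fun s => (2 * M.r s - M.n s) / (2 * M.L s))
        (g := fun s => 2 * (c * (M.L s * M.w s)))) 1)).add
      ((hcc.mul (hf.pow 2)).intervalIntegrable_of_Icc T.coe_nonneg)).congr fun s _ => ?_
    simp only [hF, Pi.mul_apply, Pi.pow_apply]
    ring
  have hFH : ∀ s, F s = κ s * (M.gam s * E s.toNNReal + G s) ^ 2 := fun s => by
    have := (M.gam_pos s).ne'
    have := (M.L_pos s).ne'
    simp only [hF, hκ, hG]
    field_simp
  have hF0 : ∀ s ∈ Icc (0 : ℝ) T, 0 ≤ F s := fun s hs => by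
    rw [hFH]; exact mul_nonneg (hκ0 s hs).le (sq_nonneg _)
  have hH : ∀ s t : ℝ, 0 ≤ s → s ≤ t → t ≤ T →
      M.gam t * E t.toNNReal ≤ M.gam s * E s.toNNReal := fun s t h0 hst ht => by
    have := hE.antitoneOn hXa (mem_Iic.2 (Real.toNNReal_le_iff_le_coe.2 (hst.trans ht)))
      (mem_Iic.2 (Real.toNNReal_le_iff_le_coe.2 ht)) (Real.toNNReal_mono hst)
    simpa only [Real.coe_toNNReal s h0, Real.coe_toNNReal t (h0.trans hst)] using this
  have key : ∀ u v : ℝ, a ≤ u → u ≤ v → v ≤ b → v - u = (b - a) / 3 →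
      (∀ s ∈ Icc u v, d ^ 2 ≤ (M.gam s * E s.toNNReal + G s) ^ 2) →
      κ s₀ * d ^ 2 * ((b - a) / 3) ≤ ∫ s in (0 : ℝ)..T, F s := by
    intro u v hu huv hv hlen hs
    have hu0 : 0 ≤ u := ha.trans hu
    have hvT : v ≤ T := hv.trans hb
    calc κ s₀ * d ^ 2 * ((b - a) / 3) = ∫ _ in u..v, κ s₀ * d ^ 2 := by
          rw [intervalIntegral.integral_const, hlen, smul_eq_mul]; ring
      _ ≤ ∫ s in u..v, F s := by
          refine intervalIntegral.integral_mono_on huv intervalIntegrable_const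
            (hFi.mono_set ?_) fun s hsm => ?_
          · rw [uIcc_of_le huv, uIcc_of_le T.coe_nonneg]
            exact Icc_subset_Icc hu0 hvT
          · have hsm' : s ∈ Icc (0 : ℝ) T := ⟨hu0.trans hsm.1, hsm.2.trans hvT⟩
            rw [hFH]
            exact mul_le_mul (hmin' s hsm') (hs s hsm) (sq_nonneg _) (hκ0 s hsm').le
      _ ≤ ∫ s in (0 : ℝ)..T, F s := by
          refine intervalIntegral.integral_mono_interval hu0 huv hvT ?_ hFi
          filter_upwards [ae_restrict_mem measurableSet_Ioc] with s hs
          exact hF0 s (Ioc_subset_Icc_self hs)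
  -- Comparison at `p` with the midpoint of `-G p` and `-G q`: above it, `γE + G ≥ d` on `[a, p]`;
  -- below it, `γE + G ≤ -d` on `[q, b]`.
  rcases le_or_gt (-((G p + G q) / 2)) (M.gam p * E p.toNNReal) with hcase | hcase
  · refine key a p le_rfl hpm.1 hpm.2 (by rw [hp]; ring) fun s hs => ?_
    have h1 := hH s p (ha.trans hs.1) hs.2 (hpm.2.trans hb)
    have h2 := hanti.antitoneOn ⟨hs.1, hs.2.trans hpm.2⟩ hpm hs.2
    refine pow_le_pow_left₀ hd.le ?_ 2
    linarith
  · refine key q b hqm.1 hqm.2 le_rfl (by rw [hq]; ring) fun s hs => ?_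
    have h1 := hH p s (ha.trans hpm.1) (hpq.le.trans hs.1) (hs.2.trans hb)
    have h2 := hanti.antitoneOn hqm ⟨hqm.1.trans hs.1, hs.2⟩ hs.1
    rw [← neg_sq (M.gam s * E s.toNNReal + G s)]
    refine pow_le_pow_left₀ hd.le ?_ 2
    linarith

/-! ### Pure sell programs when the depth increases faster than the resilience -/

/-- The positive part of the ratio `(ρ - η) / (2 ρ - η)`. -/
def wPos (M : Book) (t : ℝ) : ℝ :=
  max ((M.r t - M.n t) / M.r t) 0 / (1 + max ((M.r t - M.n t) / M.r t) 0)

theorem IsSmooth.wPos_of_le (hM : M.IsSmooth) {t : ℝ} (h : M.n t ≤ M.r t) :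
    M.wPos t = (M.r t - M.n t) / (2 * M.r t - M.n t) := by
  have hr := hM.r_pos t
  have h3 : 1 + (M.r t - M.n t) / M.r t = (2 * M.r t - M.n t) / M.r t := by
    field_simp
    ring
  rw [wPos, max_eq_left (div_nonneg (by linarith) hr.le), h3, div_div_div_cancel_right₀ hr.ne']

theorem IsSmooth.wPos_of_lt (hM : M.IsSmooth) {t : ℝ} (h : M.r t < M.n t) : M.wPos t = 0 := by
  rw [wPos, max_eq_right (div_nonpos_of_nonpos_of_nonneg (by linarith) (hM.r_pos t).le), zero_div]

/-- The map `y ↦ y / (1 + y)` is 1-Lipschitz on `[0, ∞)`. Defining `wPos` through it avoids the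
denominator `2r - n`, which may vanish where `r < n`. The Lipschitz bound makes strategies built
from `wPos` absolutely continuous. -/
theorem IsSmooth.exists_lipschitzOnWith_wPos (hM : M.IsSmooth) (T : ℝ≥0) :
    ∃ K, LipschitzOnWith K M.wPos (Icc 0 T) := by
  have hr := hM.contDiffOn_r.mono (Icc_subset_Ici_self : Icc (0 : ℝ) T ⊆ Ici 0)
  have hn := hM.contDiffOn_n.mono (Icc_subset_Ici_self : Icc (0 : ℝ) T ⊆ Ici 0)
  obtain ⟨K, hK⟩ := ((hr.sub hn).div hr fun t _ => (hM.r_pos t).ne').exists_lipschitzOnWith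
    (by decide) (convex_Icc _ _) isCompact_Icc
  have hK' : LipschitzOnWith (1 * K) (fun t => max ((M.r t - M.n t) / M.r t) 0) (Icc 0 T) :=
    (LipschitzWith.id.max_const (0 : ℝ)).comp_lipschitzOnWith hK
  refine ⟨1 * K, fun s hs t ht => le_trans ?_ (hK' hs ht)⟩
  simp only [wPos]
  generalize (M.r s - M.n s) / M.r s = y
  generalize (M.r t - M.n t) / M.r t = z
  have hy : 0 ≤ max y 0 := le_max_right _ _
  have hz : 0 ≤ max z 0 := le_max_right _ _
  generalize max y 0 = y at hy ⊢
  generalize max z 0 = z at hz ⊢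
  rw [edist_dist, edist_dist]
  refine ENNReal.ofReal_le_ofReal ?_
  rw [Real.dist_eq, Real.dist_eq]
  have e : y / (1 + y) - z / (1 + z) = (y - z) / ((1 + y) * (1 + z)) := by
    field_simp; ring
  rw [e, abs_div, abs_of_pos (a := (1 + y) * (1 + z)) (by positivity)]
  have h1 : 1 ≤ (1 + y) * (1 + z) := by nlinarith [mul_nonneg hy hz]
  exact div_le_self (abs_nonneg (y - z)) h1

/-- The effective depth over `[0, T]` for pure sell programs. -/
def depthPos (M : Book) (T : ℝ) : ℝ :=
  M.L T + ∫ s in (0 : ℝ)..T, M.L s * ((M.r s - M.n s) * M.wPos s)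

theorem IsSmooth.continuousOn_wPos (hM : M.IsSmooth) (T : ℝ≥0) :
    ContinuousOn M.wPos (Icc 0 T) := by
  obtain ⟨K, hK⟩ := hM.exists_lipschitzOnWith_wPos T
  exact hK.continuousOn

theorem IsSmooth.sub_mul_wPos_nonneg (hM : M.IsSmooth) (t : ℝ) :
    0 ≤ (M.r t - M.n t) * M.wPos t := by
  have hr := hM.r_pos t
  rcases le_or_gt (M.n t) (M.r t) with h | h
  · rw [hM.wPos_of_le h]
    exact mul_nonneg (by linarith) (div_nonneg (by linarith) (by linarith))
  · rw [hM.wPos_of_lt h, mul_zero]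

theorem IsSmooth.depthPos_pos (hM : M.IsSmooth) : 0 < M.depthPos T :=
  add_pos_of_pos_of_nonneg (M.L_pos T) (intervalIntegral.integral_nonneg T.coe_nonneg fun s _ =>
    mul_nonneg (M.L_pos s).le (hM.sub_mul_wPos_nonneg s))

theorem IsSmooth.intervalIntegrable_depthPos (hM : M.IsSmooth) (T : ℝ≥0) :
    IntervalIntegrable (fun s => M.L s * ((M.r s - M.n s) * M.wPos s)) volume 0 T :=
  (M.continuous_L.continuousOn.mul (M.continuous_sub.continuousOn.mul
    (hM.continuousOn_wPos T))).intervalIntegrable_of_Icc T.coe_nonneg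

/-- Where `n ≤ r` the square is completed as before. Where `r < n`, both the quadratic term and `(r
- n) φ` are nonnegative, so the best nonpositive impact there is zero, which is why `w` gives way to
its positive part. -/
theorem IsSmooth.le_impactFunctional_of_nonpos (hM : M.IsSmooth) (hx : 0 ≤ x)
    (h : ∀ t ∈ Icc (0 : ℝ) T, 0 ≤ 2 * M.r t - M.n t)
    (hφ : ∀ (c : ℝ → ℝ) (k : ℕ), ContinuousOn c (Icc 0 T) →
      IntervalIntegrable (fun s => c s * φ s ^ k) volume 0 T)
    (hneg : ∀ s ∈ Icc (0 : ℝ) T, φ s ≤ 0) :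
    x ^ 2 / (2 * M.depthPos T) ≤ M.impactFunctional T x φ := by
  have hK := hM.depthPos_pos (T := T)
  set c := x / M.depthPos T with hc
  have hc0 : 0 ≤ c := by positivity
  have i1 : IntervalIntegrable (fun s => (M.r s - M.n s) * φ s) volume 0 T := by
    simpa using hφ _ 1 M.continuous_sub.continuousOn
  have i2 := hφ _ 2 M.continuous_two_mul_sub_div.continuousOn
  have i3 := hM.intervalIntegrable_depthPos T
  have hmono : -c * (∫ s in (0 : ℝ)..T, (M.r s - M.n s) * φ s)
      - c ^ 2 / 2 * (∫ s in (0 : ℝ)..T, M.L s * ((M.r s - M.n s) * M.wPos s))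
      ≤ ∫ s in (0 : ℝ)..T, (2 * M.r s - M.n s) / (2 * M.L s) * φ s ^ 2 := by
    rw [← intervalIntegral.integral_const_mul, ← intervalIntegral.integral_const_mul,
      ← intervalIntegral.integral_sub (i1.const_mul _) (i3.const_mul _)]
    refine intervalIntegral.integral_mono_on T.coe_nonneg
      ((i1.const_mul _).sub (i3.const_mul _)) i2 fun s hs => ?_
    have hL := M.L_pos s
    have hs1 := hneg s hs
    rcases le_or_gt (M.n s) (M.r s) with hle | hlt
    · have h2 : 0 < 2 * M.r s - M.n s := two_mul_sub_pos hM (by linarith)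
      rw [hM.wPos_of_le hle]
      have e : (2 * M.r s - M.n s) / (2 * M.L s) * φ s ^ 2
          - (-c * ((M.r s - M.n s) * φ s) - c ^ 2 / 2 * (M.L s *
            ((M.r s - M.n s) * ((M.r s - M.n s) / (2 * M.r s - M.n s)))))
          = ((2 * M.r s - M.n s) * φ s + c * (M.L s * (M.r s - M.n s))) ^ 2
            / (2 * M.L s * (2 * M.r s - M.n s)) := by
        field_simp
        ring
      have : 0 ≤ ((2 * M.r s - M.n s) * φ s + c * (M.L s * (M.r s - M.n s))) ^ 2
            / (2 * M.L s * (2 * M.r s - M.n s)) := by positivity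
      linarith
    · rw [hM.wPos_of_lt hlt]
      have h1 : 0 ≤ (2 * M.r s - M.n s) / (2 * M.L s) * φ s ^ 2 :=
        mul_nonneg (div_nonneg (h s hs) (by positivity)) (sq_nonneg _)
      have h2 : 0 ≤ (M.r s - M.n s) * φ s := mul_nonneg_of_nonpos_of_nonpos (by linarith) hs1
      nlinarith [mul_nonneg hc0 h2]
  have hJ : ∫ s in (0 : ℝ)..T, M.L s * ((M.r s - M.n s) * M.wPos s)
      = M.depthPos T - M.L T := by rw [depthPos]; ring
  rw [hJ] at hmono
  rw [impactFunctional]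
  set I := ∫ s in (0 : ℝ)..T, (M.r s - M.n s) * φ s
  have hL := M.L_pos T
  -- Tangent line of the square at `c * M.L T`; its `c * I` cancels against `hmono`.
  have hq : c * (x + I) - c ^ 2 * M.L T / 2 ≤ (x + I) ^ 2 / (2 * M.L T) := by
    rw [le_div_iff₀ (by positivity)]
    nlinarith [sq_nonneg (x + I - c * M.L T)]
  have e : x ^ 2 / (2 * M.depthPos T) = c * x - c ^ 2 * M.depthPos T / 2 := by
    rw [hc]; field_simp; ring
  rw [e]
  linarith

/-- Starting from the best nonpositive impact, a small positive impact proportional to `(n - r)⁺` is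
added where `r < n`. This increases the number of shares that can be liquidated to first order,
which beats the bound valid for sell programs. -/
theorem IsSmooth.exists_impactFunctional_lt (hM : M.IsSmooth) (hT : 0 < T)
    (hneg : ∃ t ∈ Icc (0 : ℝ) T, M.r t - M.n t < 0) :
    ∃ (x : ℝ) (φ : ℝ → ℝ), 0 < x ∧ AbsolutelyContinuousOnInterval φ 0 T ∧
      M.impactFunctional T x φ < x ^ 2 / (2 * M.depthPos T) := by
  have hT' : (0 : ℝ) < T := hT
  have hK := hM.depthPos_pos (T := T)
  obtain ⟨R, hR⟩ := exists_abs_le_of_continuous M.continuous_r T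
  have hR' : ∀ s ∈ Icc (0 : ℝ) T, M.r s ≤ R := fun s hs => (le_abs_self _).trans (hR s hs)
  have hR0 : 0 < R := (hM.r_pos 0).trans_le (hR' 0 ⟨le_rfl, T.coe_nonneg⟩)
  set m : ℝ → ℝ := fun s => max (M.n s - M.r s) 0 with hm
  have hmc : Continuous m := (M.continuous_n.sub M.continuous_r).max continuous_const
  have hmac : AbsolutelyContinuousOnInterval m 0 T := by
    have hr := hM.contDiffOn_r.mono (Icc_subset_Ici_self : Icc (0 : ℝ) T ⊆ Ici 0)
    have hn := hM.contDiffOn_n.mono (Icc_subset_Ici_self : Icc (0 : ℝ) T ⊆ Ici 0)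
    obtain ⟨K, hK⟩ := (hn.sub hr).exists_lipschitzOnWith (by decide) (convex_Icc _ _) isCompact_Icc
    rw [← uIcc_of_le T.coe_nonneg] at hK
    exact ((LipschitzWith.id.max_const (0 : ℝ)).comp_lipschitzOnWith
      hK).absolutelyContinuousOnInterval
  have hwac : AbsolutelyContinuousOnInterval M.wPos 0 T := by
    obtain ⟨K, hK⟩ := hM.exists_lipschitzOnWith_wPos T
    rw [← uIcc_of_le T.coe_nonneg] at hK
    exact hK.absolutelyContinuousOnInterval
  have hLac : AbsolutelyContinuousOnInterval M.L 0 T :=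
    ContDiffOn.absolutelyContinuousOnInterval M.contDiff_L.contDiffOn
  have hwc := hM.continuousOn_wPos T
  set J := ∫ s in (0 : ℝ)..T, M.L s * m s ^ 2 with hJ
  have hJi : IntervalIntegrable (fun s => M.L s * m s ^ 2) volume 0 T :=
    (M.continuous_L.mul (hmc.pow 2)).intervalIntegrable _ _
  have hJ0 : 0 < J := by
    refine intervalIntegral.integral_pos hT' (M.continuous_L.mul (hmc.pow 2)).continuousOn
      (fun s _ => mul_nonneg (M.L_pos s).le (sq_nonneg _)) ?_
    obtain ⟨t, ht, hlt⟩ := hneg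
    have : 0 < m t := lt_max_of_lt_left (by linarith)
    exact ⟨t, ht, mul_pos (M.L_pos t) (by positivity)⟩
  have hi := hM.intervalIntegrable_depthPos T
  have hD : ∫ s in (0 : ℝ)..T, M.L s * ((M.r s - M.n s) * M.wPos s)
      = M.depthPos T - M.L T := by rw [depthPos]; ring
  -- The position is chosen so that `x + ∫ (r - n) φ = L_T`. The cost is then at most `x / 2`, which
  -- is below `x² / (2 depthPos)` because `x` exceeds `depthPos`.
  refine ⟨M.depthPos T + R⁻¹ * J, fun s => -(M.L s * (M.wPos s - R⁻¹ * m s)), by positivity,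
    (hLac.mul (hwac.sub (hmac.const_mul _))).neg, ?_⟩
  have e1 : ∫ s in (0 : ℝ)..T, (M.r s - M.n s) * -(M.L s * (M.wPos s - R⁻¹ * m s))
      = -(M.depthPos T - M.L T + R⁻¹ * J) := by
    rw [← hD, hJ, ← intervalIntegral.integral_const_mul,
      ← intervalIntegral.integral_add hi (hJi.const_mul _), ← intervalIntegral.integral_neg]
    refine intervalIntegral.integral_congr fun s _ => ?_
    simp only [hm]
    rcases le_total (M.n s) (M.r s) with hle | hle
    · rw [max_eq_right (by linarith)]; ring
    · rw [max_eq_left (by linarith)]; ring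
  have e2 : ∫ s in (0 : ℝ)..T, (2 * M.r s - M.n s) / (2 * M.L s)
      * (-(M.L s * (M.wPos s - R⁻¹ * m s))) ^ 2
      ≤ 1 / 2 * (M.depthPos T - M.L T) + R⁻¹ / 2 * J := by
    rw [← hD, hJ, ← intervalIntegral.integral_const_mul, ← intervalIntegral.integral_const_mul,
      ← intervalIntegral.integral_add (hi.const_mul _) (hJi.const_mul _)]
    refine intervalIntegral.integral_mono_on T.coe_nonneg ?_
      ((hi.const_mul _).add (hJi.const_mul _)) fun s hs => ?_
    · exact (M.continuous_two_mul_sub_div.continuousOn.mul ((M.continuous_L.continuousOn.mul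
        (hwc.sub (continuousOn_const.mul hmc.continuousOn))).neg.pow 2)).intervalIntegrable_of_Icc
          T.coe_nonneg
    have hL := M.L_pos s
    have hr := hM.r_pos s
    simp only [hm]
    rcases le_or_gt (M.n s) (M.r s) with hle | hlt
    · have h2 : 2 * M.r s - M.n s ≠ 0 := (two_mul_sub_pos hM (by linarith)).ne'
      rw [max_eq_right (by linarith), hM.wPos_of_le hle]
      apply le_of_eq
      field_simp
      ring
    · rw [max_eq_left (by linarith), hM.wPos_of_lt hlt]
      -- Where `r < n` one has `2r - n < r ≤ R`; this is why the perturbation is scaled by `R⁻¹`.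
      have h3 : (2 * M.r s - M.n s) * R⁻¹ ≤ 1 := by
        rw [← div_eq_mul_inv, div_le_one hR0]
        linarith [hR' s hs]
      have e : (2 * M.r s - M.n s) / (2 * M.L s) * (-(M.L s * (0 - R⁻¹ * (M.n s - M.r s)))) ^ 2
          = ((2 * M.r s - M.n s) * R⁻¹) * (R⁻¹ / 2 * (M.L s * (M.n s - M.r s) ^ 2)) := by
        field_simp
        ring
      rw [e, mul_zero, mul_zero, mul_zero, zero_add]
      exact mul_le_of_le_one_left (by positivity) h3
  rw [impactFunctional, e1]
  have hL := (M.L_pos T).ne'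
  have e3 : (M.depthPos T + R⁻¹ * J + -(M.depthPos T - M.L T + R⁻¹ * J)) ^ 2 / (2 * M.L T)
      = M.L T / 2 := by
    field_simp
    ring
  rw [e3]
  have hε : 0 < R⁻¹ * J := by positivity
  have e4 : (M.depthPos T + R⁻¹ * J) / 2 < (M.depthPos T + R⁻¹ * J) ^ 2 / (2 * M.depthPos T) := by
    rw [lt_div_iff₀ (by positivity)]
    nlinarith
  linarith

end Book

/-! ### Price manipulation -/

section

variable {Ω : Type*} {mΩ : MeasurableSpace Ω} {P : Measure Ω}
  {ℱ : Filtration ℝ≥0 mΩ} {S : ℝ≥0 → Ω → ℝ} {T : ℝ≥0} {x : ℝ} {M : Book} {lam rho : ℝ → ℝ}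

theorem admitsPMS_of_neg [IsProbabilityMeasure P] (hM : M.Extends lam rho) (hS : Martingale S ℱ P)
    (hSr : ∀ ω t, ContinuousWithinAt (fun s => S s ω) (Ici t) t) (hT : 0 < T)
    (h : ∃ t ∈ Icc (0 : ℝ) T, 2 * M.r t - M.n t < 0) :
    AdmitsPMS P ℱ S blockShape lam rho T := by
  obtain ⟨t, ht, hneg⟩ := h
  obtain ⟨a, b, ha, hab, hb, hneg⟩ := exists_Icc_neg (NNReal.coe_pos.2 hT)
    M.continuous_two_mul_sub.continuousOn ht hneg
  obtain ⟨φ, hφ, hlt⟩ := Book.exists_impactFunctional_neg ha hab hb hneg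
  refine ⟨M.strategy P ℱ T 0 hφ, _, Book.strategy_isVolumeImpactP hM hφ, ?_⟩
  rw [Book.cost_strategy hM hS hSr hφ]
  simpa using hlt

theorem not_admitsPMS_iff [IsProbabilityMeasure P] (hM : M.Extends lam rho) (hS : Martingale S ℱ P)
    (hSr : ∀ ω t, ContinuousWithinAt (fun s => S s ω) (Ici t) t) (hT : 0 < T) :
    ¬ AdmitsPMS P ℱ S blockShape lam rho T ↔ ∀ t ∈ Icc (0 : ℝ) T, 0 ≤ 2 * M.r t - M.n t := by
  constructor
  · contrapose!
    exact admitsPMS_of_neg hM hS hSr hT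
  · rintro h ⟨X, E, hE, hlt⟩
    have := X.le_cost hM hS hSr ((Strategy.isVolumeImpactP_iff hM X E).1 hE) (c := 0)
      (ae_of_all _ fun ω => Book.impactFunctional_nonneg h)
    simp only [neg_zero, zero_mul, add_zero] at this
    exact absurd hlt this.not_gt

theorem admitsTTPM_of_lt {X : Strategy P ℱ T x} {E : ℝ≥0 → Ω → ℝ}
    (hE : X.IsVolumeImpactP blockShape lam rho E) {c : ℝ} (hlt : X.cost blockShape lam S E < c)
    (hc : ∀ (Y : Strategy P ℱ T x) (E' : ℝ≥0 → Ω → ℝ), Y.IsVolumeImpactP blockShape lam rho E' →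
      Y.IsMonotone → c ≤ Y.cost blockShape lam S E') :
    AdmitsTTPM P ℱ S blockShape lam rho T := by
  refine ⟨x, X, E, hE, (EReal.coe_lt_coe hlt).trans_le (le_sInf ?_)⟩
  rintro _ ⟨Y, E', hE', hY, rfl⟩
  exact EReal.coe_le_coe (hc Y E' hE' hY)

/-- Only pure sell programs liquidate a long position monotonically. -/
theorem Strategy.IsMonotone.ae_antitone [IsProbabilityMeasure P] {X : Strategy P ℱ T x} (hX : X.IsMonotone) (hx : 0 < x) :
    ∀ᵐ ω ∂P, Antitone fun s => X.X s ω := by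
  refine hX.resolve_right fun h => ?_
  obtain ⟨ω, hω⟩ := h.exists
  have h1 : X.X 0 ω ≤ X.X (T + 1) ω := hω zero_le
  rw [X.initial, X.terminal _ (lt_add_one T)] at h1
  exact hx.not_ge h1

/-- Monotone round trips do not trade. -/
theorem Strategy.IsMonotone.ae_eq_zero {X : Strategy P ℱ T 0} (hX : X.IsMonotone) :
    ∀ᵐ ω ∂P, ∀ t, X.X t ω = 0 := by
  have hend : ∀ t ω, X.X (max t (T + 1)) ω = 0 := fun t ω =>
    X.terminal _ (lt_max_of_lt_right (lt_add_one T)) ω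
  rcases hX with h | h
  all_goals
    filter_upwards [h] with ω hω t
    have h1 := hω (zero_le : 0 ≤ t)
    have h2 := hω (le_max_left t (T + 1))
    simp only [X.initial, hend] at h1 h2
    exact le_antisymm ‹_› ‹_›

/-- Taken with `x = 0`: the profitable round trip costs less than every monotone round trip, all of
which have zero cost. -/
theorem admitsTTPM_of_two_mul_sub_neg [IsProbabilityMeasure P] (hM : M.Extends lam rho) (hS : Martingale S ℱ P)
    (hSr : ∀ ω t, ContinuousWithinAt (fun s => S s ω) (Ici t) t) (hT : 0 < T)
    (h : ∃ t ∈ Icc (0 : ℝ) T, 2 * M.r t - M.n t < 0) :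
    AdmitsTTPM P ℱ S blockShape lam rho T := by
  obtain ⟨X, E, hE, hlt⟩ := admitsPMS_of_neg hM hS hSr hT h
  refine admitsTTPM_of_lt hE hlt fun Y E' hE' hY => ?_
  have hI := (Strategy.isVolumeImpactP_iff hM Y E').1 hE'
  have := Y.le_cost hM hS hSr hI (c := 0) ?_
  · simpa using this
  filter_upwards [hY.ae_eq_zero] with ω hω
  rw [M.impactFunctional_congr T 0 (ψ := fun _ => 0) fun s hs =>
    (hI ω).eq_zero_of_const (fun t => by rw [hω, hω]) (Real.toNNReal_le_iff_le_coe.2 hs.2)]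
  simp [Book.impactFunctional]

theorem admitsTTPM_of_sub_neg [IsProbabilityMeasure P] (hM : M.Extends lam rho) (hMs : M.IsSmooth) (hS : Martingale S ℱ P)
    (hSr : ∀ ω t, ContinuousWithinAt (fun s => S s ω) (Ici t) t) (hT : 0 < T)
    (h : ∃ t ∈ Icc (0 : ℝ) T, M.r t - M.n t < 0) :
    AdmitsTTPM P ℱ S blockShape lam rho T := by
  by_cases h2 : ∃ t ∈ Icc (0 : ℝ) T, 2 * M.r t - M.n t < 0
  · exact admitsTTPM_of_two_mul_sub_neg hM hS hSr hT h2
  push Not at h2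
  obtain ⟨x, φ, hx, hφ, hlt⟩ := hMs.exists_impactFunctional_lt hT h
  refine admitsTTPM_of_lt (X := M.strategy P ℱ T x hφ) (S := S)
    (Book.strategy_isVolumeImpactP hM hφ)
    (c := -x * ∫ ω, S 0 ω ∂P + x ^ 2 / (2 * M.depthPos T)) ?_ fun Y E' hE' hY => ?_
  · rw [Book.cost_strategy hM hS hSr hφ]
    linarith
  · have hI := (Strategy.isVolumeImpactP_iff hM Y E').1 hE'
    refine Y.le_cost hM hS hSr hI ?_
    filter_upwards [hY.ae_antitone hx] with ω hω
    refine hMs.le_impactFunctional_of_nonpos hx.le h2 (fun c k hc => (hI ω).intervalIntegrable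
      (Y.left_continuous ω) (Y.finite_variation ω) hc k) fun s hs => ?_
    exact (hI ω).nonpos_of_antitone hω (Real.toNNReal_le_iff_le_coe.2 hs.2)

/-- One share suffices: the optimal strategy costs strictly less than the sell programs, which
exceed its cost by a fixed `δ`. -/
theorem admitsTTPM_of_deriv_neg [IsProbabilityMeasure P] (hM : M.Extends lam rho) (hMs : M.IsSmooth)
    (hS : Martingale S ℱ P) (hSr : ∀ ω t, ContinuousWithinAt (fun s => S s ω) (Ici t) t)
    (hT : 0 < T) (h1 : ∀ t ∈ Icc (0 : ℝ) T, 0 ≤ M.r t - M.n t)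
    (h2 : ∃ t ∈ Icc (0 : ℝ) T, derivWithin M.w (Ici 0) t + M.r t * M.w t < 0) :
    AdmitsTTPM P ℱ S blockShape lam rho T := by
  have h : ∀ t ∈ Icc (0 : ℝ) T, 0 < 2 * M.r t - M.n t := fun t ht =>
    Book.two_mul_sub_pos hMs (h1 t ht)
  obtain ⟨t, ht, hneg⟩ := h2
  obtain ⟨a, b, ha, hab, hb, hneg⟩ := exists_Icc_neg (NNReal.coe_pos.2 hT)
    ((hMs.continuousOn_derivWithin_w h).add (M.continuous_r.continuousOn.mul
      (M.continuousOn_w h))) ht hneg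
  obtain ⟨δ, hδ, hle⟩ := hMs.exists_add_le_impactFunctional_of_antitone h ha hab hb hneg one_pos
  have hφ := hMs.absolutelyContinuous_optimal (x := 1) h
  refine admitsTTPM_of_lt (X := M.strategy P ℱ T 1 hφ) (S := S)
    (Book.strategy_isVolumeImpactP hM hφ)
    (c := -1 * ∫ ω, S 0 ω ∂P + (1 ^ 2 / (2 * M.depth T) + δ)) ?_ fun Y E' hE' hY => ?_
  · rw [Book.cost_strategy hM hS hSr hφ, Book.impactFunctional_optimal h]
    linarith
  · have hI := (Strategy.isVolumeImpactP_iff hM Y E').1 hE'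
    refine Y.le_cost hM hS hSr hI ?_
    filter_upwards [hY.ae_antitone one_pos] with ω hω
    exact hle _ _ (hI ω) (Y.left_continuous ω) (Y.finite_variation ω) hω

/-- The unconstrained minimiser is itself a monotone strategy, so the infimum over monotone programs
is already the global lower bound. -/
theorem not_admitsTTPM [IsProbabilityMeasure P] (hM : M.Extends lam rho) (hMs : M.IsSmooth)
    (hS : Martingale S ℱ P) (hSr : ∀ ω t, ContinuousWithinAt (fun s => S s ω) (Ici t) t)
    (h1 : ∀ t ∈ Icc (0 : ℝ) T, 0 ≤ M.r t - M.n t)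
    (h2 : ∀ t ∈ Icc (0 : ℝ) T, 0 ≤ derivWithin M.w (Ici 0) t + M.r t * M.w t) :
    ¬ AdmitsTTPM P ℱ S blockShape lam rho T := by
  have h : ∀ t ∈ Icc (0 : ℝ) T, 0 < 2 * M.r t - M.n t := fun t ht =>
    Book.two_mul_sub_pos hMs (h1 t ht)
  rintro ⟨x, X, E, hE, hlt⟩
  have hI := (Strategy.isVolumeImpactP_iff hM X E).1 hE
  have hφ := hMs.absolutelyContinuous_optimal (x := x) h
  have hmono : (M.strategy P ℱ T x hφ).IsMonotone :=
    (hMs.antitone_or_monotone_holdings_optimal x h1 h2).imp (fun h => ae_of_all _ fun _ => h)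
      fun h => ae_of_all _ fun _ => h
  have hle := sInf_le (a := (((M.strategy P ℱ T x hφ).cost blockShape lam S
    fun t _ => if 0 < t then M.optimal T x t else 0 : ℝ) : EReal))
    (s := {c : EReal | ∃ (Y : Strategy P ℱ T x) (E' : ℝ≥0 → Ω → ℝ),
        Y.IsVolumeImpactP blockShape lam rho E' ∧ Y.IsMonotone ∧
          c = (Y.cost blockShape lam S E' : EReal)})
    ⟨_, _, Book.strategy_isVolumeImpactP hM hφ, hmono, rfl⟩
  have hlt' := EReal.coe_lt_coe_iff.1 (hlt.trans_le hle)
  rw [Book.cost_strategy hM hS hSr hφ, Book.impactFunctional_optimal h] at hlt'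
  refine hlt'.not_ge (X.le_cost hM hS hSr hI (ae_of_all _ fun ω => ?_))
  refine le_trans ?_ (M.le_impactFunctional h fun c k hc => (hI ω).intervalIntegrable
    (X.left_continuous ω) (X.finite_variation ω) hc k)
  refine le_add_of_nonneg_right (intervalIntegral.integral_nonneg T.coe_nonneg fun s hs => ?_)
  exact mul_nonneg (div_nonneg (h s hs).le (mul_pos two_pos (M.L_pos s)).le) (sq_nonneg _)

theorem not_admitsTTPM_iff [IsProbabilityMeasure P] (hM : M.Extends lam rho) (hMs : M.IsSmooth)
    (hS : Martingale S ℱ P) (hSr : ∀ ω t, ContinuousWithinAt (fun s => S s ω) (Ici t) t)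
    (hT : 0 < T) :
    ¬ AdmitsTTPM P ℱ S blockShape lam rho T ↔ ∀ t ∈ Icc (0 : ℝ) T, 0 ≤ M.r t - M.n t ∧
      0 ≤ derivWithin M.w (Ici 0) t + M.r t * M.w t := by
  refine ⟨fun hn => ?_, fun h => not_admitsTTPM hM hMs hS hSr (fun t ht => (h t ht).1)
    fun t ht => (h t ht).2⟩
  -- This condition has to be settled before the other: it keeps `2r - n` positive, so that `w` is
  -- differentiable and the square can be completed.
  have h1 : ∀ t ∈ Icc (0 : ℝ) T, 0 ≤ M.r t - M.n t := by
    by_contra! hc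
    exact hn (admitsTTPM_of_sub_neg hM hMs hS hSr hT hc)
  refine fun t ht => ⟨h1 t ht, ?_⟩
  by_contra! hc
  exact hn (admitsTTPM_of_deriv_neg hM hMs hS hSr hT h1 ⟨t, ht, hc⟩)

end

/-- A property of all `[0, T]` is a property of `[0, ∞)`. -/
theorem forall_Icc_iff_forall_nonneg {p : ℝ → Prop} :
    (∀ T : ℝ≥0, 0 < T → ∀ t ∈ Icc (0 : ℝ) T, p t) ↔ ∀ t, 0 ≤ t → p t := by
  refine ⟨fun h t ht => h (t.toNNReal + 1) (by positivity) t ⟨ht, ?_⟩, fun h T _ t ht => h t ht.1⟩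
  rw [NNReal.coe_add, Real.coe_toNNReal t ht, NNReal.coe_one]
  linarith

end LOB

end

/-! ### Fixed and arbitrary trading periods -/

theorem mainTheorem11
    {Ω : Type*} {mΩ : MeasurableSpace Ω} (P : Measure Ω) [IsProbabilityMeasure P]
    (ℱ : Filtration ℝ≥0 mΩ) (S : ℝ≥0 → Ω → ℝ) (hS : Martingale S ℱ P)
    (hSr : ∀ ω t, ContinuousWithinAt (fun s => S s ω) (Ici t) t)
    (lam rho : ℝ → ℝ)
    (hlam : ContDiffOn ℝ 2 lam (Ici 0)) (hlam_pos : ∀ t, 0 ≤ t → 0 < lam t)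
    (hrho : ContDiffOn ℝ 1 rho (Ici 0)) (hrho_pos : ∀ t, 0 ≤ t → 0 < rho t) :
    -- a fixed trading period `[0, T]`
    (∀ T : ℝ≥0, 0 < T →
      (¬ LOB.AdmitsPMS P ℱ S LOB.blockShape lam rho T ↔
        ∀ t ∈ Icc (0 : ℝ) T, 0 ≤ 2 * rho t - LOB.eta lam t) ∧
      (¬ LOB.AdmitsTTPM P ℱ S LOB.blockShape lam rho T ↔
        ∀ t ∈ Icc (0 : ℝ) T, 0 ≤ rho t - LOB.eta lam t ∧
          0 ≤ derivWithin (LOB.ratio lam rho) (Ici 0) t + rho t * LOB.ratio lam rho t)) ∧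
    -- all trading periods
    ((∀ T : ℝ≥0, 0 < T → ¬ LOB.AdmitsPMS P ℱ S LOB.blockShape lam rho T) ↔
      ∀ t : ℝ, 0 ≤ t → 0 ≤ 2 * rho t - LOB.eta lam t) ∧
    ((∀ T : ℝ≥0, 0 < T → ¬ LOB.AdmitsTTPM P ℱ S LOB.blockShape lam rho T) ↔
      ∀ t : ℝ, 0 ≤ t → 0 ≤ rho t - LOB.eta lam t ∧
        0 ≤ derivWithin (LOB.ratio lam rho) (Ici 0) t + rho t * LOB.ratio lam rho t) := by
  obtain ⟨M, hM, hMs⟩ := LOB.exists_book hlam hlam_pos hrho hrho_pos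
  have hw : EqOn (LOB.ratio lam rho) M.w (Ici 0) := fun t ht => by
    rw [LOB.ratio, LOB.Book.w, hM.r_eq t ht, hM.n_eq t ht]
  have hPMS : ∀ T : ℝ≥0, 0 < T → (¬ LOB.AdmitsPMS P ℱ S LOB.blockShape lam rho T ↔
      ∀ t ∈ Icc (0 : ℝ) T, 0 ≤ 2 * rho t - LOB.eta lam t) := fun T hT => by
    rw [LOB.not_admitsPMS_iff hM hS hSr hT]
    refine forall₂_congr fun t ht => ?_
    rw [hM.r_eq t ht.1, hM.n_eq t ht.1]
  have hTTPM : ∀ T : ℝ≥0, 0 < T → (¬ LOB.AdmitsTTPM P ℱ S LOB.blockShape lam rho T ↔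
      ∀ t ∈ Icc (0 : ℝ) T, 0 ≤ rho t - LOB.eta lam t ∧
        0 ≤ derivWithin (LOB.ratio lam rho) (Ici 0) t + rho t * LOB.ratio lam rho t) :=
    fun T hT => by
    rw [LOB.not_admitsTTPM_iff hM hMs hS hSr hT]
    refine forall₂_congr fun t ht => ?_
    -- The derivative within `[0, ∞)` sees only values there, where the extended book agrees with
    -- the given one.
    rw [derivWithin_congr hw (hw ht.1), hw ht.1, hM.r_eq t ht.1, hM.n_eq t ht.1]
  refine ⟨fun T hT => ⟨hPMS T hT, hTTPM T hT⟩, ?_, ?_⟩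
  · rw [← LOB.forall_Icc_iff_forall_nonneg]
    exact forall₂_congr hPMS
  · rw [← LOB.forall_Icc_iff_forall_nonneg]
    exact forall₂_congr hTTPM
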